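/- Let $p$ be a prime, let $k$ be an $F$-finite field of characteristic $p$, let $R$ be essentially of finite type over $k$, and let $f\colon \operatorname{Spec} S\to\operatorname{Spec} R$ be a smooth morphism (so $S$ is also essentially of finite type over $k$). Let $\mathfrak a\subseteq R$ be an ideal and let $(M,\kappa)$ be a coherent Cartier module, that is, a finitely generated $R$-module with an additive map $\kappa\colon M\to M$ satisfying $\kappa(r^pm)=r\kappa(m)$. Let $t\ge 0$ be a rational number. For a Cartier module $(N,\kappa)$ over a ring $A$ and an ideal $\mathfrak b\subseteq A$ put $\mathcal C_+N'=\sum_{e\ge1}\kappa^e(\mathfrak b^{\lceil tp^e\rceil}N')$ for submodules $N'\subseteq N$, and let $\underline N=(\mathcal C_+)^hN$ for $h\gg0$. The test module $\tau(N,\mathfrak b^t)$ is the smallest submodule $N'\subseteq N$ with $\mathcal C_+N'\subseteq N'$ and $N'_\eta=\underline N_\eta$ for every generic point $\eta$ of $\operatorname{Supp}\underline N$. Let $f^!M=\omega_f\otimes_R M$, where $\omega_f$ is the highest exterior power of $\Omega_{S/R}$ (that is, $\bigwedge^n\Omega_{S/R}$ where the relative dimension is $n$). It carries exactly one Cartier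 structure $\kappa'$ (the composite of the relative Cartier operator tensored with $M$ and of $\mathrm{id}\otimes\kappa$) that satisfies, on the locus of relative dimension $n$, for all $x_1,\dots,x_n\in S$ and $m\in M$, $$\kappa'\big((x_1\cdots x_n)^{p-1}dx_1\wedge\dots\wedge dx_n\otimes m\big)=dx_1\wedge\dots\wedge dx_n\otimes\kappa(m)$$ and, if $n\ge1$, $\kappa'(dx_1\wedge\dots\wedge dx_n\otimes m)=0$. Then the test modules $\tau(M,\mathfrak a^t)$ and $\tau(f^!M,(\mathfrak aS)^t)$ exist (in both cases the chain of the $(\mathcal C_+)^h$ becomes stationary and there is a smallest submodule as above), and $$f^!\big(\tau(M,\mathfrak a^t)\big)=\tau\big(f^!M,(\mathfrak aS)^t\big)$$ as submodules of $f^!M$, where $f^!N\subseteq f^!M$ denotes the image of $\omega_f\otimes_RN$ for $N\subseteq M$. -/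

import Mathlib

open scoped TensorProduct

noncomputable section

namespace CartierModule

/-! ### Cartier modules and test modules -/

section TestModules

/-- A Cartier structure on an `R`-module `M` in characteristic `p`: an additive map `κ : M → M`
with `κ (r ^ p • m) = r • κ m`, that is, an `R`-linear map `F_* M → M`, where `F` is the Frobenius
of `R`. -/
structure CartierStructure (p : ℕ) (R M : Type*) [CommRing R] [AddCommGroup M] [Module R M]
    extends M →+ M where
  map_pow_smul' : ∀ (r : R) (m : M), toFun (r ^ p • m) = r • toFun m

variable {p : ℕ} {R M : Type*} [CommRing R] [AddCommGroup M] [Module R M]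

instance : FunLike (CartierStructure p R M) M M where
  coe κ := κ.toFun
  coe_injective κ κ' h := by
    cases κ; cases κ'; congr; exact DFunLike.coe_injective h

instance : AddMonoidHomClass (CartierStructure p R M) M M where
  map_add κ := κ.map_add'
  map_zero κ := κ.map_zero'

instance : Inhabited (CartierStructure p R M) :=
  ⟨{ (0 : M →+ M) with map_pow_smul' := fun r _ => (smul_zero r).symm }⟩

theorem CartierStructure.map_pow_smul (κ : CartierStructure p R M) (r : R) (m : M) :
    κ (r ^ p • m) = r • κ m :=
  κ.map_pow_smul' r m

/-- The image `κ(N)` of a submodule `N`; it is again a submodule. -/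
def CartierStructure.image (κ : CartierStructure p R M) (N : Submodule R M) : Submodule R M where
  carrier := κ '' N
  add_mem' := by
    rintro _ _ ⟨x, hx, rfl⟩ ⟨y, hy, rfl⟩
    exact ⟨x + y, N.add_mem hx hy, map_add κ x y⟩
  zero_mem' := ⟨0, N.zero_mem, map_zero κ⟩
  smul_mem' := by
    rintro r _ ⟨x, hx, rfl⟩
    exact ⟨r ^ p • x, N.smul_mem _ hx, κ.map_pow_smul r x⟩

/-- Let `𝒞` be the Cartier algebra `κ^{𝔞^t}`, with `𝒞_0 = R` and
`𝒞_e = κ^e 𝔞^⌈t p^e⌉` for `e ≥ 1`. This is `𝒞_+ N = ∑_{e ≥ 1} κ^e (𝔞^⌈t p^e⌉ N)`. -/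
def plusAct (κ : CartierStructure p R M) (𝔞 : Ideal R) (t : ℚ) (N : Submodule R M) :
    Submodule R M :=
  ⨆ (e : ℕ) (_ : 1 ≤ e), κ.image^[e] (𝔞 ^ ⌈t * (p : ℚ) ^ e⌉₊ • N)

/-- `N` is a Cartier submodule of `M` for the algebra `κ^{𝔞^t}`. -/
def IsCartierSubmodule (κ : CartierStructure p R M) (𝔞 : Ideal R) (t : ℚ)
    (N : Submodule R M) : Prop :=
  plusAct κ 𝔞 t N ≤ N

/-- The `F`-pure part `(𝒞_+)^h M`, `h ≫ 0`, of `M` for the algebra `𝒞 = κ^{𝔞^t}`, written as the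
intersection of the decreasing chain of the `(𝒞_+)^h M`. -/
def fPurePart (κ : CartierStructure p R M) (𝔞 : Ideal R) (t : ℚ) : Submodule R M :=
  ⨅ h : ℕ, (plusAct κ 𝔞 t)^[h] ⊤

/-- `N` agrees generically with `P`: one has `N_η = P_η` for every generic point `η` of the
support of `P`. -/
def GenericallyAgrees (N P : Submodule R M) : Prop :=
  ∀ η : PrimeSpectrum R, Minimal (· ∈ Module.support R P) η →
    N.localized η.asIdeal.primeCompl = P.localized η.asIdeal.primeCompl

/-- The Cartier submodules of `M` that agree generically with the `F`-pure part of `M`. -/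
def testCandidates (κ : CartierStructure p R M) (𝔞 : Ideal R) (t : ℚ) : Set (Submodule R M) :=
  {N | IsCartierSubmodule κ 𝔞 t N ∧ GenericallyAgrees N (fPurePart κ 𝔞 t)}

/-- The test module `τ(M, 𝔞^t)`: the smallest Cartier submodule of `M` that agrees generically
with the `F`-pure part of `M`. -/
def testModule (κ : CartierStructure p R M) (𝔞 : Ideal R) (t : ℚ) : Submodule R M :=
  sInf (testCandidates κ 𝔞 t)

/-- The test module exists: the chain of the `(𝒞_+)^h M` becomes stationary, with value the
`F`-pure part, and there is a smallest Cartier submodule that agrees generically with it. -/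
def TestModuleExists (κ : CartierStructure p R M) (𝔞 : Ideal R) (t : ℚ) : Prop :=
  (∃ h₀ : ℕ, ∀ h ≥ h₀, (plusAct κ 𝔞 t)^[h] ⊤ = fPurePart κ 𝔞 t) ∧
    IsLeast (testCandidates κ 𝔞 t) (testModule κ 𝔞 t)

end TestModules

/-! ### The functor `f^!` for a smooth morphism `f : Spec S → Spec R` -/

section Shriek

variable (R S : Type*) [CommRing R] [CommRing S] [Algebra R S]

/-- The idempotents of `S` whose (open and closed) support lies in the locus where `S` has relative
dimension `n` over `R`. -/
def relDimIdempotents (n : ℕ) : Set S :=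
  {e | IsIdempotentElem e ∧
    ∀ q : PrimeSpectrum S, e ∉ q.asIdeal → Module.rankAtStalk (Ω[S⁄R]) q = n}

/-- The relative dualizing module `ω_f` of a smooth `R`-algebra `S`: the highest exterior power of
`Ω_{S/R}`. It is `⋀^n Ω_{S/R}` on the open and closed locus of relative dimension `n`. -/
def relDualizing : Submodule S (ExteriorAlgebra S (Ω[S⁄R])) :=
  ⨆ n : ℕ, Ideal.span (relDimIdempotents R S n) • ⋀[S]^n (Ω[S⁄R])

/-- The twisted inverse image `f^! M = ω_f ⊗_S (S ⊗_R M) = ω_f ⊗_R M`. -/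
abbrev Shriek (M : Type*) [AddCommGroup M] [Module R M] : Type _ :=
  relDualizing R S ⊗[R] M

variable {S}

/-- The top form `e dx_1 ∧ ⋯ ∧ dx_n`, where `e` is an idempotent supported in the locus of relative
dimension `n`. -/
def topForm {n : ℕ} (e : relDimIdempotents R S n) (x : Fin n → S) : relDualizing R S :=
  ⟨(e : S) • ExteriorAlgebra.ιMulti S n fun i => KaehlerDifferential.D R S (x i),
    Submodule.mem_iSup_of_mem n <| Submodule.smul_mem_smul (Ideal.subset_span e.2) <|
      ExteriorAlgebra.ιMulti_range S n ⟨_, rfl⟩⟩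

variable {R} {p : ℕ} {M : Type*} [AddCommGroup M] [Module R M]

/-- `κ'` is the Cartier structure on `f^! M` induced by the Cartier structure `κ` on `M`. It is
the composite
`F_* (ω_f ⊗_R M) → ω_f ⊗_R F_* M → ω_f ⊗_R M`
of the relative Cartier operator of top forms (tensored with `M`) and of `id ⊗ κ`. The relative
Cartier operator kills the exact top forms, which are the sums of forms `dx_1 ∧ ⋯ ∧ dx_n` with
`n ≥ 1`, and sends `(x_1 ⋯ x_n)^(p-1) dx_1 ∧ ⋯ ∧ dx_n` to `dx_1 ∧ ⋯ ∧ dx_n`. Together with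
`κ' (s ^ p • z) = s • κ' z` these two rules determine `κ'`. -/
structure IsShriekStructure (κ : CartierStructure p R M)
    (κ' : CartierStructure p S (Shriek R S M)) : Prop where
  exact_eq_zero : ∀ (n : ℕ) (e : relDimIdempotents R S (n + 1)) (x : Fin (n + 1) → S) (m : M),
    κ' (topForm R e x ⊗ₜ[R] m) = 0
  cartier : ∀ (n : ℕ) (e : relDimIdempotents R S n) (x : Fin n → S) (m : M),
    κ' (((∏ i, x i) ^ (p - 1) • topForm R e x) ⊗ₜ[R] m) = topForm R e x ⊗ₜ[R] κ m

variable (S)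

/-- The Cartier structure of `f^! M`. -/
def shriekStructure (κ : CartierStructure p R M) : CartierStructure p S (Shriek R S M) :=
  Classical.epsilon (IsShriekStructure κ)

/-- The submodule `f^! N` of `f^! M` for a submodule `N` of `M` (the functor `f^!` is exact, `ω_f`
being flat over `R`). -/
def shriekSubmodule (N : Submodule R M) : Submodule S (Shriek R S M) :=
  LinearMap.range
    (TensorProduct.AlgebraTensorModule.lTensor S (relDualizing R S) N.subtype)

end Shriek

end CartierModule

end

/-!
Let `𝒞₊` be the operator `plusAct`, and let `P` be the `F`-pure part of `M`, the stable value of the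
submodules `𝒞₊ ^ h M`.

*Stationarity.* Let `Jₕ` be the ideal of all `x` that carry `𝒞₊ ^ h M` into `𝒞₊ ^ (h + 1) M`. These
ideals increase, hence they become stationary. At a minimal prime of the stable value `J` the chain
of the `𝒞₊ ^ h M`, modulo the ideal of the squares of `J`, lives in a module of finite length, where
it has to stop; thus `J` is the unit ideal (`exists_iterate_eq_fPurePart`).

*Test elements.* Let `η` be a generic point of the support of `P`. The annihilator of `P` is
radical, so that `P_η` is a vector space over a field `K` with a finite `p`-basis, and modulo
nilpotents the adjoint `P_η → Hom(F_* K, P_η)` of `κ` is injective between vector spaces of the same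
dimension, hence bijective. With cleared denominators this becomes a *splitting* of `P`, with a
denominator `c` outside `η` (`exists_isSplitting_of_minimal`). Such a `c` is a test element: some
power of `c` carries `P` into every Cartier submodule `N` that agrees generically with `P`
(`exists_pow_smul_mem_of_generic`). Indeed, the splitting shows that the ideal of all `x` with
`κ ^ n (x P) ⊆ N` is idempotent on the locus where `c` is invertible, hence open and closed there,
and it meets every component of the support of `P`. It follows that the smallest candidate is
`𝒞₊ ^ h (∑ c P)` for `h ≫ 0`, where the sum is over the denominators `c` of all splittings of `P`
(`exists_isLeast_testCandidates`).

*The Cartier structure of `f^! M`.* Locally `S` is étale over a polynomial ring `A = R[x₁, …, xₙ]`.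
The relative Frobenius of an étale algebra is an isomorphism, `F_* A ⊗ T ≃ F_* T`
(`relFrobenius_bijective`), so that the Cartier operator on `A ⊗ M`, which is given by a formula for
monomials, extends to `T ⊗ M` (`exists_cartierStructure_coord`). It obeys the two rules for
arbitrary top forms, not only for those in the coordinates (`cartier_jac_tmul`,
`cartier_prod_pow_mul_jac_tmul`). Globally, the two rules generate a subgroup of `f^! M × f^! M`. It
is the graph of a map: the values exist because exact forms and forms
`(y₁ ⋯ yₙ) ^ (p - 1) dy₁ ∧ ⋯ ∧ dyₙ` span `ω` over `R` and the `p`-th powers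
(`reachableForms_eq_top`), and they are unique because they are unique locally
(`existsUnique_isShriekStructure`).

*Comparison.* The two rules imply `κ' (f^! N) = f^! (κ N)`, hence `f^!` commutes with `𝒞₊`, and it
carries the `F`-pure part to the `F`-pure part and `𝒞₊ ^ h (∑ c P)` to the corresponding submodule
of `f^! P`. It agrees generically with `f^! P`, because generic points of the support of `f^! P` lie
over generic points of the support of `P`, by going down (`minimal_comap_support`). The argument
about test elements is carried out for a *chart* of a Cartier module over an `R`-algebra, which
covers `M` itself and, with the monomials in étale coordinates, `f^! M`; it shows that the same
elements `c` are test elements for `f^! M` (`IsShriekStructure.exists_pow_smul_mem`). Hence the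
pullback of the smallest candidate is the smallest candidate.
-/

namespace CartierModule

/-! ### Cartier structures and the operator `𝒞₊` -/

section Operators

variable {p : ℕ} {R M : Type*} [CommRing R] [AddCommGroup M] [Module R M]

theorem CartierStructure.mem_image {κ : CartierStructure p R M} {N : Submodule R M} {x : M} :
    x ∈ κ.image N ↔ ∃ y ∈ N, κ y = x :=
  Iff.rfl

theorem CartierStructure.mem_image_iterate {κ : CartierStructure p R M} {N : Submodule R M}
    {e : ℕ} {x : M} : x ∈ κ.image^[e] N ↔ ∃ y ∈ N, κ^[e] y = x := by
  induction e generalizing x with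
  | zero => simp
  | succ e ih =>
    rw [Function.iterate_succ_apply', CartierStructure.mem_image]
    constructor
    · rintro ⟨y, hy, rfl⟩
      obtain ⟨z, hz, rfl⟩ := ih.1 hy
      exact ⟨z, hz, Function.iterate_succ_apply' _ _ _⟩
    · rintro ⟨z, hz, rfl⟩
      exact ⟨_, ih.2 ⟨z, hz, rfl⟩, (Function.iterate_succ_apply' _ _ _).symm⟩

theorem CartierStructure.iterate_pow_smul (κ : CartierStructure p R M) (e : ℕ) (r : R) (m : M) :
    κ^[e] (r ^ p ^ e • m) = r • κ^[e] m := by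
  induction e generalizing r m with
  | zero => simp
  | succ e ih =>
    rw [pow_succ', pow_mul, Function.iterate_succ_apply', Function.iterate_succ_apply', ih,
      κ.map_pow_smul]

theorem CartierStructure.iterate_add (κ : CartierStructure p R M) (e : ℕ) (x y : M) :
    κ^[e] (x + y) = κ^[e] x + κ^[e] y :=
  iterate_map_add κ e x y

theorem CartierStructure.iterate_zero' (κ : CartierStructure p R M) (e : ℕ) :
    κ^[e] (0 : M) = 0 :=
  iterate_map_zero κ e

theorem CartierStructure.iterate_sum (κ : CartierStructure p R M) (e : ℕ) {ι : Type*}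
    (s : Finset ι) (f : ι → M) : κ^[e] (∑ i ∈ s, f i) = ∑ i ∈ s, κ^[e] (f i) := by
  classical
  induction s using Finset.induction_on with
  | empty => simp [κ.iterate_zero']
  | insert a s ha ih => rw [Finset.sum_insert ha, Finset.sum_insert ha, κ.iterate_add, ih]

variable {κ : CartierStructure p R M} {𝔞 : Ideal R} {t : ℚ}

theorem mem_plusAct {N : Submodule R M} {e : ℕ} (he : 1 ≤ e) {r : R}
    (hr : r ∈ 𝔞 ^ ⌈t * (p : ℚ) ^ e⌉₊) {m : M} (hm : m ∈ N) :
    κ^[e] (r • m) ∈ plusAct κ 𝔞 t N :=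
  Submodule.mem_iSup_of_mem e <| Submodule.mem_iSup_of_mem he <|
    CartierStructure.mem_image_iterate.2 ⟨_, Submodule.smul_mem_smul hr hm, rfl⟩

theorem plusAct_le_iff {N N' : Submodule R M} :
    plusAct κ 𝔞 t N ≤ N' ↔
      ∀ e : ℕ, 1 ≤ e → ∀ r ∈ 𝔞 ^ ⌈t * (p : ℚ) ^ e⌉₊, ∀ m ∈ N, κ^[e] (r • m) ∈ N' := by
  refine ⟨fun h e he r hr m hm => h (mem_plusAct he hr hm), fun h => ?_⟩
  refine iSup_le fun e => iSup_le fun he => ?_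
  intro x hx
  obtain ⟨y, hy, rfl⟩ := CartierStructure.mem_image_iterate.1 hx
  refine Submodule.smul_induction_on hy (fun r hr m hm => h e he r hr m hm) fun x y hx hy => ?_
  rw [κ.iterate_add]
  exact N'.add_mem hx hy

theorem plusAct_mono : Monotone (plusAct κ 𝔞 t) := fun _ _ h =>
  plusAct_le_iff.2 fun _ he _ hr _ hm => mem_plusAct he hr (h hm)

theorem plusAct_iterate_mono (h : ℕ) : Monotone (plusAct κ 𝔞 t)^[h] :=
  plusAct_mono.iterate h

theorem plusAct_iterate_antitone : Antitone fun h : ℕ => (plusAct κ 𝔞 t)^[h] ⊤ :=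
  plusAct_mono.antitone_iterate_of_map_le le_top

/-- Since `x • κ ^ e m = κ ^ e (x ^ (p ^ e) • m)` and `p ^ e ≥ 2`, multiplication by `x` after
`𝒞₊` can be traded for multiplication by `x ^ 2` before it. -/
theorem smul_mem_plusAct (hp : p.Prime) {x : R} {N N' : Submodule R M}
    (h : ∀ m ∈ N, x ^ 2 • m ∈ N') {m : M} (hm : m ∈ plusAct κ 𝔞 t N) :
    x • m ∈ plusAct κ 𝔞 t N' := by
  suffices plusAct κ 𝔞 t N ≤ (plusAct κ 𝔞 t N').comap (LinearMap.lsmul R M x) from this hm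
  refine plusAct_le_iff.2 fun e he r hr m hm => ?_
  have h2 : 2 ≤ p ^ e := hp.two_le.trans (Nat.le_self_pow (by omega) p)
  have : x • κ^[e] (r • m) = κ^[e] (r • x ^ (p ^ e - 2) • x ^ 2 • m) := by
    rw [← κ.iterate_pow_smul, smul_smul (x ^ (p ^ e - 2)), ← pow_add, Nat.sub_add_cancel h2,
      smul_comm]
  rw [Submodule.mem_comap, LinearMap.lsmul_apply, this]
  exact mem_plusAct he hr (N'.smul_mem _ (h m hm))

theorem smul_mem_plusAct_iterate (hp : p.Prime) (k : ℕ) {x : R} {N N' : Submodule R M}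
    (h : ∀ m ∈ N, x ^ 2 ^ k • m ∈ N') {m : M} (hm : m ∈ (plusAct κ 𝔞 t)^[k] N) :
    x • m ∈ (plusAct κ 𝔞 t)^[k] N' := by
  induction k generalizing x m with
  | zero => simpa using h m hm
  | succ k ih =>
    rw [Function.iterate_succ_apply'] at hm ⊢
    refine smul_mem_plusAct hp (fun m hm => ih (x := x ^ 2) (fun m hm => ?_) hm) hm
    rw [← pow_mul, ← pow_succ']
    exact h m hm

theorem IsCartierSubmodule.iterate_le {N : Submodule R M} (hN : IsCartierSubmodule κ 𝔞 t N)
    (l : ℕ) : (plusAct κ 𝔞 t)^[l] N ≤ N :=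
  plusAct_mono.antitone_iterate_of_map_le hN (Nat.zero_le l)

/-- If `N` is fixed by `𝒞₊` and some power of `x` carries `N` into a Cartier submodule `N'`, then
`x` itself does. -/
theorem smul_mem_of_pow_smul_mem (hp : p.Prime) {x : R} {N N' : Submodule R M}
    (hN : plusAct κ 𝔞 t N = N) (hN' : IsCartierSubmodule κ 𝔞 t N') {l : ℕ}
    (h : ∀ m ∈ N, x ^ l • m ∈ N') {m : M} (hm : m ∈ N) : x • m ∈ N' := by
  refine hN'.iterate_le l (smul_mem_plusAct_iterate hp l (N := N) (fun m hm => ?_) ?_)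
  · obtain ⟨k, hk⟩ := Nat.exists_eq_add_of_le (Nat.lt_two_pow_self (n := l)).le
    rw [hk, add_comm, pow_add, mul_smul]
    exact N'.smul_mem _ (h m hm)
  · rwa [Function.iterate_fixed hN]

theorem fPurePart_le_iterate (h : ℕ) : fPurePart κ 𝔞 t ≤ (plusAct κ 𝔞 t)^[h] ⊤ :=
  iInf_le _ h

end Operators

/-! ### The chain of the `𝒞₊ ^ h M` becomes stationary -/

section Localized

variable {R M : Type*} [CommRing R] [AddCommGroup M] [Module R M]

theorem exists_smul_mem_of_localized_le {S : Submonoid R} {N N' : Submodule R M}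
    (h : N.localized S ≤ N'.localized S) {m : M} (hm : m ∈ N) : ∃ s ∈ S, s • m ∈ N' := by
  obtain ⟨n, hn, s, hs⟩ := h ⟨m, hm, 1, rfl⟩
  obtain ⟨u, hu⟩ := (IsLocalizedModule.mk'_eq_mk'_iff (LocalizedModule.mkLinearMap S M) _ _ _ _).1 hs
  refine ⟨u * s, S.mul_mem u.2 s.2, ?_⟩
  have hu' : (u : R) • (s : R) • m = (u : R) • n := by simpa [Submonoid.smul_def] using hu
  rw [mul_smul, hu']
  exact N'.smul_mem _ hn

theorem exists_smul_mem_of_fg {S : Submonoid R} {N N' : Submodule R M} (hN : N.FG)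
    (h : ∀ m ∈ N, ∃ s ∈ S, s • m ∈ N') : ∃ s ∈ S, ∀ m ∈ N, s • m ∈ N' := by
  obtain ⟨G, rfl⟩ := hN
  choose! s hs hsm using h
  refine ⟨∏ g ∈ G, s g, S.prod_mem fun g hg => hs g (Submodule.subset_span hg), fun m hm => ?_⟩
  suffices Submodule.span R (G : Set M) ≤ N'.comap (LinearMap.lsmul R M (∏ g ∈ G, s g)) from this hm
  refine Submodule.span_le.2 fun g hg => ?_
  obtain ⟨c, hc⟩ := Finset.dvd_prod_of_mem s (Finset.mem_coe.1 hg)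
  rw [SetLike.mem_coe, Submodule.mem_comap, LinearMap.lsmul_apply, hc, mul_comm, mul_smul]
  exact N'.smul_mem _ (hsm g (Submodule.subset_span hg))

theorem exists_smul_le_of_localized_le {S : Submonoid R} {N N' : Submodule R M} (hN : N.FG)
    (h : N.localized S ≤ N'.localized S) : ∃ s ∈ S, ∀ m ∈ N, s • m ∈ N' :=
  exists_smul_mem_of_fg hN fun _ hm => exists_smul_mem_of_localized_le h hm

theorem localized_le_of_smul_mem {S : Submonoid R} {N N' : Submodule R M} {s : R} (hs : s ∈ S)
    (h : ∀ m ∈ N, s • m ∈ N') : N.localized S ≤ N'.localized S := by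
  rintro _ ⟨m, hm, u, rfl⟩
  refine ⟨s • m, h m hm, ⟨s, hs⟩ * u, ?_⟩
  exact IsLocalizedModule.mk'_cancel_left (S := S) (LocalizedModule.mkLinearMap S M) m ⟨s, hs⟩ u

theorem localized_mono {S : Submonoid R} {N N' : Submodule R M} (h : N ≤ N') :
    N.localized S ≤ N'.localized S :=
  localized_le_of_smul_mem S.one_mem fun m hm => by simpa using h hm

end Localized

section Stationary

variable {p : ℕ} {R M : Type*} [CommRing R] [AddCommGroup M] [Module R M]

/-- At a minimal prime of an ideal `I` that annihilates it, a finite module has finite length. -/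
theorem isArtinian_localizedModule_of_smul_eq_zero [IsNoetherianRing R]
    {X : Type*} [AddCommGroup X] [Module R X] [Module.Finite R X] {I : Ideal R}
    (hX : ∀ r ∈ I, ∀ x : X, r • x = 0) (η : Ideal R) [η.IsPrime] (hη : η ∈ I.minimalPrimes) :
    IsArtinian (Localization.AtPrime η) (LocalizedModule η.primeCompl X) := by
  set A := Localization.AtPrime η
  set L := LocalizedModule η.primeCompl X
  have hmin : IsLocalRing.maximalIdeal A ∈ (I.map (algebraMap R A)).minimalPrimes := by
    rw [IsLocalization.minimalPrimes_map η.primeCompl A I]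
    simpa [IsLocalization.AtPrime.under_maximalIdeal A η] using hη
  have hA : IsArtinianRing (A ⧸ I.map (algebraMap R A)) :=
    IsLocalRing.quotient_artinian_of_mem_minimalPrimes_of_isLocalRing _ hmin
  have htor : Module.IsTorsionBySet A L (I.map (algebraMap R A)) := by
    rw [Ideal.map, Ideal.span, ← Module.isTorsionBySet_iff_is_torsion_by_span]
    rintro x ⟨_, r, hr, rfl⟩
    induction x using LocalizedModule.induction_on with
    | h m s =>
      rw [algebraMap_smul, LocalizedModule.smul'_mk, hX r hr, LocalizedModule.zero_mk]
  let _ := htor.module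
  have : IsScalarTower A (A ⧸ I.map (algebraMap R A)) L := htor.isScalarTower
  have : Module.Finite (A ⧸ I.map (algebraMap R A)) L :=
    Module.Finite.of_restrictScalars_finite A _ _
  exact isArtinian_of_surjective_algebraMap (M := L)
    (show Function.Surjective (algebraMap A (A ⧸ I.map (algebraMap R A))) from
      Ideal.Quotient.mk_surjective)

/-- In a decreasing chain of submodules that all contain `I • N 0`, every minimal prime `η` of `I`
has a neighbourhood on which some step of the chain is an equality: locally at `η` the chain lives
in a module of finite length. -/
theorem exists_smul_mem_of_antitone [IsNoetherianRing R] [Module.Finite R M]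
    {N : ℕ → Submodule R M} (hN : Antitone N) {I : Ideal R} (hI : ∀ h, I • N 0 ≤ N h)
    {η : Ideal R} (hη : η ∈ I.minimalPrimes) :
    ∃ h, ∃ s ∉ η, ∀ m ∈ N h, s • m ∈ N (h + 1) := by
  have : η.IsPrime := hη.1.1
  let X := N 0 ⧸ (I • ⊤ : Submodule R (N 0))
  let D : ℕ → Submodule R X := fun h => ((N h).comap (N 0).subtype).map (Submodule.mkQ _)
  have hD : Antitone D := fun h k hk => Submodule.map_mono (Submodule.comap_mono (hN hk))
  have := isArtinian_localizedModule_of_smul_eq_zero (X := X) (I := I) (fun r hr x => by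
    obtain ⟨y, rfl⟩ := Submodule.mkQ_surjective _ x
    rw [← map_smul, Submodule.mkQ_apply, Submodule.Quotient.mk_eq_zero]
    exact Submodule.smul_mem_smul hr trivial) η hη
  obtain ⟨h, hh⟩ := monotone_stabilizes_iff_artinian.2 this
    ⟨fun h => OrderDual.toDual ((D h).localized η.primeCompl), fun h k hk =>
      localized_mono (hD hk)⟩
  have heq : (D h).localized η.primeCompl = (D (h + 1)).localized η.primeCompl :=
    hh (h + 1) (Nat.le_succ h)
  refine ⟨h, ?_⟩
  have hI' : ∀ k, ∀ y : N 0, (I • ⊤ : Submodule R (N 0)).mkQ y ∈ D k → (y : M) ∈ N k := by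
    rintro k y ⟨z, hz, hzy⟩
    have h0 : y - z ∈ (I • ⊤ : Submodule R (N 0)) := (Submodule.Quotient.eq _).1 hzy.symm
    have h1 : ((y - z : N 0) : M) ∈ I • N 0 := by
      have := Submodule.mem_map_of_mem (f := (N 0).subtype) h0
      rwa [Submodule.map_smul'', Submodule.map_top, Submodule.range_subtype] at this
    have := (N k).add_mem (hI k h1) hz
    simpa using this
  obtain ⟨s, hs, hsm⟩ := exists_smul_le_of_localized_le (IsNoetherian.noetherian (D h)) heq.le
  refine ⟨s, hs, fun m hm => ?_⟩
  have := hI' (h + 1) (s • ⟨m, hN (Nat.zero_le h) hm⟩) ?_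
  · simpa using this
  · rw [map_smul]
    exact hsm _ ⟨_, hm, rfl⟩

/-- The chain of the `𝒞₊ ^ h M` becomes stationary. The ideals of all `x` that carry
`𝒞₊ ^ h M` into `𝒞₊ ^ (h + 1) M` increase to an ideal `J`; if `x ∈ J`, then `x ^ 2` carries a
late member of the chain into all the others, so that locally at a minimal prime of `J` the chain
lives in a module of finite length. Hence `J` has no minimal prime. -/
theorem exists_iterate_eq_fPurePart [IsNoetherianRing R] [Module.Finite R M] (hp : p.Prime)
    (κ : CartierStructure p R M) (𝔞 : Ideal R) (t : ℚ) :
    ∃ h₀ : ℕ, ∀ h ≥ h₀, (plusAct κ 𝔞 t)^[h] ⊤ = fPurePart κ 𝔞 t := by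
  set N : ℕ → Submodule R M := fun h => (plusAct κ 𝔞 t)^[h] ⊤ with hNdef
  have hN : Antitone N := plusAct_iterate_antitone
  have hsucc : ∀ h, N (h + 1) = plusAct κ 𝔞 t (N h) := fun h => Function.iterate_succ_apply' _ _ _
  have hpow : ∀ {x : R} {A B : Submodule R M}, (∀ m ∈ A, x • m ∈ B) → ∀ m ∈ A, x ^ 2 • m ∈ B :=
    fun {x A B} h m hm => by rw [pow_two, mul_smul]; exact B.smul_mem _ (h m hm)
  let J : ℕ →o Ideal R :=
    { toFun := fun h => (N (h + 1)).colon (N h)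
      monotone' := monotone_nat_of_le_succ fun h x hx => by
        rw [Submodule.mem_colon] at hx ⊢
        intro m hm
        rw [SetLike.mem_coe, hsucc] at hm
        rw [hsucc (h + 1)]
        exact smul_mem_plusAct hp (hpow hx) hm }
  obtain ⟨h₀, hJ⟩ := monotone_stabilizes_iff_noetherian.2 ‹_› J
  have hsq : ∀ x ∈ J h₀, ∀ k, ∀ m ∈ N h₀, x ^ 2 • m ∈ N (h₀ + k) := by
    intro x hx k
    have hx' := Submodule.mem_colon.1 hx
    induction k with
    | zero => exact fun m hm => (N h₀).smul_mem _ hm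
    | succ k ih =>
      intro m hm
      rw [pow_two, mul_smul, ← add_assoc, hsucc]
      have := hx' m hm
      rw [hsucc] at this
      exact smul_mem_plusAct hp ih this
  have key : J h₀ = ⊤ := by
    -- The squares of the elements of `J h₀` generate an ideal with the same minimal primes.
    by_contra hne
    let I : Ideal R := Ideal.span ((fun x => x ^ 2) '' (J h₀ : Set R))
    have hIJ : I.radical = (J h₀).radical := by
      refine le_antisymm (Ideal.radical_mono (Ideal.span_le.2 ?_)) ?_
      · rintro _ ⟨x, hx, rfl⟩
        exact Ideal.pow_mem_of_mem _ hx 2 two_pos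
      · refine Ideal.radical_le_radical_iff.2 fun x hx => ⟨2, Ideal.subset_span ⟨x, hx, rfl⟩⟩
    obtain ⟨η, hη⟩ := Ideal.nonempty_minimalPrimes hne
    have hηI : η ∈ I.minimalPrimes := by
      rwa [← Ideal.radical_minimalPrimes, hIJ, Ideal.radical_minimalPrimes]
    obtain ⟨h, s, hs, hsm⟩ := exists_smul_mem_of_antitone (N := fun k => N (h₀ + k))
      (fun a b hab => hN (Nat.add_le_add_left hab h₀)) (I := I) (fun k => by
        refine Submodule.smul_le.2 fun r hr m hm => ?_
        suffices I ≤ ((N (h₀ + k)).comap (LinearMap.toSpanSingleton R M m)) from this hr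
        refine Ideal.span_le.2 ?_
        rintro _ ⟨x, hx, rfl⟩
        exact hsq x hx k m hm) hηI
    refine hs (hη.1.2 ?_)
    rw [hJ (h₀ + h) (Nat.le_add_right _ _)]
    exact Submodule.mem_colon.2 hsm
  have hstep : ∀ k, N (h₀ + k) = N h₀ := by
    intro k
    induction k with
    | zero => rfl
    | succ k ih =>
      refine le_antisymm (hN (Nat.le_add_right _ _)) fun m hm => ?_
      rw [← ih] at hm
      have h1 : (1 : R) ∈ J (h₀ + k) := by
        rw [← hJ (h₀ + k) (Nat.le_add_right _ _), key]; trivial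
      have := Submodule.mem_colon.1 h1 m hm
      rwa [one_smul] at this
  refine ⟨h₀, fun h hh => le_antisymm (le_iInf fun k => ?_) (fPurePart_le_iterate h)⟩
  obtain ⟨l, rfl⟩ := Nat.exists_eq_add_of_le hh
  change N (h₀ + l) ≤ N k
  rw [hstep, ← hstep k]
  exact hN (Nat.le_add_left _ _)

theorem plusAct_fPurePart [IsNoetherianRing R] [Module.Finite R M] (hp : p.Prime)
    (κ : CartierStructure p R M) (𝔞 : Ideal R) (t : ℚ) :
    plusAct κ 𝔞 t (fPurePart κ 𝔞 t) = fPurePart κ 𝔞 t := by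
  obtain ⟨h₀, h⟩ := exists_iterate_eq_fPurePart hp κ 𝔞 t
  rw [← h h₀ le_rfl, ← Function.iterate_succ_apply' (plusAct κ 𝔞 t), h _ (Nat.le_succ h₀),
    h h₀ le_rfl]

/-- The annihilator of a submodule that is fixed by `𝒞₊` is a radical ideal. -/
theorem smul_eq_zero_of_pow_smul_eq_zero (hp : p.Prime) {κ : CartierStructure p R M} {𝔞 : Ideal R}
    {t : ℚ} {P : Submodule R M} (hP : plusAct κ 𝔞 t P = P) {x : R} {l : ℕ}
    (h : ∀ m ∈ P, x ^ l • m = 0) {m : M} (hm : m ∈ P) : x • m = 0 := by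
  have : IsCartierSubmodule κ 𝔞 t ⊥ := by
    refine plusAct_le_iff.2 fun e _ r _ m hm => ?_
    rw [(Submodule.mem_bot R).1 hm, smul_zero, κ.iterate_zero']
    exact zero_mem _
  simpa using smul_mem_of_pow_smul_mem hp hP this (x := x) (l := l) (by simpa using h) hm

end Stationary

/-! ### Cartier structures over fields and on localizations -/

section FrobeniusBasis

variable {p : ℕ} [Fact p.Prime]

/-- A finite family that spans a field `K` over `K ^ p` contains a basis. -/
theorem exists_frobenius_basis {K σ : Type*} [Field K] [CharP K p] [Fintype σ] (g : σ → K)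
    (hg : ∀ x, ∃ c : σ → K, x = ∑ i, c i ^ p * g i) :
    ∃ s : Finset σ, (∀ x, ∃ c : s → K, x = ∑ i, c i ^ p * g i) ∧
      ∀ c : s → K, ∑ i, c i ^ p * g i = 0 → c = 0 := by
  classical
  let good : Set (Finset σ) := {s | ∀ x, ∃ c : σ → K, x = ∑ i ∈ s, c i ^ p * g i}
  obtain ⟨s, hs⟩ := (Set.toFinite good).exists_minimal ⟨Finset.univ, hg⟩
  refine ⟨s, fun x => ?_, fun d hd => ?_⟩
  · obtain ⟨c, rfl⟩ := hs.1 x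
    exact ⟨fun i => c i, (Finset.sum_coe_sort s fun i => c i ^ p * g i).symm⟩
  · by_contra hne
    obtain ⟨i₀, hi₀⟩ := Function.ne_iff.1 hne
    let d' : σ → K := fun i => if h : i ∈ s then d ⟨i, h⟩ else 0
    have hd' : ∑ i ∈ s, d' i ^ p * g i = 0 := by
      rw [← hd, ← Finset.sum_coe_sort s]
      exact Finset.sum_congr rfl fun i _ => by simp [d']
    have hd0 : d' i₀ ≠ 0 := by simpa [d'] using hi₀
    have : s.erase i₀ ∈ good := by
      intro x
      obtain ⟨c, rfl⟩ := hs.1 x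
      refine ⟨fun i => c i - c i₀ / d' i₀ * d' i, ?_⟩
      have h1 : ∑ i ∈ s, (c i - c i₀ / d' i₀ * d' i) ^ p * g i = ∑ i ∈ s, c i ^ p * g i := by
        simp_rw [sub_pow_char, sub_mul, Finset.sum_sub_distrib, mul_pow, mul_assoc,
          ← Finset.mul_sum, hd', mul_zero, sub_zero]
      rw [← h1, ← Finset.add_sum_erase s _ i₀.2, div_mul_cancel₀ _ hd0, sub_self,
        zero_pow (Fact.out : p.Prime).ne_zero, zero_mul, zero_add]
    exact (Finset.notMem_erase (i₀ : σ) s) (hs.2 this (Finset.erase_subset _ _) i₀.2)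

end FrobeniusBasis

section Nil

variable {p : ℕ} {R M : Type*} [CommRing R] [AddCommGroup M] [Module R M]

/-- The largest submodule of `M` that is annihilated by `κ ^ n`. -/
def nilSubmodule (κ : CartierStructure p R M) (n : ℕ) : Submodule R M where
  carrier := {v | ∀ x : R, κ^[n] (x • v) = 0}
  add_mem' {v w} hv hw x := by rw [smul_add, κ.iterate_add, hv x, hw x, add_zero]
  zero_mem' x := by rw [smul_zero, κ.iterate_zero']
  smul_mem' r v hv x := by rw [smul_smul]; exact hv _

theorem mem_nilSubmodule {κ : CartierStructure p R M} {n : ℕ} {v : M} :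
    v ∈ nilSubmodule κ n ↔ ∀ x : R, κ^[n] (x • v) = 0 :=
  Iff.rfl

theorem nilSubmodule_mono (κ : CartierStructure p R M) : Monotone (nilSubmodule κ) :=
  monotone_nat_of_le_succ fun n v hv x => by
    rw [Function.iterate_succ_apply', hv x, map_zero]

/-- Over a field `K` with finite `p`-basis `b`, the adjoint `V → Hom_K(F_* K, V)` of a Cartier
structure becomes bijective modulo the nilpotent part: it is injective there by definition, and
both sides have the same dimension. In terms of `b`: the functionals dual to `b`, composed with any
`u`, are of the form `x ↦ κ (x • m)`. -/
theorem exists_dual_of_field [Fact p.Prime] {K V ι : Type*} [Field K] [CharP K p] [AddCommGroup V]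
    [Module K V] [FiniteDimensional K V] [Fintype ι] [DecidableEq ι] (b : ι → K)
    (hb : ∀ x, ∃ c : ι → K, x = ∑ i, c i ^ p * b i)
    (hb' : ∀ c : ι → K, ∑ i, c i ^ p * b i = 0 → c = 0) (κ : CartierStructure p K V) :
    ∃ n, ∀ (u : V) (j : ι), ∃ m : V, ∀ j',
      κ (b j' • m) - (if j = j' then u else 0) ∈ nilSubmodule κ n := by
  obtain ⟨n, hn⟩ := monotone_stabilizes_iff_noetherian.2
    (inferInstance : IsNoetherian K V) ⟨nilSubmodule κ, nilSubmodule_mono κ⟩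
  set W := nilSubmodule κ n with hW
  have hW' : nilSubmodule κ (n + 1) = W := (hn (n + 1) (Nat.le_succ n)).symm
  let B := Module.finBasis K (V ⧸ W)
  choose u hu using fun i => W.mkQ_surjective (B i)
  let m : (ι × Fin (Module.finrank K (V ⧸ W)) → K) → V := fun c =>
    ∑ ji, c ji ^ p • b ji.1 • u ji.2
  let L : (ι × Fin (Module.finrank K (V ⧸ W)) → K) →ₗ[K] (ι → V ⧸ W) :=
    ∑ ji, (LinearMap.proj ji).smulRight fun j' => W.mkQ (κ (b j' • b ji.1 • u ji.2))
  have hL : ∀ c j', L c j' = W.mkQ (κ (b j' • m c)) := by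
    intro c j'
    simp only [L, m, LinearMap.sum_apply, Finset.sum_apply, LinearMap.smulRight_apply,
      LinearMap.proj_apply, Pi.smul_apply, Finset.smul_sum, map_sum]
    refine Finset.sum_congr rfl fun ji _ => ?_
    rw [smul_comm (b j') (c ji ^ p), κ.map_pow_smul, LinearMap.map_smul]
  -- If `κ (x • m c) ∈ W` for all `x`, then `m c` is annihilated by `κ ^ (n + 1)`, so it is in `W`.
  have hinj : Function.Injective L := by
    rw [injective_iff_map_eq_zero]
    intro c hc
    have h1 : m c ∈ W := by
      rw [← hW']
      intro x
      obtain ⟨a, rfl⟩ := hb x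
      have h2 : κ ((∑ i, a i ^ p * b i) • m c) ∈ W := by
        rw [Finset.sum_smul, map_sum]
        refine W.sum_mem fun i _ => ?_
        rw [mul_smul, κ.map_pow_smul]
        refine W.smul_mem _ ?_
        rw [← Submodule.Quotient.mk_eq_zero, ← Submodule.mkQ_apply, ← hL, hc]
        rfl
      simpa [Function.iterate_succ_apply] using h2 1
    have h3 : ∑ i, (∑ j, c (j, i) ^ p * b j) • B i = 0 := by
      have : W.mkQ (m c) = 0 := (Submodule.Quotient.mk_eq_zero W).2 h1
      rw [← this]
      simp only [m, map_sum, map_smul, hu, smul_smul, Finset.sum_smul, Fintype.sum_prod_type]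
      exact Finset.sum_comm
    funext ji
    exact congrFun (hb' (fun j => c (j, ji.2))
      (Fintype.linearIndependent_iff.1 B.linearIndependent _ h3 ji.2)) ji.1
  have hsurj : Function.Surjective L := by
    refine (LinearMap.injective_iff_surjective_of_finrank_eq_finrank ?_).1 hinj
    rw [Module.finrank_pi_fintype]
    simp [Module.finrank_pi_fintype]
  refine ⟨n, fun v j => ?_⟩
  obtain ⟨c, hc⟩ := hsurj fun j' => if j = j' then W.mkQ v else 0
  refine ⟨m c, fun j' => ?_⟩
  rw [← hW, ← Submodule.Quotient.mk_eq_zero, ← Submodule.mkQ_apply, map_sub, ← hL, hc]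
  dsimp only
  split_ifs <;> simp

end Nil

section Localize

variable {p : ℕ} {R M : Type*} [CommRing R] [AddCommGroup M] [Module R M]

/-- The Cartier structure `m / s ↦ κ (s ^ (p - 1) m) / s` on a localization of `M`. -/
def CartierStructure.localize (hp : p ≠ 0) (κ : CartierStructure p R M) (S : Submonoid R) :
    CartierStructure p (Localization S) (LocalizedModule S M) where
  toFun x := x.liftOn (fun ms => LocalizedModule.mk (κ ((ms.2 : R) ^ (p - 1) • ms.1)) ms.2) (by
    rintro ⟨m, s⟩ ⟨m', s'⟩ ⟨u, hu⟩
    have hu' : (u : R) • (s' : R) • m = (u : R) • (s : R) • m' := hu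
    refine LocalizedModule.mk_eq.2 ⟨u, ?_⟩
    have key : ∀ (a b c : R) (x : M),
        a • b • κ (c ^ (p - 1) • x) = κ ((a * b * c) ^ (p - 1) • a • b • x) := by
      intro a b c x
      obtain ⟨q, rfl⟩ := Nat.exists_eq_succ_of_ne_zero hp
      rw [← κ.map_pow_smul, ← κ.map_pow_smul]
      congr 1
      simp only [smul_smul]
      congr 1
      simp only [Nat.succ_eq_add_one, Nat.add_sub_cancel]
      ring
    change (u : R) • (s' : R) • κ ((s : R) ^ (p - 1) • m) =
      (u : R) • (s : R) • κ ((s' : R) ^ (p - 1) • m')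
    rw [key, key, hu']
    congr 2
    ring)
  map_zero' := by
    have h0 : (0 : LocalizedModule S M) = LocalizedModule.mk 0 (1 : S) :=
      (LocalizedModule.zero_mk 1).symm
    rw [h0, LocalizedModule.liftOn_mk]
    simp
  map_add' x y := by
    induction x, y using LocalizedModule.induction_on₂ with
    | h m m' s s' =>
      rw [LocalizedModule.mk_add_mk]
      change LocalizedModule.mk (κ (((s : R) * (s' : R)) ^ (p - 1) • ((s' : R) • m + (s : R) • m')))
        (s * s') = LocalizedModule.mk (κ ((s : R) ^ (p - 1) • m)) s +
          LocalizedModule.mk (κ ((s' : R) ^ (p - 1) • m')) s'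
      rw [LocalizedModule.mk_add_mk]
      congr 1
      rw [Submonoid.smul_def, Submonoid.smul_def, ← κ.map_pow_smul, ← κ.map_pow_smul, ← map_add]
      congr 1
      obtain ⟨q, rfl⟩ := Nat.exists_eq_succ_of_ne_zero hp
      simp only [smul_add, smul_smul, Nat.succ_eq_add_one, Nat.add_sub_cancel]
      congr 2 <;> ring
  map_pow_smul' a x := by
    induction x using LocalizedModule.induction_on with
    | h m s =>
      obtain ⟨r, u, rfl⟩ := IsLocalization.exists_mk'_eq S a
      rw [← Localization.mk_eq_mk', Localization.mk_pow, LocalizedModule.mk_smul_mk]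
      change LocalizedModule.mk (κ (((u : R) ^ p * (s : R)) ^ (p - 1) • r ^ p • m)) (u ^ p * s) =
        Localization.mk r u • LocalizedModule.mk (κ ((s : R) ^ (p - 1) • m)) s
      rw [LocalizedModule.mk_smul_mk, smul_comm, κ.map_pow_smul, mul_pow, ← pow_mul, mul_comm p,
        pow_mul, mul_smul, κ.map_pow_smul]
      refine LocalizedModule.mk_eq.2 ⟨1, ?_⟩
      obtain ⟨q, rfl⟩ := Nat.exists_eq_succ_of_ne_zero hp
      simp only [one_smul, Submonoid.smul_def, Submonoid.coe_mul, SubmonoidClass.coe_pow, smul_smul,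
        Nat.succ_eq_add_one, Nat.add_sub_cancel]
      congr 1
      ring

theorem CartierStructure.localize_mk (hp : p ≠ 0) (κ : CartierStructure p R M) (S : Submonoid R)
    (m : M) (s : S) : κ.localize hp S (LocalizedModule.mk m s) =
      LocalizedModule.mk (κ ((s : R) ^ (p - 1) • m)) s :=
  rfl

theorem CartierStructure.localize_iterate_mk_one (hp : p ≠ 0) (κ : CartierStructure p R M)
    (S : Submonoid R) (n : ℕ) (m : M) :
    (κ.localize hp S)^[n] (LocalizedModule.mk m 1) = LocalizedModule.mk (κ^[n] m) 1 := by
  induction n generalizing m with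
  | zero => rfl
  | succ n ih =>
    rw [Function.iterate_succ_apply, Function.iterate_succ_apply, κ.localize_mk, ← ih]
    simp

end Localize

/-! ### Splittings at the generic points -/

section Splitting

variable {p : ℕ} {R M : Type*} [CommRing R] [AddCommGroup M] [Module R M]

/-- `R` is `F`-finite: some finite family generates `R` over the subring of `p`-th powers. -/
def IsFFinite (p : ℕ) (R : Type*) [CommRing R] : Prop :=
  ∃ (r : ℕ) (g : Fin r → R), ∀ x, ∃ c : Fin r → R, x = ∑ i, c i ^ p * g i

/-- The family `b` is a basis of `R` over its `p`-th powers up to the denominator `c`, as far as the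
action on `P` is concerned, and modulo the part of `M` that is annihilated by `κ ^ n` the
functionals dual to `b`, multiplied by `c` and composed with any `u ∈ P`, are of the form
`x ↦ κ (x • m)` with `m ∈ P`. If `b` is such a family with `c = 1` and `P` is torsion-free over a
domain `A`, then `F_* A` is free with basis `b` and the adjoint `P → Hom(F_* A, P)` of `κ` is
surjective modulo nilpotents. -/
structure IsSplitting (κ : CartierStructure p R M) (P : Submodule R M) (c : R) (n : ℕ)
    {ι : Type*} [Fintype ι] [DecidableEq ι] (b : ι → R) : Prop where
  coords : ∀ r, ∃ a : ι → R, ∀ m ∈ P, (c * r - ∑ i, a i ^ p * b i) • m = 0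
  dual : ∀ u ∈ P, ∀ j, ∃ m ∈ P, ∀ j', κ (b j' • m) - (if j = j' then c • u else 0) ∈
    nilSubmodule κ n

theorem pow_smul_mem_nilSubmodule {κ : CartierStructure p R M} {n : ℕ} {v : M} {q : R}
    (h : ∀ x : R, q • κ^[n] (x • v) = 0) : q ^ p ^ n • v ∈ nilSubmodule κ n := fun x => by
  rw [smul_comm, κ.iterate_pow_smul, h]

section Localized

variable [Fact p.Prime] (κ : CartierStructure p R M) (P : Submodule R M) (η : Ideal R) [η.IsPrime]

/-- A splitting exists generically on the support of `P`: this is linear algebra over the residue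
field at a generic point `η`, transported to a neighbourhood of `η` by clearing denominators. -/
theorem exists_isSplitting [CharP R p] [IsNoetherianRing R] [Module.Finite R M]
    (hR : IsFFinite p R) {s : R} (hs : s ∉ η) (hsP : ∀ r ∈ η, ∀ m ∈ P, (s * r) • m = 0)
    {w : R} (hw : w ∉ η) (hwP : ∀ m ∈ P, w • κ m ∈ P) :
    ∃ c ∉ η, ∃ n : ℕ, ∃ (r : ℕ) (T : Finset (Fin r)) (b : T → R), ∀ e ∉ η,
      IsSplitting κ P (c * e ^ p) n b := by
  classical
  have hp : p.Prime := Fact.out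
  set S := η.primeCompl
  set A := Localization.AtPrime η
  set V := P.localized S
  let K := IsLocalRing.ResidueField A
  have hV : Module.IsTorsionBySet A V (IsLocalRing.maximalIdeal A) := by
    rw [← Localization.AtPrime.map_eq_maximalIdeal, Ideal.map, Ideal.span,
      ← Module.isTorsionBySet_iff_is_torsion_by_span]
    rintro ⟨_, m, hm, u, rfl⟩ ⟨_, r, hr, rfl⟩
    refine Subtype.ext ?_
    change algebraMap R A r • IsLocalizedModule.mk' _ m u = 0
    rw [algebraMap_smul, ← IsLocalizedModule.mk'_smul, IsLocalizedModule.mk'_eq_zero']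
    exact ⟨⟨s, hs⟩, by rw [Submonoid.smul_def, smul_smul, hsP r hr m hm]⟩
  let _ : Module K V := hV.module
  have hsmul : ∀ (a : A) (v : V), IsLocalRing.residue A a • v = a • v := fun a v => rfl
  have : IsScalarTower A K V := hV.isScalarTower
  have : Module.Finite A V := by
    have : IsNoetherian A (LocalizedModule S M) := inferInstance
    infer_instance
  have : FiniteDimensional K V := Module.Finite.of_restrictScalars_finite A K V
  -- the Cartier structure of the stalk
  have hκV : ∀ v : V, κ.localize hp.ne_zero S v ∈ V := by
    rintro ⟨_, m, hm, u, rfl⟩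
    change κ.localize hp.ne_zero S (IsLocalizedModule.mk' (LocalizedModule.mkLinearMap S M) m u) ∈ V
    rw [← IsLocalizedModule.mk_eq_mk', κ.localize_mk]
    refine ⟨w • κ ((u : R) ^ (p - 1) • m), hwP _ (P.smul_mem _ hm), ⟨w, hw⟩ * u, ?_⟩
    rw [IsLocalizedModule.mk_eq_mk']
    exact IsLocalizedModule.mk'_cancel_left (S := S) (LocalizedModule.mkLinearMap S M) _ ⟨w, hw⟩ u
  let κV : CartierStructure p K V :=
    { toFun := fun v => ⟨κ.localize hp.ne_zero S v, hκV v⟩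
      map_zero' := Subtype.ext (map_zero (κ.localize hp.ne_zero S))
      map_add' := fun v v' => Subtype.ext
          (map_add (κ.localize hp.ne_zero S) (v : LocalizedModule S M) v')
      map_pow_smul' := fun k v => by
        obtain ⟨a, rfl⟩ := IsLocalRing.residue_surjective k
        rw [← map_pow, hsmul, hsmul]
        exact Subtype.ext ((κ.localize hp.ne_zero S).map_pow_smul a v) }
  have hκV_coe : ∀ (n : ℕ) (v : V), ((κV^[n] v : V) : LocalizedModule S M) =
      (κ.localize hp.ne_zero S)^[n] v := by
    intro n
    induction n with
    | zero => exact fun _ => rfl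
    | succ n ih =>
      intro v
      rw [Function.iterate_succ_apply, Function.iterate_succ_apply, ih]
      rfl
  let ψ : R →+* K := (IsLocalRing.residue A).comp (algebraMap R A)
  have hψ : ∀ r, ψ r = 0 ↔ r ∈ η := fun r => by
    change IsLocalRing.residue A (algebraMap R A r) = 0 ↔ _
    rw [IsLocalRing.residue_eq_zero_iff, IsLocalization.AtPrime.to_map_mem_maximal_iff A η]
  have hcoe : ∀ (x : R) (v : V), ((ψ x • v : V) : LocalizedModule S M) = x • (v : _) := fun x v => by
    change ((algebraMap R A x • v : V) : LocalizedModule S M) = _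
    rw [Submodule.coe_smul, algebraMap_smul]
  have : CharP K p := by
    refine (CharP.charP_iff_prime_eq_zero hp).2 ?_
    rw [← map_natCast ψ, CharP.cast_eq_zero, map_zero]
  -- a `p`-basis of the residue field
  obtain ⟨r, g, hg⟩ := hR
  obtain ⟨T, hT, hT'⟩ := exists_frobenius_basis (p := p) (fun i => ψ (g i)) (by
    intro x
    obtain ⟨a, rfl⟩ := IsLocalRing.residue_surjective x
    obtain ⟨y, u, rfl⟩ := IsLocalization.exists_mk'_eq S a
    obtain ⟨c, hc⟩ := hg (y * u ^ (p - 1))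
    have hu0 : ψ u ≠ 0 := fun h => u.2 ((hψ _).1 h)
    have hy : IsLocalRing.residue A (IsLocalization.mk' A y u) = ψ y / ψ u := by
      rw [eq_div_iff hu0]
      exact (map_mul _ _ _).symm.trans (congrArg _ (IsLocalization.mk'_spec A y u))
    refine ⟨fun i => ψ (c i) / ψ u, ?_⟩
    have := congrArg ψ hc
    simp only [map_mul, map_pow, map_sum] at this
    rw [hy]
    simp_rw [div_pow, div_mul_eq_mul_div, ← Finset.sum_div]
    rw [← this, div_eq_div_iff hu0 (pow_ne_zero _ hu0), mul_assoc, ← pow_succ,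
      Nat.sub_add_cancel hp.one_le])
  obtain ⟨n, hn⟩ := exists_dual_of_field (fun i : T => ψ (g i)) hT hT' κV
  -- coordinates with a common denominator
  obtain ⟨d, hd, a, ha⟩ : ∃ d ∉ η, ∃ a : Fin r → T → R,
      ∀ l, ψ (d ^ p * g l) = ∑ j, ψ (a l j) ^ p * ψ (g j) := by
    choose k hk using fun l => hT (ψ (g l))
    choose kA hkA using fun l j => IsLocalRing.residue_surjective (k l j)
    obtain ⟨d, hd⟩ := IsLocalization.exist_integer_multiples_of_finite S
      (fun lj : Fin r × T => kA lj.1 lj.2)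
    choose a ha using hd
    have ha' : ∀ l j, ψ (a (l, j)) = ψ d * k l j := by
      intro l j
      change IsLocalRing.residue A (algebraMap R A (a (l, j))) = _
      rw [ha (l, j), Algebra.smul_def, map_mul, hkA]
      rfl
    refine ⟨d, d.2, fun l j => a (l, j), fun l => ?_⟩
    simp_rw [ha', mul_pow, mul_assoc, ← Finset.mul_sum, ← hk, map_mul, map_pow]
  have hcoords : ∀ e, ∀ x, ∃ a : T → R, ∀ m ∈ P,
      ((s * d) ^ p * e ^ p * x - ∑ i, a i ^ p * g i) • m = 0 := by
    intro e x
    obtain ⟨c, rfl⟩ := hg x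
    refine ⟨fun j => s * e * ∑ l, c l * a l j, fun m hm => ?_⟩
    have h1 : d ^ p * ∑ l, c l ^ p * g l - ∑ j : T, (∑ l, c l * a l j) ^ p * g j ∈ η := by
      rw [← hψ, map_sub, sub_eq_zero]
      have hsum : ∀ j, (∑ l, c l * a l j) ^ p = ∑ l, (c l * a l j) ^ p := fun j =>
        sum_pow_char p _ _
      simp only [hsum, map_mul, map_pow, map_sum, Finset.mul_sum, Finset.sum_mul, mul_pow]
      rw [Finset.sum_comm]
      refine Finset.sum_congr rfl fun l _ => ?_
      have := ha l
      simp only [map_mul, map_pow] at this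
      rw [mul_left_comm, this, Finset.mul_sum]
      exact Finset.sum_congr rfl fun j _ => by ring
    obtain ⟨q, hq⟩ := Nat.exists_eq_succ_of_ne_zero hp.ne_zero
    have h2 := hsP _ h1 m hm
    have h3 : (s * d) ^ p * e ^ p * ∑ l, c l ^ p * g l -
        ∑ j : T, (s * e * ∑ l, c l * a l j) ^ p * g j = (s ^ q * e ^ p) *
        (s * (d ^ p * ∑ l, c l ^ p * g l - ∑ j : T, (∑ l, c l * a l j) ^ p * g j)) := by
      simp_rw [mul_pow, mul_assoc, ← Finset.mul_sum]
      rw [hq, pow_succ s q]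
      ring
    rw [h3, mul_smul, h2, smul_zero]
  -- the dual functionals with a common denominator
  have hscale : ∀ {c u j}, (∃ m ∈ P, ∀ j' : T, κ (g j' • m) - (if j = j' then c • u else 0) ∈
      nilSubmodule κ n) → ∀ e : R, ∃ m ∈ P, ∀ j' : T, κ (g j' • m) -
        (if j = j' then (e * c) • u else 0) ∈ nilSubmodule κ n := by
    rintro c u j ⟨m, hm, h⟩ e
    refine ⟨e ^ p • m, P.smul_mem _ hm, fun j' => ?_⟩
    convert (nilSubmodule κ n).smul_mem e (h j') using 1
    rw [smul_comm, κ.map_pow_smul, smul_sub]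
    split_ifs <;> simp [mul_smul]
  have hdual : ∀ u ∈ P, ∀ j : T, ∃ c ∉ η, ∃ m ∈ P, ∀ j' : T,
      κ (g j' • m) - (if j = j' then c • u else 0) ∈ nilSubmodule κ n := by
    intro u hu j
    obtain ⟨⟨_, m, hm, q, rfl⟩, hmv⟩ := hn ⟨LocalizedModule.mk u 1, u, hu, 1, by
      rw [IsLocalizedModule.mk_eq_mk']⟩ j
    set vm : V := ⟨_, m, hm, q, rfl⟩
    let m₁ := (q : R) ^ (p - 1) • m
    have hm₁ : m₁ ∈ P := P.smul_mem _ hm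
    let w' : T → M := fun j' => κ (g j' • m₁) - (if j = j' then (q : R) • u else 0)
    have hw' : ∀ j', ∃ s' ∈ S, ∀ x ∈ κ.image^[n] (Submodule.span R {w' j'}), s' • x ∈
        (⊥ : Submodule R M) := by
      intro j'
      refine exists_smul_mem_of_fg (IsNoetherian.noetherian _) fun x hx => ?_
      obtain ⟨y, hy, rfl⟩ := CartierStructure.mem_image_iterate.1 hx
      obtain ⟨x, rfl⟩ := Submodule.mem_span_singleton.1 hy
      have h1 := hmv j' (ψ x * ψ q)
      have h2 : (((ψ x * ψ q) • (κV (ψ (g j') • vm) - if j = j' then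
          (⟨LocalizedModule.mk u 1, u, hu, 1, by rw [IsLocalizedModule.mk_eq_mk']⟩ : V) else 0) : V) :
          LocalizedModule S M) = LocalizedModule.mk (x • w' j') 1 := by
        have hq : (q : R) ^ p • g j' • (vm : LocalizedModule S M) =
            LocalizedModule.mk (g j' • m₁) 1 := by
          change (q : R) ^ p • g j' • IsLocalizedModule.mk' (LocalizedModule.mkLinearMap S M) m q = _
          rw [← IsLocalizedModule.mk_eq_mk', LocalizedModule.smul'_mk, LocalizedModule.smul'_mk,
            LocalizedModule.mk_eq]
          refine ⟨1, ?_⟩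
          obtain ⟨l, hl⟩ := Nat.exists_eq_succ_of_ne_zero hp.ne_zero
          simp only [m₁, one_smul, Submonoid.smul_def, smul_smul, hl, Nat.succ_eq_add_one,
            Nat.add_sub_cancel]
          congr 1
          ring
        have e1 : ((κV (ψ ((q : R) ^ p) • ψ (g j') • vm) : V) : LocalizedModule S M) =
            LocalizedModule.mk (κ (g j' • m₁)) 1 := by
          change κ.localize hp.ne_zero S
            ((ψ ((q : R) ^ p) • ψ (g j') • vm : V) : LocalizedModule S M) = _
          rw [hcoe, hcoe, hq, κ.localize_mk]
          simp
        rw [mul_smul, hcoe, smul_sub, Submodule.coe_sub, ← κV.map_pow_smul, ← map_pow, e1, hcoe,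
          ← LocalizedModule.smul'_mk]
        congr 1
        simp only [w']
        split_ifs
        · rw [LocalizedModule.smul'_mk]
          exact (map_sub (LocalizedModule.mkLinearMap S M) _ _).symm
        · simp
      have h3 := congrArg (Subtype.val : V → LocalizedModule S M) h1
      rw [hκV_coe, h2, κ.localize_iterate_mk_one] at h3
      obtain ⟨s', hs'⟩ := LocalizedModule.mk_eq.1 (h3.trans (LocalizedModule.zero_mk 1).symm)
      refine ⟨s', s'.2, ?_⟩
      simpa [Submonoid.smul_def] using hs'
    choose s' hs' hs'w using hw'
    refine ⟨(∏ j', s' j') ^ p ^ n * q, fun h => ?_, (((∏ j', s' j') ^ p ^ n) ^ p) • m₁,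
      P.smul_mem _ hm₁, fun j' => ?_⟩
    · exact (S.mul_mem (S.pow_mem (S.prod_mem fun j' _ => hs' j') _) q.2) h
    · have h1 : κ (g j' • ((∏ j', s' j') ^ p ^ n) ^ p • m₁) -
          (if j = j' then ((∏ j', s' j') ^ p ^ n * q) • u else 0) =
          (∏ j', s' j') ^ p ^ n • w' j' := by
        rw [smul_comm, κ.map_pow_smul, smul_sub]
        split_ifs <;> simp [mul_smul]
      rw [h1]
      refine pow_smul_mem_nilSubmodule fun x => ?_
      obtain ⟨y, hy⟩ := Finset.dvd_prod_of_mem s' (Finset.mem_univ j')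
      rw [hy, mul_comm, mul_smul]
      have := hs'w j' (κ^[n] (x • w' j')) (CartierStructure.mem_image_iterate.2
        ⟨_, Submodule.smul_mem _ _ (Submodule.mem_span_singleton_self _), rfl⟩)
      rw [(Submodule.mem_bot R).1 this, smul_zero]
  have hdual' : ∃ c ∈ S, ∀ u ∈ P, ∀ j : T, ∃ m ∈ P, ∀ j' : T,
      κ (g j' • m) - (if j = j' then c • u else 0) ∈ nilSubmodule κ n := by
    have hj : ∀ j : T, ∃ c ∈ S, ∀ u ∈ P, ∃ m ∈ P, ∀ j' : T,
        κ (g j' • m) - (if j = j' then c • u else 0) ∈ nilSubmodule κ n := by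
      intro j
      let N' : Submodule R M :=
        { carrier := {u | ∃ m ∈ P, ∀ j' : T,
            κ (g j' • m) - (if j = j' then u else 0) ∈ nilSubmodule κ n}
          zero_mem' := ⟨0, P.zero_mem, fun j' => by simp⟩
          add_mem' := by
            rintro u u' ⟨m, hm, h⟩ ⟨m', hm', h'⟩
            refine ⟨m + m', P.add_mem hm hm', fun j' => ?_⟩
            convert (nilSubmodule κ n).add_mem (h j') (h' j') using 1
            rw [smul_add, map_add]
            split_ifs <;> abel
          smul_mem' := by
            rintro e u ⟨m, hm, h⟩
            refine ⟨e ^ p • m, P.smul_mem _ hm, fun j' => ?_⟩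
            convert (nilSubmodule κ n).smul_mem e (h j') using 1
            rw [smul_comm, κ.map_pow_smul, smul_sub]
            split_ifs <;> simp }
      exact exists_smul_mem_of_fg (N := P) (N' := N') (S := S) (IsNoetherian.noetherian P)
        fun u hu => (hdual u hu j).imp fun c hc => ⟨hc.1, hc.2⟩
    choose c hc hcu using hj
    refine ⟨∏ j, c j, S.prod_mem fun j _ => hc j, fun u hu j => ?_⟩
    obtain ⟨y, hy⟩ := Finset.dvd_prod_of_mem c (Finset.mem_univ j)
    rw [hy, mul_comm]
    exact hscale (hcu j u hu) y
  obtain ⟨c₂, hc₂, hc₂u⟩ := hdual'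
  have hsd : s * d ∈ S := S.mul_mem hs hd
  refine ⟨(s * d) ^ p * c₂ ^ p, S.mul_mem (S.pow_mem hsd p) (S.pow_mem hc₂ p), n, r, T,
    fun j => g j, fun e he => ⟨fun x => ?_, fun u hu j => ?_⟩⟩
  · rw [mul_assoc _ (c₂ ^ p), ← mul_pow]
    exact hcoords (c₂ * e) x
  · obtain ⟨l, hl⟩ := Nat.exists_eq_succ_of_ne_zero hp.ne_zero
    have := hscale (hc₂u u hu j) ((s * d) ^ p * c₂ ^ l * e ^ p)
    convert this using 8
    rw [hl, pow_succ c₂]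
    ring

end Localized

theorem minimal_support_iff {N : Type*} [AddCommGroup N] [Module R N] [Module.Finite R N]
    {η : PrimeSpectrum R} : Minimal (· ∈ Module.support R N) η ↔
      η.asIdeal ∈ (Module.annihilator R N).minimalPrimes := by
  rw [Module.support_eq_zeroLocus]
  constructor
  · exact fun h => ⟨⟨η.2, h.1⟩, fun Q hQ hle => h.2 (y := ⟨Q, hQ.1⟩) hQ.2 hle⟩
  · exact fun h => ⟨h.1.2, fun Q hQ hle => h.2 ⟨Q.2, hQ⟩ hle⟩

theorem ceil_mul_pow_le (p e : ℕ) {t : ℚ} : ⌈t * (p : ℚ) ^ e⌉₊ ≤ ⌈t⌉₊ * p ^ e := by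
  refine Nat.ceil_le.2 ?_
  push_cast
  exact mul_le_mul_of_nonneg_right (Nat.le_ceil t) (by positivity)

/-- A Cartier submodule `N` for `κ^{𝔞^t}` is stable under the powers of `κ` up to the denominator
`c ^ ⌈t⌉`, for any `c ∈ 𝔞`. -/
theorem IsCartierSubmodule.pow_smul_iterate_mem {κ : CartierStructure p R M} {𝔞 : Ideal R} {t : ℚ}
    {N : Submodule R M} (hN : IsCartierSubmodule κ 𝔞 t N) {c : R} (hc : t = 0 ∨ c ∈ 𝔞) (e : ℕ)
    {m : M} (hm : m ∈ N) : c ^ ⌈t⌉₊ • κ^[e] m ∈ N := by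
  rcases Nat.eq_zero_or_pos e with rfl | he
  · exact N.smul_mem _ hm
  · rw [← κ.iterate_pow_smul, ← pow_mul]
    refine plusAct_le_iff.1 hN e he _ ?_ m hm
    rcases hc with rfl | hc
    · simp
    · exact Ideal.pow_le_pow_right (ceil_mul_pow_le p e) (Ideal.pow_mem_pow hc _)

/-- Around a generic point of its support, a submodule that is fixed by `𝒞₊` has a splitting. -/
theorem exists_isSplitting_of_minimal [Fact p.Prime] [CharP R p] [IsNoetherianRing R]
    [Module.Finite R M] (hR : IsFFinite p R) {κ : CartierStructure p R M} {𝔞 : Ideal R} {t : ℚ}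
    (ht : 0 ≤ t) {P : Submodule R M} (hP : plusAct κ 𝔞 t P = P) {η : PrimeSpectrum R}
    (hη : Minimal (· ∈ Module.support R P) η) :
    ∃ c ∉ η.asIdeal, (t = 0 ∨ c ∈ 𝔞) ∧ ∃ n : ℕ, ∃ (r : ℕ) (T : Finset (Fin r)) (b : T → R),
      IsSplitting κ P c n b := by
  have hp : p.Prime := Fact.out
  have hmin := minimal_support_iff.1 hη
  have hann : ∀ {x : R}, x ∈ Module.annihilator R P ↔ ∀ m ∈ P, x • m = 0 := by
    intro x
    rw [Module.mem_annihilator]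
    exact ⟨fun h m hm => congrArg Subtype.val (h ⟨m, hm⟩), fun h m => Subtype.ext (h m m.2)⟩
  -- The annihilator of `P` is radical, so that it agrees with `η` in a neighbourhood of `η`.
  obtain ⟨s, hs, hsη⟩ : ∃ s ∈ η.asIdeal.primeCompl, ∀ r ∈ η.asIdeal, s • r ∈
      Module.annihilator R P := by
    refine exists_smul_mem_of_fg (IsNoetherian.noetherian η.asIdeal) fun r hr => ?_
    by_contra! hno
    let D : Submonoid R := η.asIdeal.primeCompl ⊔ Submonoid.powers r
    have hdis : Disjoint (Module.annihilator R P : Set R) (D : Set R) := by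
      rw [Set.disjoint_left]
      intro x hx hxD
      obtain ⟨s, hs, _, ⟨l, rfl⟩, rfl⟩ := Submonoid.mem_sup.1 hxD
      refine hno s hs (hann.2 fun m hm => ?_)
      refine smul_eq_zero_of_pow_smul_eq_zero hp hP (l := l + 1) (fun m hm => ?_) hm
      have : (s • r) ^ (l + 1) = (s ^ l * r) * (s * r ^ l) := by rw [smul_eq_mul]; ring
      rw [this, mul_smul, hann.1 hx m hm, smul_zero]
    obtain ⟨Q, hQ, hle, hQD⟩ := Ideal.exists_le_prime_disjoint _ D hdis
    have hQη : Q ≤ η.asIdeal := fun x hx => by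
      by_contra hxη
      exact Set.disjoint_left.1 hQD hx (Submonoid.mem_sup_left hxη)
    exact Set.disjoint_left.1 hQD (hmin.2 ⟨hQ, hle⟩ hQη hr)
      (Submonoid.mem_sup_right (Submonoid.mem_powers r))
  have hsP : ∀ r ∈ η.asIdeal, ∀ m ∈ P, (s * r) • m = 0 := fun r hr => hann.1 (hsη r hr)
  -- If `t > 0`, then `𝔞` is not contained in `η`: otherwise `𝒞₊ P` would vanish at `η`.
  obtain ⟨b, hb, hb𝔞⟩ : ∃ b ∉ η.asIdeal, t = 0 ∨ b ∈ 𝔞 := by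
    rcases ht.eq_or_lt with rfl | ht
    · exact ⟨1, fun h => η.2.ne_top ((Ideal.eq_top_iff_one _).2 h), Or.inl rfl⟩
    by_contra! hno
    refine hs (hmin.1.2 (hann.2 fun m hm => ?_))
    suffices plusAct κ 𝔞 t P ≤ LinearMap.ker (LinearMap.lsmul R M s) from this (hP.symm ▸ hm)
    refine plusAct_le_iff.2 fun e he r hr m hm => ?_
    have hr𝔞 : r ∈ 𝔞 := Ideal.pow_le_self (Nat.ceil_pos.2 (mul_pos ht (by
      have := hp.pos; positivity))).ne' hr
    obtain ⟨q, hq⟩ := Nat.exists_eq_succ_of_ne_zero (pow_pos hp.pos e).ne'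
    rw [LinearMap.mem_ker, LinearMap.lsmul_apply, ← κ.iterate_pow_smul, hq, pow_succ, smul_smul,
      mul_assoc, mul_smul, hsP r (by_contra fun h => (hno r h).2 hr𝔞) m hm, smul_zero,
      κ.iterate_zero']
  have hPc : IsCartierSubmodule κ 𝔞 t P := hP.le
  obtain ⟨c, hc, n, r, T, g, h⟩ := exists_isSplitting κ P η.asIdeal hR hs hsP
    (w := b ^ ⌈t⌉₊) (fun h => hb (η.2.mem_of_pow_mem _ h))
    (fun m hm => hPc.pow_smul_iterate_mem hb𝔞 1 hm)
  refine ⟨c * b ^ p, fun h => ?_, hb𝔞.imp_right fun h => ?_, n, r, T, g, h b hb⟩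
  · exact (η.2.mem_or_mem h).elim hc fun h => hb (η.2.mem_of_pow_mem _ h)
  · exact 𝔞.mul_mem_left _ (Ideal.pow_mem_of_mem _ h _ hp.pos)

end Splitting

/-! ### Test elements -/

section Core

variable {p : ℕ} {R S M Z : Type*} [CommRing R] [CommRing S] [Algebra R S]
  [AddCommGroup M] [Module R M] [AddCommGroup Z] [Module R Z] [Module S Z] [IsScalarTower R S Z]

/-- A chart for a Cartier module `Z` over an `R`-algebra `S` that is induced from a Cartier module
`M` over `R`: on the locus where `s` is invertible `S` is generated over `R` and its `p`-th powers
by the `g a`, and the Cartier operator `κZ` takes the coefficient of `g a` of a form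
`x • i m` when it is applied to `h a • x • i m`. For a smooth algebra with étale coordinates
`x₁, …, xₙ`, the `g a` are the monomials with exponents less than `p`, the `h a` are the
complementary monomials, and `i m = dx₁ ∧ ⋯ ∧ dxₙ ⊗ m`. -/
structure IsChart (κ : CartierStructure p R M) (κZ : CartierStructure p S Z) (s : S)
    (i : M →ₗ[R] Z) {α : Type*} [DecidableEq α] (g h : α → S) : Prop where
  orth : ∀ a a' m, κZ ((g a' * h a) • i m) = if a = a' then i (κ m) else 0
  span : ∀ x : S, ∃ l : ℕ, s ^ l * x ∈
    AddSubmonoid.closure {y : S | ∃ (r : R) (t : S) (a : α), y = algebraMap R S r * t ^ p * g a}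
  nil : ∀ (n : ℕ), ∀ v ∈ nilSubmodule κ n, ∀ σ : S, κZ^[n] (σ • i v) = 0

/-- A submodule that is fixed by `𝒞₊` is generated by values of high powers of `κ` on it. -/
theorem le_of_iterate_mem {κ : CartierStructure p R M} {𝔞 : Ideal R} {t : ℚ}
    {P : Submodule R M} (hP : plusAct κ 𝔞 t P = P) (n : ℕ) {Q : Submodule R M}
    (hQ : ∀ E, n ≤ E → ∀ z ∈ P, κ^[E] z ∈ Q) : P ≤ Q := by
  induction n generalizing Q with
  | zero => exact fun z hz => hQ 0 le_rfl z hz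
  | succ n ih =>
    let Q' : Submodule R M :=
      { carrier := {m | ∀ e : ℕ, 1 ≤ e → ∀ r : R, κ^[e] (r • m) ∈ Q}
        zero_mem' := fun e _ r => by rw [smul_zero, κ.iterate_zero']; exact Q.zero_mem
        add_mem' := fun {m m'} h h' e he r => by
          rw [smul_add, κ.iterate_add]; exact Q.add_mem (h e he r) (h' e he r)
        smul_mem' := fun x m h e he r => by rw [smul_smul]; exact h e he _ }
    have hPQ' : P ≤ Q' := ih fun E hE z hz e he r => by
      rw [← κ.iterate_pow_smul, ← Function.iterate_add_apply]
      exact hQ _ (by omega) _ (P.smul_mem _ hz)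
    rw [← hP]
    exact plusAct_le_iff.2 fun e he r _ m hm => hPQ' hm e he r

/-- The ideal of all `x` such that `κ ^ n` carries `x • P` into `N` on the locus where `f` is
invertible. -/
def carryIdeal (κZ : CartierStructure p S Z) (f : S) (n : ℕ) (P N : Submodule S Z) : Ideal S where
  carrier := {x | ∃ l : ℕ, ∀ z ∈ P, κZ^[n] (f ^ l • x • z) ∈ N}
  zero_mem' := ⟨0, fun z _ => by
    rw [zero_smul, smul_zero, κZ.iterate_zero']; exact N.zero_mem⟩
  add_mem' := by
    rintro x y ⟨l, hl⟩ ⟨k, hk⟩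
    refine ⟨l + k, fun z hz => ?_⟩
    have : f ^ (l + k) • (x + y) • z = f ^ l • x • f ^ k • z + f ^ k • y • f ^ l • z := by
      simp only [smul_smul, ← add_smul]
      congr 1
      ring
    rw [this, κZ.iterate_add]
    exact N.add_mem (hl _ (P.smul_mem _ hz)) (hk _ (P.smul_mem _ hz))
  smul_mem' := by
    rintro c x ⟨l, hl⟩
    refine ⟨l, fun z hz => ?_⟩
    rw [smul_eq_mul, mul_comm, mul_smul]
    exact hl _ (P.smul_mem _ hz)

/-- The ideal `J = carryIdeal` is contained in its square on the locus where `C * s` is invertible: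
`x ∈ J` is a combination `∑ τ ^ p • b • g`, and the chart and the splitting show that the
coefficients `τ` belong to `J`. -/
theorem exists_pow_smul_mem_carryIdeal_sq [Fact p.Prime] [CharP S p]
    {κ : CartierStructure p R M} {P : Submodule R M} {c : R} {n : ℕ}
    {ι : Type*} [Fintype ι] [DecidableEq ι] {b : ι → R} (hsplit : IsSplitting κ P c n b)
    {κZ : CartierStructure p S Z} {s : S} {i : M →ₗ[R] Z} {α : Type*} [DecidableEq α] [Fintype α]
    {g h : α → S} (hchart : IsChart κ κZ s i g h) {𝔟 : Ideal S} {t : ℚ}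
    (hc : t = 0 ∨ algebraMap R S c ∈ 𝔟) {P' N' : Submodule S Z} (hfg : P'.FG)
    (hann : ∀ r : R, (∀ m ∈ P, r • m = 0) → ∀ z ∈ P', r • z = 0)
    (hi : ∀ m ∈ P, i m ∈ P')
    (hgen : ∀ z ∈ P', ∃ l : ℕ, s ^ l • z ∈ Submodule.span S (i '' P))
    (hN' : IsCartierSubmodule κZ 𝔟 t N') {x : S}
    (hx : x ∈ carryIdeal κZ (algebraMap R S c * s) n P' N') {z : Z} (hz : z ∈ P') :
    ∃ L : ℕ, (algebraMap R S c * s) ^ L • x • z ∈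
      carryIdeal κZ (algebraMap R S c * s) n P' N' •
        carryIdeal κZ (algebraMap R S c * s) n P' N' • P' := by
  classical
  set C := algebraMap R S c with hC
  set f := C * s with hf
  set J := carryIdeal κZ f n P' N' with hJ
  have hp : p.Prime := Fact.out
  -- expansion of `C * s ^ l * x` in the basis
  have hexp : ∀ y ∈ AddSubmonoid.closure {y : S | ∃ (r : R) (t : S) (a : α),
      y = algebraMap R S r * t ^ p * g a}, ∃ τ : α → ι → S, ∀ z ∈ P',
      (C * y) • z = (∑ a, ∑ j, τ a j ^ p * algebraMap R S (b j) * g a) • z := by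
    intro y hy
    induction hy using AddSubmonoid.closure_induction with
    | mem y hy =>
      obtain ⟨r, t, a, rfl⟩ := hy
      obtain ⟨k, hk⟩ := hsplit.coords r
      refine ⟨fun a' j => if a' = a then algebraMap R S (k j) * t else 0, fun z hz => ?_⟩
      have h1 := hann _ hk _ (P'.smul_mem (t ^ p * g a) hz)
      rw [← algebraMap_smul S, smul_smul] at h1
      rw [← sub_eq_zero, ← sub_smul, ← h1]
      congr 1
      rw [Finset.sum_eq_single a (fun a' _ ha' => by simp [ha', hp.ne_zero]) (by simp)]
      simp only [if_true, map_sub, map_mul, map_sum, map_pow, sub_mul, Finset.sum_mul]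
      congr 1
      · ring
      · exact Finset.sum_congr rfl fun j _ => by ring
    | zero => exact ⟨0, fun z _ => by simp [hp.ne_zero]⟩
    | add y y' _ _ h h' =>
      obtain ⟨τ, hτ⟩ := h
      obtain ⟨τ', hτ'⟩ := h'
      refine ⟨τ + τ', fun z hz => ?_⟩
      rw [mul_add, add_smul, hτ z hz, hτ' z hz, ← add_smul]
      congr 1
      simp_rw [← Finset.sum_add_distrib, ← add_mul, Pi.add_apply, add_pow_char]
  obtain ⟨k, hk⟩ := hchart.span x
  obtain ⟨τ, hτ⟩ := hexp _ hk
  have hτJ : ∀ a j, τ a j ∈ J := by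
    intro a j
    obtain ⟨l, hl⟩ := hx
    set w := ⌈t⌉₊
    set F := w * p ^ n + l with hF
    -- the value of `κZ ^ n` on the forms `y • i u`
    have key : ∀ u ∈ P, ∀ y : S, κZ^[n] (f ^ (F + 1) • τ a j • y • i u) ∈ N' := by
      intro u hu y
      obtain ⟨m, hm, hmu⟩ := hsplit.dual u hu j
      let z' : Z := (s ^ k * C * s ^ (w * p ^ (n + 1)) * f ^ ((p - 1) * l) * (s * y) ^ p * h a) • i m
      have hz' : z' ∈ P' := P'.smul_mem _ (hi m hm)
      have h1 := hN'.pow_smul_iterate_mem hc 1 (hl z' hz')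
      rw [Function.iterate_one, ← Function.iterate_succ_apply' κZ, ← κZ.iterate_pow_smul] at h1
      have h2 : (C ^ w) ^ p ^ (n + 1) • f ^ l • x • z' =
          ((f ^ F * (s * y)) ^ p) • (C * (s ^ k * x)) • h a • i m := by
        have e1 : f ^ (F * p) = C ^ (w * p ^ (n + 1)) * s ^ (w * p ^ (n + 1)) *
            (f ^ ((p - 1) * l) * f ^ l) := by
          have e2 : (p - 1) * l + l = p * l := by
            rw [← Nat.succ_mul, Nat.succ_eq_add_one, Nat.sub_add_cancel hp.one_le]
          rw [← pow_add, e2, ← mul_pow, ← pow_add, hF]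
          congr 1
          ring
        simp only [z', smul_smul]
        congr 1
        rw [← pow_mul C, mul_pow (f ^ F), ← pow_mul f, e1]
        ring
      have h3 : κZ ((C ^ w) ^ p ^ (n + 1) • f ^ l • x • z') =
          f ^ (F + 1) • τ a j • y • i u +
            ∑ j', (f ^ F * (s * y) * τ a j') • i (κ (b j' • m) - if j = j' then c • u else 0) := by
        rw [h2, κZ.map_pow_smul, hτ _ (P'.smul_mem _ (hi m hm))]
        have h4 : ∀ a' j', (τ a' j' ^ p * algebraMap R S (b j') * g a') • h a • i m =
            τ a' j' ^ p • (g a' * h a) • i (b j' • m) := by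
          intro a' j'
          rw [map_smul, ← algebraMap_smul S (b j')]
          simp only [smul_smul]
          congr 1
          ring
        have h5 : κZ ((∑ a', ∑ j', τ a' j' ^ p * algebraMap R S (b j') * g a') • h a • i m) =
            ∑ j', τ a j' • i (κ (b j' • m)) := by
          simp only [Finset.sum_smul, map_sum, h4, κZ.map_pow_smul, hchart.orth]
          rw [Finset.sum_eq_single a]
          · simp
          · exact fun a' _ ha' => Finset.sum_eq_zero fun j' _ => by
              rw [if_neg (Ne.symm ha'), smul_zero]
          · simp
        have h6 : ∀ j', (f ^ F * (s * y) * τ a j') • i (κ (b j' • m) - if j = j' then c • u else 0) =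
            (f ^ F * (s * y)) • τ a j' • i (κ (b j' • m)) -
              if j = j' then f ^ (F + 1) • τ a j • y • i u else 0 := by
          intro j'
          split_ifs with hjj
          · subst hjj
            rw [map_sub, smul_sub, mul_smul, i.map_smul, ← algebraMap_smul S c (i u)]
            congr 1
            simp only [smul_smul]
            congr 1
            rw [hf]
            ring
          · rw [sub_zero, sub_zero, mul_smul]
        rw [h5, Finset.sum_congr rfl fun j' _ => h6 j', Finset.sum_sub_distrib, Finset.smul_sum]
        simp
      rw [Function.iterate_succ_apply, h3, κZ.iterate_add, κZ.iterate_sum,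
        Finset.sum_eq_zero fun j' _ => hchart.nil n _ (hmu j') _, add_zero] at h1
      exact h1
    have hspan : ∀ z ∈ Submodule.span S (i '' P), ∀ y : S,
        κZ^[n] (f ^ (F + 1) • τ a j • y • z) ∈ N' := by
      intro z hz
      induction hz using Submodule.span_induction with
      | mem z hz =>
        obtain ⟨u, hu, rfl⟩ := hz
        exact key u hu
      | zero => intro y; simpa only [smul_zero, κZ.iterate_zero'] using N'.zero_mem
      | add z z' _ _ h h' =>
        intro y
        simpa only [smul_add, κZ.iterate_add] using N'.add_mem (h y) (h' y)
      | smul y' z _ h => intro y; rw [smul_smul y]; exact h _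
    obtain ⟨_, ⟨K, rfl⟩, hK⟩ := exists_smul_mem_of_fg (S := Submonoid.powers s) hfg fun z hz =>
      (hgen z hz).elim fun l hl => ⟨s ^ l, ⟨l, rfl⟩, hl⟩
    refine ⟨F + 1 + K, fun z hz => ?_⟩
    have := hspan _ (hK z hz) (C ^ K)
    convert this using 2
    simp only [smul_smul]
    congr 1
    rw [hf]
    ring
  refine ⟨k + 1, ?_⟩
  have h1 : f ^ (k + 1) • x • z = (C ^ k * s) • (C * (s ^ k * x)) • z := by
    simp only [smul_smul]
    congr 1
    rw [hf]
    ring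
  rw [h1, hτ z hz]
  refine Submodule.smul_mem _ _ ?_
  simp only [Finset.sum_smul]
  refine Submodule.sum_mem _ fun a _ => Submodule.sum_mem _ fun j _ => ?_
  have h2 : (τ a j ^ p * algebraMap R S (b j) * g a) • z =
      τ a j • τ a j • (τ a j ^ (p - 2) * algebraMap R S (b j) * g a) • z := by
    simp only [smul_smul]
    congr 1
    have : τ a j ^ p = τ a j ^ (p - 2) * (τ a j * τ a j) := by
      rw [← pow_two, ← pow_add, Nat.sub_add_cancel hp.two_le]
    rw [this]
    ring
  rw [h2]
  exact Submodule.smul_mem_smul (hτJ a j) (Submodule.smul_mem_smul (hτJ a j) (P'.smul_mem _ hz))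

/-- The uniform bound behind test elements: on the locus where `C * s` is invertible, a Cartier
submodule `N'` that agrees with `P'` at the generic points of its support contains `P'`. Indeed
`J = carryIdeal` is idempotent on that locus, hence open and closed, and it meets every
component of the support of `P'`, so it is the unit ideal. -/
theorem exists_pow_smul_mem_of_generic [Fact p.Prime] [CharP S p] [IsNoetherianRing S]
    {κ : CartierStructure p R M} {P : Submodule R M} {c : R} {n : ℕ}
    {ι : Type*} [Fintype ι] [DecidableEq ι] {b : ι → R} (hsplit : IsSplitting κ P c n b)
    {κZ : CartierStructure p S Z} {s : S} {i : M →ₗ[R] Z} {α : Type*} [DecidableEq α] [Fintype α]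
    {g h : α → S} (hchart : IsChart κ κZ s i g h) {𝔟 : Ideal S} {t : ℚ}
    (hc : t = 0 ∨ algebraMap R S c ∈ 𝔟) {P' N' : Submodule S Z} (hfg : P'.FG)
    (hann : ∀ r : R, (∀ m ∈ P, r • m = 0) → ∀ z ∈ P', r • z = 0)
    (hi : ∀ m ∈ P, i m ∈ P')
    (hgen : ∀ z ∈ P', ∃ l : ℕ, s ^ l • z ∈ Submodule.span S (i '' P))
    (hP' : plusAct κZ 𝔟 t P' = P') (hN' : IsCartierSubmodule κZ 𝔟 t N')
    (hgeneric : ∀ η, Minimal (· ∈ Module.support S P') η → ∃ r ∉ η.asIdeal, ∀ z ∈ P', r • z ∈ N') :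
    ∃ L : ℕ, ∀ z ∈ P', (algebraMap R S c * s) ^ L • z ∈ N' := by
  set C := algebraMap R S c with hC
  set f := C * s with hf
  set J := carryIdeal κZ f n P' N' with hJ
  set w := ⌈t⌉₊
  have : Module.Finite S P' := Module.Finite.of_fg hfg
  have hP'c : IsCartierSubmodule κZ 𝔟 t P' := hP'.le
  have hannJ : Module.annihilator S P' ≤ J := fun x hx => ⟨0, fun z hz => by
    have : x • z = 0 := congrArg Subtype.val (Module.mem_annihilator.1 hx ⟨z, hz⟩)
    rw [this, smul_zero, κZ.iterate_zero']
    exact N'.zero_mem⟩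
  have hmem : ∃ l : ℕ, f ^ l ∈ J := by
    by_contra! hno
    obtain ⟨Q, hQ, hJQ, hfQ⟩ := Ideal.exists_le_prime_disjoint J (Submonoid.powers f)
      (Set.disjoint_left.2 fun x hx => by rintro ⟨l, rfl⟩; exact hno l hx)
    have hfQ' : f ∉ Q := fun hf => Set.disjoint_left.1 hfQ hf (Submonoid.mem_powers f)
    -- Cayley-Hamilton for multiplication by a power of `f` on `J • P'`
    have hfgJ : (J • P').FG := Submodule.FG.smul (IsNoetherian.noetherian J) hfg
    obtain ⟨_, ⟨L, rfl⟩, hL⟩ := exists_smul_mem_of_fg (S := Submonoid.powers f)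
      (N := J • P') (N' := J • J • P') hfgJ fun z hz => by
        induction hz using Submodule.smul_induction_on' with
        | smul x hx z hz =>
          obtain ⟨L, hL⟩ := exists_pow_smul_mem_carryIdeal_sq hsplit hchart hc hfg hann hi hgen hN'
            hx hz
          exact ⟨f ^ L, ⟨L, rfl⟩, hL⟩
        | add z _ z' _ h h' =>
          obtain ⟨_, ⟨L, rfl⟩, hL⟩ := h
          obtain ⟨_, ⟨L', rfl⟩, hL'⟩ := h'
          refine ⟨f ^ L * f ^ L', ⟨L + L', pow_add _ _ _⟩, ?_⟩
          rw [smul_add]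
          refine Submodule.add_mem _ ?_ ?_
          · rw [mul_comm, mul_smul]; exact Submodule.smul_mem _ _ hL
          · rw [mul_smul]; exact Submodule.smul_mem _ _ hL'
    have : Module.Finite S (J • P' : Submodule S Z) := Module.Finite.of_fg hfgJ
    obtain ⟨q, hqm, -, hqc, hq0⟩ :=
      LinearMap.exists_monic_and_natDegree_eq_and_coeff_mem_pow_and_aeval_eq_zero S
        (algebraMap S (Module.End S (J • P' : Submodule S Z)) (f ^ L)) J (by
          rintro _ ⟨⟨z, hz⟩, rfl⟩
          exact (Submodule.mem_smul_top_iff _ _ _).2 (hL z hz))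
    rw [Polynomial.aeval_algebraMap_apply, Polynomial.coe_aeval_eq_eval] at hq0
    set d := q.eval (f ^ L) with hd
    have hdQ : d ∉ Q := by
      intro hdQ
      rw [hd, Polynomial.eval_eq_sum_range, Finset.sum_range_succ, hqm.coeff_natDegree, one_mul,
        Ideal.add_mem_iff_right] at hdQ
      · exact hfQ' (hQ.mem_of_pow_mem _ (hQ.mem_of_pow_mem _ hdQ))
      · refine Q.sum_mem fun k hk => Q.mul_mem_right _ (hJQ ?_)
        exact Ideal.pow_le_self (Nat.sub_pos_of_lt (Finset.mem_range.1 hk)).ne' (hqc k)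
    -- a generic point below `Q`
    obtain ⟨η, hη, hηQ⟩ := Ideal.exists_minimalPrimes_le (hannJ.trans hJQ)
    obtain ⟨r, hrη, hr⟩ := hgeneric ⟨η, hη.1.1⟩ (minimal_support_iff.2 hη)
    have hrJ : r ^ p ^ n ∈ J := by
      refine ⟨w * p ^ n, fun z hz => ?_⟩
      rw [smul_comm, κZ.iterate_pow_smul, hf, mul_pow, mul_smul, pow_mul, κZ.iterate_pow_smul]
      exact hr _ (hP'c.pow_smul_iterate_mem hc n (P'.smul_mem _ hz))
    have hdr : d * r ^ p ^ n ∈ Module.annihilator S P' := by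
      refine Module.mem_annihilator.2 fun z => Subtype.ext ?_
      have := LinearMap.congr_fun hq0 ⟨r ^ p ^ n • (z : Z), Submodule.smul_mem_smul hrJ z.2⟩
      have := congrArg Subtype.val this
      rw [mul_smul]
      exact this
    rcases hη.1.1.mem_or_mem (hη.1.2 hdr) with h | h
    · exact hdQ (hηQ h)
    · exact hrη (hη.1.1.mem_of_pow_mem _ h)
  obtain ⟨l, l', hl⟩ := hmem
  refine ⟨l' + l + w, ?_⟩
  suffices P' ≤ N'.comap (LinearMap.lsmul S Z (f ^ (l' + l + w))) from fun z hz => this hz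
  refine le_of_iterate_mem hP' n fun E hE z hz => ?_
  obtain ⟨e, rfl⟩ := Nat.exists_eq_add_of_le hE
  rw [Submodule.mem_comap, LinearMap.lsmul_apply, Function.iterate_add_apply,
    ← κZ.iterate_pow_smul, ← pow_mul]
  obtain ⟨k, hk⟩ : ∃ k, (l' + l + w) * p ^ n = l' + l + w + k :=
    Nat.exists_eq_add_of_le (Nat.le_mul_of_pos_right _ (pow_pos (Fact.out : p.Prime).pos n))
  have h1 : f ^ ((l' + l + w) * p ^ n) • κZ^[e] z =
      f ^ l' • f ^ l • (f ^ k * s ^ w) • C ^ w • κZ^[e] z := by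
    rw [hk]
    simp only [smul_smul]
    congr 1
    rw [hf]
    ring
  rw [h1]
  exact hl _ (P'.smul_mem _ (hP'c.pow_smul_iterate_mem hc e hz))

end Core

/-! ### Existence of test modules over `F`-finite rings -/

section FFinite

theorem exists_sum_of_finite {A B : Type*} [CommRing A] [CommRing B] {f : A →+* B}
    (hf : f.Finite) : ∃ (r : ℕ) (g : Fin r → B), ∀ x, ∃ c : Fin r → A, x = ∑ i, f (c i) * g i := by
  algebraize [f]
  obtain ⟨r, g, hg⟩ := Module.Finite.exists_fin (R := A) (M := B)
  refine ⟨r, g, fun x => ?_⟩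
  obtain ⟨c, hc⟩ := (Submodule.mem_span_range_iff_exists_fun A).1 (hg ▸ Submodule.mem_top (x := x))
  exact ⟨c, by rw [← hc]; exact Finset.sum_congr rfl fun i _ => Algebra.smul_def _ _⟩

/-- An integral algebra that is essentially of finite type is finite: the denominators are units of
the subalgebra of finite type already. -/
theorem finite_of_essFiniteType_of_isIntegral (A B : Type*) [CommRing A] [CommRing B] [Algebra A B]
    [Algebra.EssFiniteType A B] [Algebra.IsIntegral A B] : Module.Finite A B := by
  let B₀ := Algebra.EssFiniteType.subalgebra A B
  have : Algebra.IsIntegral B₀ B := Algebra.IsIntegral.tower_top A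
  have htop : B₀ = ⊤ := by
    refine eq_top_iff.2 fun b _ => ?_
    obtain ⟨a, s, rfl⟩ := IsLocalization.exists_mk'_eq (Algebra.EssFiniteType.submonoid A B) b
    obtain ⟨u, hu⟩ : IsUnit (s : B₀) := isUnit_of_map_unit (algebraMap B₀ B) _ s.2
    have : IsLocalization.mk' B a s = algebraMap B₀ B (a * ↑u⁻¹) := by
      rw [IsLocalization.mk'_eq_iff_eq_mul, ← map_mul, ← hu, Units.inv_mul_cancel_right]
    rw [this]
    exact (a * ↑u⁻¹ : B₀).2
  have : Algebra.FiniteType A B := by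
    have : Algebra.FiniteType A B₀ := inferInstance
    rw [htop] at this
    exact this.equiv Subalgebra.topEquiv
  exact Algebra.IsIntegral.finite

/-- A ring that is essentially of finite type over an `F`-finite field is `F`-finite. -/
theorem isFFinite_of_essFiniteType {p : ℕ} [Fact p.Prime] {k R : Type*} [Field k] [CharP k p]
    (hk : (frobenius k p).Finite) [CommRing R] [CharP R p] [Algebra k R]
    [Algebra.EssFiniteType k R] : IsFFinite p R := by
  have h1 : ((frobenius R p).comp (algebraMap k R)).EssFiniteType := by
    have : (frobenius R p).comp (algebraMap k R) = (algebraMap k R).comp (frobenius k p) :=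
      RingHom.ext fun x => (map_pow (algebraMap k R) x p).symm
    rw [this]
    exact RingHom.EssFiniteType.comp hk.finiteType.essFiniteType
      (RingHom.essFiniteType_algebraMap.2 inferInstance)
  have h2 : (frobenius R p).EssFiniteType := RingHom.EssFiniteType.of_comp _ h1
  have h3 : (frobenius R p).IsIntegral := fun x =>
    ⟨Polynomial.X ^ p - Polynomial.C x,
      Polynomial.monic_X_pow_sub_C _ (Fact.out : p.Prime).ne_zero, by
      simp [frobenius_def]⟩
  have key : ∀ {A B : Type _} [CommRing A] [CommRing B] (f : A →+* B), f.EssFiniteType →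
      f.IsIntegral → f.Finite := by
    intro A B _ _ f hf hi
    algebraize [f]
    exact finite_of_essFiniteType_of_isIntegral A B
  exact exists_sum_of_finite (key _ h2 h3)

end FFinite

section Existence

variable {p : ℕ} {R M : Type*} [CommRing R] [AddCommGroup M] [Module R M]

/-- The denominators of the splittings of `P`. They are test elements for `P` and for its pullback to
every smooth algebra. -/
def splittingElements (κ : CartierStructure p R M) (𝔞 : Ideal R) (t : ℚ) (P : Submodule R M) :
    Set R :=
  {c | (t = 0 ∨ c ∈ 𝔞) ∧ ∃ n : ℕ, ∃ (r : ℕ) (T : Finset (Fin r)) (b : T → R),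
    IsSplitting κ P c n b}

variable {κ : CartierStructure p R M} {𝔞 : Ideal R} {t : ℚ} {P : Submodule R M}

theorem isChart_id (κ : CartierStructure p R M) :
    IsChart κ κ (1 : R) LinearMap.id (fun _ : Unit => 1) (fun _ => 1) where
  orth a a' m := by simp
  span x := ⟨0, AddSubmonoid.subset_closure ⟨x, 1, (), by simp⟩⟩
  nil n v hv σ := hv σ

/-- The submodule `∑ c • P` over all `c ∈ T` is contained in its image under `𝒞₊`. -/
theorem span_smul_le_plusAct (hp : p.Prime) (hP : plusAct κ 𝔞 t P = P) (T : Set R) :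
    Ideal.span T • P ≤ plusAct κ 𝔞 t (Ideal.span T • P) := by
  refine Submodule.smul_le.2 fun r hr m hm => ?_
  suffices Ideal.span T ≤ (plusAct κ 𝔞 t (Ideal.span T • P)).comap (LinearMap.toSpanSingleton R M m)
    from this hr
  refine Ideal.span_le.2 fun c hc => ?_
  refine smul_mem_plusAct hp (N := P) (fun m hm => ?_) (hP.symm ▸ hm)
  exact Submodule.smul_mem_smul (Ideal.pow_mem_of_mem _ (Ideal.subset_span hc) 2 two_pos) hm

theorem exists_plusAct_iterate_eq [IsNoetherian R M] {Q : Submodule R M}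
    (hQ : Q ≤ plusAct κ 𝔞 t Q) :
    ∃ h : ℕ, Q ≤ (plusAct κ 𝔞 t)^[h] Q ∧
      plusAct κ 𝔞 t ((plusAct κ 𝔞 t)^[h] Q) = (plusAct κ 𝔞 t)^[h] Q := by
  have hmono : Monotone fun h : ℕ => (plusAct κ 𝔞 t)^[h] Q :=
    plusAct_mono.monotone_iterate_of_le_map hQ
  obtain ⟨h, hh⟩ := monotone_stabilizes_iff_noetherian.2 ‹_› ⟨_, hmono⟩
  refine ⟨h, hmono (Nat.zero_le h), ?_⟩
  rw [← Function.iterate_succ_apply' (plusAct κ 𝔞 t)]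
  exact (hh (h + 1) (Nat.le_succ h)).symm

/-- A Cartier submodule into which some power of every `c ∈ T` carries `P` contains `𝒞₊ ^ h` of
`∑ c • P`. -/
theorem iterate_span_smul_le (hp : p.Prime) (hP : plusAct κ 𝔞 t P = P) {T : Set R}
    {N : Submodule R M} (hN : IsCartierSubmodule κ 𝔞 t N)
    (h : ∀ c ∈ T, ∃ l : ℕ, ∀ m ∈ P, c ^ l • m ∈ N) (k : ℕ) :
    (plusAct κ 𝔞 t)^[k] (Ideal.span T • P) ≤ N := by
  refine (plusAct_iterate_mono k (Submodule.smul_le.2 fun r hr m hm => ?_)).trans (hN.iterate_le k)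
  suffices Ideal.span T ≤ N.comap (LinearMap.toSpanSingleton R M m) from this hr
  refine Ideal.span_le.2 fun c hc => ?_
  obtain ⟨l, hl⟩ := h c hc
  exact smul_mem_of_pow_smul_mem hp hP hN hl hm

theorem genericallyAgrees_of_le {N P : Submodule R M} (hNP : N ≤ P)
    (h : ∀ η, Minimal (· ∈ Module.support R P) η → ∃ s ∉ η.asIdeal, ∀ m ∈ P, s • m ∈ N) :
    GenericallyAgrees N P := fun η hη => by
  obtain ⟨s, hs, hsm⟩ := h η hη
  exact le_antisymm (localized_mono hNP) (localized_le_of_smul_mem (S := η.asIdeal.primeCompl) hs hsm)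

theorem GenericallyAgrees.exists_smul_mem [IsNoetherian R M] {N P : Submodule R M}
    (h : GenericallyAgrees N P) {η : PrimeSpectrum R}
    (hη : Minimal (· ∈ Module.support R P) η) : ∃ s ∉ η.asIdeal, ∀ m ∈ P, s • m ∈ N :=
  exists_smul_le_of_localized_le (S := η.asIdeal.primeCompl) (IsNoetherian.noetherian P) (h η hη).ge

/-- The test module is `𝒞₊ ^ h` of `∑ c • P` for large `h`, where `P` is the `F`-pure part and `c`
ranges over the denominators of its splittings. -/
theorem exists_isLeast_testCandidates [Fact p.Prime] [CharP R p] [IsNoetherianRing R]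
    [Module.Finite R M] (hR : IsFFinite p R) (κ : CartierStructure p R M) (𝔞 : Ideal R)
    (ht : 0 ≤ t) : ∃ h : ℕ, IsLeast (testCandidates κ 𝔞 t) ((plusAct κ 𝔞 t)^[h]
      (Ideal.span (splittingElements κ 𝔞 t (fPurePart κ 𝔞 t)) • fPurePart κ 𝔞 t)) := by
  have hp : p.Prime := Fact.out
  set P := fPurePart κ 𝔞 t
  set T := splittingElements κ 𝔞 t P
  have hP : plusAct κ 𝔞 t P = P := plusAct_fPurePart hp κ 𝔞 t
  obtain ⟨h, hQ, hh⟩ := exists_plusAct_iterate_eq (span_smul_le_plusAct hp hP T)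
  refine ⟨h, ⟨hh.le, genericallyAgrees_of_le ?_ fun η hη => ?_⟩, fun N hN => ?_⟩
  · calc _ ≤ (plusAct κ 𝔞 t)^[h] P := plusAct_iterate_mono h Submodule.smul_le_right
      _ = P := Function.iterate_fixed hP h
  · obtain ⟨c, hc, hc𝔞, hs⟩ := exists_isSplitting_of_minimal hR ht hP hη
    exact ⟨c, hc, fun m hm => hQ (Submodule.smul_mem_smul (Ideal.subset_span ⟨hc𝔞, hs⟩) hm)⟩
  · refine iterate_span_smul_le hp hP hN.1 (fun c hc => ?_) h
    obtain ⟨hc𝔞, n, r, T, b, hs⟩ := hc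
    obtain ⟨L, hL⟩ := exists_pow_smul_mem_of_generic hs (isChart_id κ) (𝔟 := 𝔞) hc𝔞
      (P' := P) (N' := N) (IsNoetherian.noetherian P) (fun r h => h) (fun m hm => hm)
      (fun z hz => ⟨0, Submodule.subset_span ⟨z, by simpa using hz, by simp⟩⟩) hP hN.1
      (fun η hη => hN.2.exists_smul_mem hη)
    exact ⟨L, by simpa using hL⟩

end Existence

/-! ### The relative Frobenius of an étale algebra -/

section Frobenius

theorem add_pow_prime_of_natCast_eq_zero {A : Type*} [CommRing A] {p : ℕ} (hp : p.Prime)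
    (h : (p : A) = 0) (x y : A) : (x + y) ^ p = x ^ p + y ^ p := by
  obtain ⟨r, hr⟩ := exists_add_pow_prime_eq hp x y
  rw [hr, h, zero_mul, zero_mul, zero_mul, add_zero]

/-- If `T` is unramified over `B` and `Spec T → Spec B` is a universal homeomorphism because `B`
contains the `p`-th powers of `T`, then `B → T` is surjective: the ideal of the diagonal is
idempotent, finitely generated and nil, hence zero, so that `B → T` is a finite epimorphism. -/
theorem surjective_of_formallyUnramified {B T : Type*} [CommRing B] [CommRing T] [Algebra B T]
    [Algebra.FormallyUnramified B T] [Algebra.FiniteType B T] {p : ℕ} (hp : p.Prime)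
    (h0 : (p : T) = 0) (h : ∀ t : T, t ^ p ∈ (algebraMap B T).range) :
    Function.Surjective (algebraMap B T) := by
  have : Algebra.IsIntegral B T := ⟨fun t => by
    obtain ⟨b, hb⟩ := h t
    exact .of_pow hp.pos (hb ▸ isIntegral_algebraMap)⟩
  have : Module.Finite B T := Algebra.IsIntegral.finite
  have hI : KaehlerDifferential.ideal B T = ⊥ := by
    obtain ⟨e, he, hIe⟩ := (Ideal.isIdempotentElem_iff_of_fg _ (KaehlerDifferential.ideal_fg B T)).1
      ((Ideal.cotangent_subsingleton_iff _).1
        (inferInstanceAs (Subsingleton (Ω[T⁄B]))))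
    have hnil : KaehlerDifferential.ideal B T ≤ nilradical (T ⊗[B] T) := by
      rw [← KaehlerDifferential.span_range_eq_ideal, Ideal.span_le]
      rintro _ ⟨t, rfl⟩
      refine ⟨p, ?_⟩
      have h1 : (p : T ⊗[B] T) = 0 := by
        rw [← map_natCast (algebraMap T (T ⊗[B] T)), h0, map_zero]
      have h2 := add_pow_prime_of_natCast_eq_zero hp h1 ((1 : T) ⊗ₜ[B] t - t ⊗ₜ[B] 1) (t ⊗ₜ[B] 1)
      obtain ⟨b, hb⟩ := h t
      rw [sub_add_cancel, Algebra.TensorProduct.tmul_pow, Algebra.TensorProduct.tmul_pow, one_pow,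
        ← hb, Algebra.algebraMap_eq_smul_one, TensorProduct.tmul_smul, ← TensorProduct.smul_tmul'] at h2
      simpa using h2.symm
    have he0 : e = 0 := by
      obtain ⟨n, hn⟩ := hnil (hIe ▸ Ideal.subset_span rfl : e ∈ _)
      rcases n with - | n
      · rw [pow_zero] at hn
        rw [← mul_one e, hn, mul_zero]
      · rw [← he.pow_succ_eq n, hn]
    rw [hIe, he0]
    simp
  have : Algebra.IsEpi B T := ⟨(injective_iff_map_eq_zero _).2 fun z hz => by
    have : z ∈ KaehlerDifferential.ideal B T := by
      exact hz
    rwa [hI] at this⟩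
  exact Algebra.isEpi_iff_surjective_algebraMap_of_finite.1 this

/-- A map of étale algebras is injective if its kernel is nil and if it is surjective. -/
theorem injective_of_etale {C B T : Type*} [CommRing C] [CommRing B] [CommRing T] [Algebra C B]
    [Algebra C T] [Algebra.Etale C B] [Algebra.Etale C T] (σ : B →ₐ[C] T)
    (hσ : Function.Surjective σ) (h : ∀ b, σ b = 0 → IsNilpotent b) : Function.Injective σ := by
  have hfg : (RingHom.ker σ).FG := Algebra.FinitePresentation.ker_fG_of_surjective σ hσ
  have hnil : IsNilpotent (RingHom.ker σ) := by
    refine (Ideal.FG.isNilpotent_iff_le_nilradical hfg).2 fun b hb => h b hb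
  let τ : T →ₐ[C] B := Algebra.FormallySmooth.liftOfSurjective (AlgHom.id C T) σ hσ hnil
  have hτ : ∀ t, σ (τ t) = t := fun t =>
    Algebra.FormallySmooth.liftOfSurjective_apply (AlgHom.id C T) σ hσ hnil t
  have : τ.comp σ = AlgHom.id C B :=
    Algebra.FormallyUnramified.ext' (R := C) (A := B) (B := B) (C := T) (f := (σ : B →+* T)) hnil _ _
      fun b => hτ (σ b)
  exact Function.LeftInverse.injective (g := τ) fun b => DFunLike.congr_fun this b

variable (p : ℕ)

/-- The Frobenius twist of a ring: the same ring, regarded as an algebra over another ring by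
the composite of the structure map with the Frobenius. -/
def FrobTwist (_ : ℕ) (T : Type*) : Type _ := T

variable {p} in
instance {T : Type*} [CommRing T] : CommRing (FrobTwist p T) := inferInstanceAs (CommRing T)

instance {A T : Type*} [CommRing A] [CommRing T] [Algebra A T] :
    Algebra (FrobTwist p A) (FrobTwist p T) := inferInstanceAs (Algebra A T)

instance {A T : Type*} [CommRing A] [CommRing T] [Algebra A T] [Algebra.Etale A T] :
    Algebra.Etale (FrobTwist p A) (FrobTwist p T) := inferInstanceAs (Algebra.Etale A T)

variable [Fact p.Prime]

instance {A T : Type*} [CommRing A] [CommRing T] [Algebra A T] [CharP T p] :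
    Algebra A (FrobTwist p T) :=
  RingHom.toAlgebra (show A →+* FrobTwist p T from (frobenius T p).comp (algebraMap A T))

variable {p} {A T : Type*} [CommRing A] [CommRing T] [Algebra A T]

/-- An element of a ring, as an element of the Frobenius twist. -/
def toTwist : T ≃+* FrobTwist p T := RingEquiv.refl T

variable [CharP T p]

theorem algebraMap_frobTwist (a : A) :
    algebraMap A (FrobTwist p T) a = toTwist (algebraMap A T a ^ p) := rfl

instance : IsScalarTower A T (FrobTwist p T) := .of_algebraMap_eq fun _ => rfl

variable [CharP A p]

instance : IsScalarTower A (FrobTwist p A) (FrobTwist p T) :=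
  .of_algebraMap_eq fun x => congrArg toTwist (map_pow (algebraMap A T) x p).symm

variable (p A T) in
/-- The relative Frobenius of an `A`-algebra `T`, given by `a ⊗ t ↦ a * t ^ p`. -/
def relFrobenius : FrobTwist p A ⊗[A] T →ₐ[FrobTwist p A] FrobTwist p T :=
  Algebra.TensorProduct.lift (Algebra.ofId _ _) (IsScalarTower.toAlgHom A T (FrobTwist p T))
    fun _ _ => Commute.all _ _

theorem relFrobenius_tmul (a : A) (t : T) :
    relFrobenius p A T (toTwist a ⊗ₜ t) = toTwist (algebraMap A T a * t ^ p) := rfl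

theorem tmul_relFrobenius (b : FrobTwist p A ⊗[A] T) :
    (1 : FrobTwist p A) ⊗ₜ[A] (toTwist (p := p)).symm (relFrobenius p A T b) = b ^ p := by
  have hp : p.Prime := Fact.out
  have h0 : (p : FrobTwist p A ⊗[A] T) = 0 := by
    have : (p : T) = 0 := CharP.cast_eq_zero T p
    rw [← map_natCast (Algebra.TensorProduct.includeRight : T →ₐ[A] FrobTwist p A ⊗[A] T), this,
      map_zero]
  induction b with
  | zero => rw [map_zero, map_zero, TensorProduct.tmul_zero, zero_pow hp.ne_zero]
  | add x y hx hy =>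
    rw [map_add, map_add, TensorProduct.tmul_add, hx, hy, add_pow_prime_of_natCast_eq_zero hp h0]
  | tmul a t =>
    obtain ⟨a, rfl⟩ := (toTwist (p := p)).surjective a
    rw [relFrobenius_tmul, RingEquiv.symm_apply_apply, ← Algebra.smul_def, ← TensorProduct.smul_tmul,
      Algebra.TensorProduct.tmul_pow, Algebra.smul_def, mul_one]
    rfl

/-- The relative Frobenius of an étale algebra is an isomorphism. -/
theorem relFrobenius_bijective [Algebra.Etale A T] : Function.Bijective (relFrobenius p A T) := by
  have hp : p.Prime := Fact.out
  have hsurj : Function.Surjective (relFrobenius p A T) := by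
    let C := FrobTwist p A
    let B := FrobTwist p A ⊗[A] T
    let T' := FrobTwist p T
    algebraize [(relFrobenius p A T).toRingHom]
    have : IsScalarTower C B T' := .of_algebraMap_eq fun x => ((relFrobenius p A T).commutes x).symm
    have : Algebra.FormallyUnramified B T' := .of_restrictScalars C B T'
    have : Algebra.FiniteType B T' := .of_restrictScalars_finiteType C B T'
    refine surjective_of_formallyUnramified (B := B) (T := T') hp
      (CharP.cast_eq_zero T p) fun t => ⟨1 ⊗ₜ (toTwist (p := p)).symm t, ?_⟩
    exact (relFrobenius_tmul 1 _).trans (by rw [map_one, one_mul]; rfl)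
  refine ⟨injective_of_etale _ hsurj fun b hb => ⟨p, ?_⟩, hsurj⟩
  rw [← tmul_relFrobenius, hb, map_zero, TensorProduct.tmul_zero]

end Frobenius

/-! ### The Cartier operator in étale coordinates -/

noncomputable section EtaleCoordinates

variable {p : ℕ} {R T M : Type*} [CommRing R] [CommRing T] [AddCommGroup M]
  [Module R M] {n : ℕ} [Algebra (MvPolynomial (Fin n) R) T]

variable (R T) in
/-- The element of `T` given by a monomial in the coordinates. -/
def coordMonomial (c : Fin n →₀ ℕ) : T :=
  algebraMap (MvPolynomial (Fin n) R) T (MvPolynomial.monomial c 1)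

theorem coordMonomial_add (c d : Fin n →₀ ℕ) :
    coordMonomial R T (c + d) = coordMonomial R T c * coordMonomial R T d := by
  rw [coordMonomial, coordMonomial, coordMonomial, ← map_mul, MvPolynomial.monomial_mul, one_mul]

/-- The exponent `(c + 1) / p - 1`, computed in each coordinate. -/
def rootExponent (p : ℕ) (c : Fin n →₀ ℕ) : Fin n →₀ ℕ :=
  c.mapRange (fun a => (a + 1) / p - 1) (Nat.sub_eq_zero_of_le (Nat.div_le_self 1 p))

theorem rootExponent_add (hp : 0 < p) (c d : Fin n →₀ ℕ) (hd : ∀ i, p ∣ d i + 1) :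
    rootExponent p (p • c + d) = c + rootExponent p d := by
  ext i
  obtain ⟨k, hk⟩ := hd i
  have hk1 : 1 ≤ k := Nat.pos_of_ne_zero fun h => by simp [h] at hk
  have h1 : ((p • c + d) i + 1) = p * (c i + k) := by
    rw [Finsupp.add_apply, Finsupp.smul_apply, smul_eq_mul, add_assoc, hk, mul_add]
  have h2 : ((p • c + d) i + 1) / p = c i + k := by rw [h1, Nat.mul_div_cancel_left _ hp]
  have h3 : (d i + 1) / p = k := by rw [hk, Nat.mul_div_cancel_left _ hp]
  change ((p • c + d) i + 1) / p - 1 = c i + ((d i + 1) / p - 1)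
  omega

variable [Algebra R T]

variable (T) in
open Classical in
/-- The value of the Cartier operator at `x ^ c ⊗ m`. -/
def cartierMonomial (κ : CartierStructure p R M) (c : Fin n →₀ ℕ) : M →+ T ⊗[R] M :=
  if ∀ i, p ∣ c i + 1 then
    (TensorProduct.mk R T M (coordMonomial R T (rootExponent p c))).toAddMonoidHom.comp
      (κ : M →+ M)
  else 0

theorem cartierMonomial_of_dvd (κ : CartierStructure p R M) {c : Fin n →₀ ℕ}
    (hc : ∀ i, p ∣ c i + 1) (m : M) :
    cartierMonomial T κ c m = coordMonomial R T (rootExponent p c) ⊗ₜ κ m := by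
  rw [cartierMonomial, if_pos hc]; rfl

theorem cartierMonomial_of_not_dvd (κ : CartierStructure p R M) {c : Fin n →₀ ℕ}
    (hc : ¬ ∀ i, p ∣ c i + 1) (m : M) : cartierMonomial T κ c m = 0 := by
  rw [cartierMonomial, if_neg hc]; rfl

variable (T n) in
/-- The values of the Cartier operator at `a ⊗ m` for polynomials `a` in the coordinates. -/
def cartierPolynomial (κ : CartierStructure p R M) :
    M →+ MvPolynomial (Fin n) R →+ T ⊗[R] M :=
  AddMonoidHom.mk' (fun m =>
    (Finsupp.liftAddHom fun c => (cartierMonomial T κ c).comp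
      (LinearMap.toSpanSingleton R M m).toAddMonoidHom).comp
      AddMonoidAlgebra.coeffAddEquiv.toAddMonoidHom) fun m m' => by
    ext c r
    simp [smul_add]

theorem cartierPolynomial_monomial (κ : CartierStructure p R M) (m : M) (c : Fin n →₀ ℕ) (r : R) :
    cartierPolynomial T n κ m (MvPolynomial.monomial c r) = cartierMonomial T κ c (r • m) := by
  change (Finsupp.liftAddHom _) (Finsupp.single c r) = _
  rw [Finsupp.liftAddHom_apply_single]
  rfl

variable [IsScalarTower R (MvPolynomial (Fin n) R) T] [Fact p.Prime] [CharP R p]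

theorem cartierPolynomial_pow_mul (κ : CartierStructure p R M) (m : M)
    (a b : MvPolynomial (Fin n) R) :
    cartierPolynomial T n κ m (a ^ p * b) = a • cartierPolynomial T n κ m b := by
  have hp : p.Prime := Fact.out
  induction a using MvPolynomial.induction_on' with
  | add a a' ha ha' => rw [add_pow_char, add_mul, map_add, ha, ha', add_smul]
  | monomial c r =>
    induction b using MvPolynomial.induction_on' with
    | add b b' hb hb' => rw [mul_add, map_add, hb, hb', map_add, smul_add]
    | monomial d s =>
      have hr : MvPolynomial.monomial c r =
          r • (MvPolynomial.monomial c 1 : MvPolynomial (Fin n) R) := by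
        rw [MvPolynomial.smul_monomial, smul_eq_mul, mul_one]
      rw [MvPolynomial.monomial_pow, MvPolynomial.monomial_mul, cartierPolynomial_monomial,
        cartierPolynomial_monomial, hr, smul_assoc]
      have hdvd : (∀ i, p ∣ (p • c + d) i + 1) ↔ ∀ i, p ∣ d i + 1 := forall_congr' fun i => by
        rw [Finsupp.add_apply, Finsupp.smul_apply, smul_eq_mul, add_assoc,
          Nat.dvd_add_right (dvd_mul_right p _)]
      by_cases hd : ∀ i, p ∣ d i + 1
      · rw [cartierMonomial_of_dvd κ (hdvd.2 hd), cartierMonomial_of_dvd κ hd,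
          rootExponent_add hp.pos c d hd, coordMonomial_add, mul_smul, κ.map_pow_smul,
          ← algebraMap_smul T (MvPolynomial.monomial c 1 : MvPolynomial (Fin n) R),
          TensorProduct.smul_tmul', smul_eq_mul, TensorProduct.tmul_smul]
        rfl
      · rw [cartierMonomial_of_not_dvd κ (mt hdvd.1 hd), cartierMonomial_of_not_dvd κ hd, smul_zero,
          smul_zero]

variable (T n) in
/-- The map `a ⊗ t ↦ t • κ (a ⊗ m)` on `F_* A ⊗ T`, where `A` is the polynomial ring. -/
def cartierTensor (κ : CartierStructure p R M) (m : M) :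
    FrobTwist p (MvPolynomial (Fin n) R) ⊗[MvPolynomial (Fin n) R] T
      →ₗ[MvPolynomial (Fin n) R] T ⊗[R] M :=
  TensorProduct.lift <| LinearMap.mk₂ _
    (fun a t => t • cartierPolynomial T n κ m ((toTwist (p := p)).symm a))
    (fun a a' t => by rw [map_add, map_add, smul_add])
    (fun c a t => by
      rw [Algebra.smul_def, map_mul, algebraMap_frobTwist, RingEquiv.symm_apply_apply,
        Algebra.algebraMap_self, RingHom.id_apply, cartierPolynomial_pow_mul, smul_comm])
    (fun a t t' => by rw [add_smul])
    (fun c a t => by rw [smul_assoc])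

theorem cartierTensor_tmul (κ : CartierStructure p R M) (m : M) (a : MvPolynomial (Fin n) R)
    (t : T) : cartierTensor T n κ m (toTwist a ⊗ₜ t) = t • cartierPolynomial T n κ m a := rfl

variable [CharP T p] [Algebra.Etale (MvPolynomial (Fin n) R) T]

variable (n) in
/-- The module `T ⊗ M` over an algebra `T` with étale coordinates has a Cartier structure that takes
`x ^ c ⊗ m` to `x ^ ((c + 1) / p - 1) ⊗ κ m` if `p` divides all `c i + 1`, and to `0` otherwise. As
the relative Frobenius of `T` over the polynomial ring is an isomorphism, it is extended from the
polynomial ring. -/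
theorem exists_cartierStructure_coord (κ : CartierStructure p R M) :
    ∃ κT : CartierStructure p T (T ⊗[R] M), ∀ (c : Fin n →₀ ℕ) (m : M),
      κT (coordMonomial R T c ⊗ₜ m) = cartierMonomial T κ c m := by
  let A := MvPolynomial (Fin n) R
  let σ := RingEquiv.ofBijective (relFrobenius p A T) relFrobenius_bijective
  have hσ : ∀ b, σ b = relFrobenius p A T b := fun b => rfl
  have hadd : ∀ m m', cartierTensor T n κ (m + m') =
      cartierTensor T n κ m + cartierTensor T n κ m' := by
    intro m m'
    refine TensorProduct.ext' fun a t => ?_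
    obtain ⟨a, rfl⟩ := (toTwist (p := p)).surjective a
    simp only [LinearMap.add_apply, cartierTensor_tmul, map_add, AddMonoidHom.add_apply, smul_add]
  have hsmul : ∀ (r : R) m (b : FrobTwist p A ⊗[A] T), cartierTensor T n κ (r • m) b =
      cartierTensor T n κ m ((toTwist (p := p) (algebraMap R A r) ⊗ₜ[A] (1 : T)) * b) := by
    intro r m b
    induction b with
    | zero => rw [mul_zero, map_zero, map_zero]
    | add x y hx hy => rw [mul_add, map_add, map_add, hx, hy]
    | tmul a t =>
      obtain ⟨a, rfl⟩ := (toTwist (p := p)).surjective a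
      rw [Algebra.TensorProduct.tmul_mul_tmul, one_mul, ← map_mul, cartierTensor_tmul,
        cartierTensor_tmul]
      congr 1
      induction a using MvPolynomial.induction_on' with
      | add a b ha hb => rw [map_add, ha, hb, mul_add, map_add]
      | monomial c s =>
        rw [MvPolynomial.algebraMap_eq, MvPolynomial.C_mul_monomial, cartierPolynomial_monomial,
          cartierPolynomial_monomial, smul_smul, mul_comm]
  have hmul : ∀ (t : T) m (b : FrobTwist p A ⊗[A] T),
      cartierTensor T n κ m ((1 ⊗ₜ t) * b) = t • cartierTensor T n κ m b := by
    intro t m b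
    induction b with
    | zero => rw [mul_zero, map_zero, smul_zero]
    | add x y hx hy => rw [mul_add, map_add, map_add, hx, hy, smul_add]
    | tmul a t' =>
      obtain ⟨a, rfl⟩ := (toTwist (p := p)).surjective a
      rw [Algebra.TensorProduct.tmul_mul_tmul, one_mul, cartierTensor_tmul, cartierTensor_tmul,
        mul_smul]
  -- `f t m` is the value at `t ⊗ m`, read off from the preimage of `t` under the relative Frobenius.
  let f : T →+ M →+ T ⊗[R] M :=
    AddMonoidHom.mk' (fun t => AddMonoidHom.mk'
      (fun m => cartierTensor T n κ m (σ.symm (toTwist t))) fun m m' => by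
        rw [hadd, LinearMap.add_apply]) fun t t' => by
        ext m
        simp only [map_add, AddMonoidHom.mk'_apply, AddMonoidHom.add_apply]
  have hf : ∀ t m, f t m = cartierTensor T n κ m (σ.symm (toTwist t)) := fun t m => rfl
  have hbal : ∀ (r : R) t m, f (r • t) m = f t (r • m) := by
    intro r t m
    rw [hf, hf, hsmul]
    congr 1
    rw [RingEquiv.symm_apply_eq, map_mul, RingEquiv.apply_symm_apply, hσ, relFrobenius_tmul, one_pow,
      mul_one, ← IsScalarTower.algebraMap_apply, ← map_mul, Algebra.smul_def]
  refine ⟨{ TensorProduct.liftAddHom f hbal with map_pow_smul' := fun t z => ?_ }, fun c m => ?_⟩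
  · change TensorProduct.liftAddHom f hbal _ = t • TensorProduct.liftAddHom f hbal z
    induction z with
    | zero => rw [smul_zero, map_zero, smul_zero]
    | add x y hx hy => rw [smul_add, map_add, map_add, hx, hy, smul_add]
    | tmul t' m =>
      rw [TensorProduct.smul_tmul', TensorProduct.liftAddHom_tmul, TensorProduct.liftAddHom_tmul, hf,
        hf, ← hmul]
      congr 1
      rw [RingEquiv.symm_apply_eq, map_mul, RingEquiv.apply_symm_apply, hσ]
      refine Eq.trans ?_ (congrArg (· * _) (relFrobenius_tmul 1 t).symm)
      rw [map_one, one_mul, ← map_mul, smul_eq_mul]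
  · change TensorProduct.liftAddHom f hbal _ = _
    rw [TensorProduct.liftAddHom_tmul, hf]
    have : σ.symm (toTwist (coordMonomial R T c)) = toTwist (MvPolynomial.monomial c 1) ⊗ₜ 1 := by
      rw [RingEquiv.symm_apply_eq, hσ, relFrobenius_tmul, one_pow, mul_one]
      rfl
    rw [this, cartierTensor_tmul, one_smul, cartierPolynomial_monomial, one_smul]

end EtaleCoordinates

/-! ### Jacobians with respect to étale coordinates -/

noncomputable section TopForms

variable {p : ℕ} {R T M : Type*} [CommRing R] [CommRing T] [AddCommGroup M]
  [Module R M] {n : ℕ} [Algebra (MvPolynomial (Fin n) R) T]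

theorem coordMonomial_sum {ι : Type*} (s : Finset ι) (c : ι → Fin n →₀ ℕ) :
    coordMonomial R T (∑ i ∈ s, c i) = ∏ i ∈ s, coordMonomial R T (c i) := by
  classical
  induction s using Finset.induction_on with
  | empty =>
    rw [Finset.sum_empty, Finset.prod_empty, coordMonomial, MvPolynomial.monomial_zero', map_one,
      map_one]
  | insert i s hi ih => rw [Finset.sum_insert hi, Finset.prod_insert hi, coordMonomial_add, ih]

variable [Algebra R T] [IsScalarTower R (MvPolynomial (Fin n) R) T]

variable (R T n) in
/-- The differentials of the coordinates are a basis of the differentials of an algebra with étale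
coordinates. -/
def coordBasis [Algebra.Etale (MvPolynomial (Fin n) R) T] : Module.Basis (Fin n) T (Ω[T⁄R]) :=
  ((KaehlerDifferential.mvPolynomialBasis R (Fin n)).baseChange T).map
    (KaehlerDifferential.tensorKaehlerEquivOfFormallyEtale R (MvPolynomial (Fin n) R) T)

theorem coordBasis_repr [Algebra.Etale (MvPolynomial (Fin n) R) T] (a : MvPolynomial (Fin n) R)
    (j : Fin n) : (coordBasis R T n).repr
      (KaehlerDifferential.D R T (algebraMap (MvPolynomial (Fin n) R) T a)) j =
      algebraMap (MvPolynomial (Fin n) R) T (MvPolynomial.pderiv j a) := by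
  rw [coordBasis, Module.Basis.map_repr, LinearEquiv.trans_apply,
    KaehlerDifferential.tensorKaehlerEquivOfFormallyEtale_symm_D_algebraMap,
    Module.Basis.baseChange_repr_tmul, KaehlerDifferential.mvPolynomialBasis_repr_apply,
    Algebra.smul_def, mul_one]

theorem coordBasis_apply [Algebra.Etale (MvPolynomial (Fin n) R) T] (j : Fin n) :
    coordBasis R T n j = KaehlerDifferential.D R T
      (algebraMap (MvPolynomial (Fin n) R) T (MvPolynomial.X j)) := by
  rw [coordBasis, Module.Basis.map_apply, Module.Basis.baseChange_apply,
    KaehlerDifferential.mvPolynomialBasis_apply,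
    KaehlerDifferential.tensorKaehlerEquivOfFormallyEtale_apply,
    KaehlerDifferential.mapBaseChange_tmul, one_smul, KaehlerDifferential.map_D]

variable (R) in
/-- The Jacobian of `n` elements with respect to the coordinates. -/
def jac [Algebra.Etale (MvPolynomial (Fin n) R) T] (y : Fin n → T) : T :=
  (coordBasis R T n).det fun i => KaehlerDifferential.D R T (y i)

variable [Algebra.Etale (MvPolynomial (Fin n) R) T]

theorem jac_update_add (y : Fin n → T) (i : Fin n) (a b : T) :
    jac R (Function.update y i (a + b)) =
      jac R (Function.update y i a) + jac R (Function.update y i b) := by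
  simp only [jac, Function.apply_update (fun _ => KaehlerDifferential.D R T), map_add,
    AlternatingMap.map_update_add]

theorem jac_update_zero (y : Fin n → T) (i : Fin n) : jac R (Function.update y i 0) = 0 := by
  simp only [jac, Function.apply_update (fun _ => KaehlerDifferential.D R T), map_zero,
    AlternatingMap.map_update_zero]

theorem jac_update_algebraMap (y : Fin n → T) (i : Fin n) (r : R) :
    jac R (Function.update y i (algebraMap R T r)) = 0 := by
  simp only [jac, Function.apply_update (fun _ => KaehlerDifferential.D R T), Derivation.map_algebraMap,
    AlternatingMap.map_update_zero]

theorem jac_update_mul (y : Fin n → T) (i : Fin n) (a b : T) :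
    jac R (Function.update y i (a * b)) =
      a * jac R (Function.update y i b) + b * jac R (Function.update y i a) := by
  simp only [jac, Function.apply_update (fun _ => KaehlerDifferential.D R T), Derivation.leibniz,
    AlternatingMap.map_update_add, AlternatingMap.map_update_smul, smul_eq_mul]

/-- The Jacobian of monomials `x ^ c i` is `det (c i j) * x ^ (∑ c i - 1)`. The exponent is computed
with truncated subtraction, which is harmless because the determinant vanishes if it matters. -/
theorem jac_coordMonomial (c : Fin n → Fin n →₀ ℕ) :
    jac R (fun i => coordMonomial R T (c i)) = (Matrix.of fun j i => (c i j : T)).det *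
      coordMonomial R T (∑ i, c i - ∑ i, Finsupp.single i 1) := by
  rw [jac, Module.Basis.det_apply, Matrix.det_apply, Matrix.det_apply, Finset.sum_mul]
  refine Finset.sum_congr rfl fun τ _ => ?_
  rw [smul_mul_assoc]
  congr 1
  have hrepr : ∀ i j, (coordBasis R T n).toMatrix
      (fun i => KaehlerDifferential.D R T (coordMonomial R T (c i))) j i =
      (c i j : T) * coordMonomial R T (c i - Finsupp.single j 1) := by
    intro i j
    rw [Module.Basis.toMatrix_apply, coordMonomial, coordBasis_repr, MvPolynomial.pderiv_monomial,
      one_mul, ← mul_one ((c i j : ℕ) : R), ← smul_eq_mul, ← MvPolynomial.smul_monomial,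
      Algebra.smul_def, map_mul, ← IsScalarTower.algebraMap_apply, map_natCast]
    rfl
  simp only [hrepr, Matrix.of_apply, Finset.prod_mul_distrib]
  -- If the truncation matters in a term of the determinant, then the coefficient is zero.
  by_cases h : ∃ i, c i (τ i) = 0
  · obtain ⟨i, hi⟩ := h
    rw [Finset.prod_eq_zero (Finset.mem_univ i) (by rw [hi, Nat.cast_zero]), zero_mul, zero_mul]
  · rw [← coordMonomial_sum]
    congr 2
    have h1 : ∀ i, c i = (c i - Finsupp.single (τ i) 1) + Finsupp.single (τ i) 1 := fun i =>
      (tsub_add_cancel_of_le (Finsupp.single_le_iff.2 (Nat.one_le_iff_ne_zero.2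
        fun h' => h ⟨i, h'⟩))).symm
    have h2 : ∑ i, c i = ∑ i, (c i - Finsupp.single (τ i) 1) + ∑ i, Finsupp.single i 1 := by
      rw [← Equiv.sum_comp τ fun i => Finsupp.single i 1, ← Finset.sum_add_distrib]
      exact Finset.sum_congr rfl fun i _ => h1 i
    rw [h2, add_tsub_cancel_right]

/-- To prove a property of all families `y` one may pass from a set `G` to its closure, one member of
the family at a time. -/
theorem forall_of_forall_update {ι α : Type*} [Finite ι] [DecidableEq ι] {G : Set α}
    {P : (ι → α) → Prop}
    (hstep : ∀ y i, (∀ a ∈ G, P (Function.update y i a)) → P y)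
    (hG : ∀ y, (∀ i, y i ∈ G) → P y) (y : ι → α) : P y := by
  classical
  cases nonempty_fintype ι
  suffices ∀ (s : Finset ι) (y : ι → α), (∀ i ∉ s, y i ∈ G) → P y from
    this Finset.univ y fun i hi => absurd (Finset.mem_univ i) hi
  intro s
  induction s using Finset.induction_on with
  | empty => exact fun y hy => hG y fun i => hy i (Finset.notMem_empty i)
  | insert i s hi ih =>
    refine fun y hy => hstep y i fun a ha => ih _ fun j hj => ?_
    by_cases hji : j = i
    · rw [hji, Function.update_self]; exact ha
    · rw [Function.update_of_ne hji]
      exact hy j fun h => (Finset.mem_insert.1 h).elim hji hj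

/-- The surjectivity of the relative Frobenius: `T` is generated by the monomials in the coordinates
over `R` and the `p`-th powers. -/
theorem mem_closure_coordMonomial [Fact p.Prime] [CharP R p] [CharP T p] (t : T) :
    t ∈ AddSubmonoid.closure {y : T | ∃ (r : R) (s : T) (c : Fin n →₀ ℕ),
      y = algebraMap R T r * s ^ p * coordMonomial R T c} := by
  obtain ⟨b, hb⟩ := (relFrobenius_bijective (p := p) (A := MvPolynomial (Fin n) R) (T := T)).2
    (toTwist t)
  suffices ∀ b : FrobTwist p (MvPolynomial (Fin n) R) ⊗[MvPolynomial (Fin n) R] T,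
      (toTwist (p := p)).symm (relFrobenius p (MvPolynomial (Fin n) R) T b) ∈
      AddSubmonoid.closure {y : T | ∃ (r : R) (s : T) (c : Fin n →₀ ℕ),
      y = algebraMap R T r * s ^ p * coordMonomial R T c} by
    have h := this b
    rwa [hb, RingEquiv.symm_apply_apply] at h
  intro b
  induction b with
  | zero => rw [map_zero, map_zero]; exact zero_mem _
  | add x y hx hy => rw [map_add, map_add]; exact add_mem hx hy
  | tmul a s =>
    obtain ⟨a, rfl⟩ := (toTwist (p := p)).surjective a
    rw [relFrobenius_tmul, RingEquiv.symm_apply_apply]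
    induction a using MvPolynomial.induction_on' with
    | add a a' ha ha' => rw [map_add, add_mul]; exact add_mem ha ha'
    | monomial c r =>
      refine AddSubmonoid.subset_closure ⟨r, s, c, ?_⟩
      rw [coordMonomial, IsScalarTower.algebraMap_apply R (MvPolynomial (Fin n) R) T, mul_right_comm,
        ← map_mul, MvPolynomial.algebraMap_eq, MvPolynomial.C_mul_monomial, mul_one]

theorem det_eq_zero_of_sum_eq_zero {A : Type*} [CommRing A] (hn : n ≠ 0)
    (N : Matrix (Fin n) (Fin n) A) (h : ∀ j, ∑ i, N j i = 0) : N.det = 0 := by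
  have h1 : N.mulVec 1 = 0 := by
    ext j
    simpa [Matrix.mulVec, dotProduct] using h j
  have h2 : (N.adjugate * N).mulVec 1 = 0 := by
    rw [← Matrix.mulVec_mulVec, h1, Matrix.mulVec_zero]
  rw [Matrix.adjugate_mul, Matrix.smul_mulVec, Matrix.one_mulVec] at h2
  simpa using congrFun h2 ⟨0, Nat.pos_of_ne_zero hn⟩

theorem D_pow_prime_mul {N : Type*} [AddCommGroup N] [Module T N] [Module R N] [IsScalarTower R T N]
    [CharP T p] (d : Derivation R T N) (s a : T) : d (s ^ p * a) = s ^ p • d a := by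
  have : (p : T) = 0 := CharP.cast_eq_zero T p
  rw [d.leibniz, d.leibniz_pow, ← Nat.cast_smul_eq_nsmul T, this, zero_smul, smul_zero, add_zero]

/-- In characteristic `p` the form `(a + b) ^ (p - 1) d(a + b)` differs from the sum of
`a ^ (p - 1) da` and `b ^ (p - 1) db` by the differential of `((a + b) ^ p - a ^ p - b ^ p) / p`. -/
theorem exists_pow_smul_D_add (hp : p.Prime) (a b : T) :
    ∃ g : T, (a + b) ^ (p - 1) • KaehlerDifferential.D R T (a + b) =
      a ^ (p - 1) • KaehlerDifferential.D R T a + b ^ (p - 1) • KaehlerDifferential.D R T b +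
        KaehlerDifferential.D R T g := by
  let φ : MvPolynomial (Fin 2) ℤ →ₐ[ℤ] T := MvPolynomial.aeval ![a, b]
  obtain ⟨r, hr⟩ := exists_add_pow_prime_eq hp (MvPolynomial.X 0 : MvPolynomial (Fin 2) ℤ)
    (MvPolynomial.X 1)
  let G : MvPolynomial (Fin 2) ℤ := MvPolynomial.X 0 * MvPolynomial.X 1 * r
  have hG : (p : MvPolynomial (Fin 2) ℤ) * G =
      (MvPolynomial.X 0 + MvPolynomial.X 1) ^ p - MvPolynomial.X 0 ^ p - MvPolynomial.X 1 ^ p := by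
    rw [hr]; ring
  have hchain : ∀ f : MvPolynomial (Fin 2) ℤ, KaehlerDifferential.D R T (φ f) =
      φ (MvPolynomial.pderiv 0 f) • KaehlerDifferential.D R T a +
        φ (MvPolynomial.pderiv 1 f) • KaehlerDifferential.D R T b := by
    intro f
    induction f using MvPolynomial.induction_on with
    | C z => simp [φ]
    | add f g hf hg => simp only [map_add, hf, hg, add_smul]; abel
    | mul_X f i hf =>
      fin_cases i <;>
        simp [φ, hf, Derivation.leibniz, MvPolynomial.pderiv_X, add_smul] <;>
        module
  have hp0 : (p : MvPolynomial (Fin 2) ℤ) ≠ 0 := Nat.cast_ne_zero.2 hp.ne_zero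
  have key : ∀ i : Fin 2, MvPolynomial.pderiv i G =
      (MvPolynomial.X 0 + MvPolynomial.X 1) ^ (p - 1) - MvPolynomial.X i ^ (p - 1) := by
    intro i
    refine mul_left_cancel₀ hp0 ?_
    have := congrArg (MvPolynomial.pderiv i) hG
    fin_cases i <;>
      simpa [Derivation.leibniz, Derivation.leibniz_pow, MvPolynomial.pderiv_X, mul_sub] using this
  refine ⟨φ G, ?_⟩
  rw [hchain, key, key]
  simp only [φ, map_sub, map_pow, map_add, MvPolynomial.aeval_X, Matrix.cons_val_zero,
    Matrix.cons_val_one]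
  module

end TopForms

/-! ### The two rules for the Cartier operator in étale coordinates -/

section CartierRules

variable {p : ℕ} {R T M : Type*} [CommRing R] [CommRing T] [AddCommGroup M]
  [Module R M] {n : ℕ} [Algebra (MvPolynomial (Fin n) R) T] [Algebra R T]
  [IsScalarTower R (MvPolynomial (Fin n) R) T] [Algebra.Etale (MvPolynomial (Fin n) R) T]

theorem jac_update (y : Fin n → T) (i : Fin n) (a : T) :
    jac R (Function.update y i a) = (coordBasis R T n).det.toMultilinearMap.toLinearMap
      (fun i => KaehlerDifferential.D R T (y i)) i (KaehlerDifferential.D R T a) := by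
  simp only [jac, Function.apply_update (fun _ => KaehlerDifferential.D R T)]
  rfl

/-- The Jacobian vanishes if one of the elements is a monomial in the others. -/
theorem jac_update_prod_pow (y : Fin n → T) (i : Fin n) (k : ℕ) :
    jac R (Function.update y i ((∏ j ∈ Finset.univ \ {i}, y j) ^ k)) = 0 := by
  let V : Submonoid T :=
    { carrier := {v | jac R (Function.update y i v) = 0}
      one_mem' := by
        have := jac_update_algebraMap (R := R) y i 1
        rwa [map_one] at this
      mul_mem' := fun {a b} (ha : _ = 0) (hb : _ = 0) => by
        change _ = 0
        rw [jac_update_mul, ha, hb, mul_zero, mul_zero, add_zero] }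
  refine V.pow_mem (V.prod_mem fun j hj => ?_) k
  have hji : i ≠ j := by simpa [eq_comm] using hj
  change _ = _
  simp only [jac, Function.apply_update (fun _ => KaehlerDifferential.D R T)]
  exact AlternatingMap.map_update_self (coordBasis R T n).det _ hji

variable {κ : CartierStructure p R M} {κT : CartierStructure p T (T ⊗[R] M)}

theorem CartierStructure.map_pow_mul_tmul (κT : CartierStructure p T (T ⊗[R] M)) (s a : T) (m : M) :
    κT ((s ^ p * a) ⊗ₜ m) = s • κT (a ⊗ₜ m) := by
  rw [← κT.map_pow_smul, TensorProduct.smul_tmul', smul_eq_mul]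

variable [Fact p.Prime] [CharP R p] [CharP T p]

/-- The Cartier operator kills exact forms. -/
theorem cartier_jac_tmul (hκ : ∀ (c : Fin n →₀ ℕ) (m : M),
      κT (coordMonomial R T c ⊗ₜ m) = cartierMonomial T κ c m) (hn : n ≠ 0) (y : Fin n → T) :
    ∀ m, κT (jac R y ⊗ₜ m) = 0 := by
  have hp : p.Prime := Fact.out
  refine forall_of_forall_update (P := fun y => ∀ m, κT (jac R y ⊗ₜ m) = 0)
    (G := {y : T | ∃ (r : R) (s : T) (c : Fin n →₀ ℕ),
      y = algebraMap R T r * s ^ p * coordMonomial R T c}) (fun y i h => ?_) (fun y hy m => ?_) y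
  · rw [← Function.update_eq_self i y]
    have hmem := mem_closure_coordMonomial (p := p) (R := R) (n := n) (y i)
    generalize y i = a at hmem ⊢
    induction hmem using AddSubmonoid.closure_induction with
    | mem a ha => exact h a ha
    | zero => intro m; rw [jac_update_zero, TensorProduct.zero_tmul, map_zero]
    | add a b _ _ ha hb =>
      intro m
      rw [jac_update_add, TensorProduct.add_tmul, map_add, ha, hb, add_zero]
  -- Reduced to monomials: the exponents of the Jacobian are the `∑ i, c i j - 1`. If `p` divides all
  -- the sums `∑ i, c i j`, then the determinant of the `c i j` is zero modulo `p`.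
  choose r s c hc using hy
  have hy : jac R y = (∏ i, s i) ^ p * (algebraMap R T (∏ i, r i) *
      jac R fun i => coordMonomial R T (c i)) := by
    have : ∀ i, KaehlerDifferential.D R T (y i) = (s i ^ p * algebraMap R T (r i)) •
        KaehlerDifferential.D R T (coordMonomial R T (c i)) := fun i => by
      rw [hc, mul_comm (algebraMap R T (r i)), mul_assoc, D_pow_prime_mul, ← Algebra.smul_def,
        Derivation.map_smul, mul_smul, algebraMap_smul]
    rw [jac, funext this, AlternatingMap.map_smul_univ, Finset.prod_mul_distrib, Finset.prod_pow,
      map_prod, smul_eq_mul, mul_assoc]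
    rfl
  rw [hy, κT.map_pow_mul_tmul, ← Algebra.smul_def, TensorProduct.smul_tmul, jac_coordMonomial]
  set m' := (∏ i, r i) • m
  set N : Matrix (Fin n) (Fin n) ℤ := Matrix.of fun j i => (c i j : ℤ)
  have hN : (Matrix.of fun j i => (c i j : T)) = N.map (Int.castRingHom T) := by
    ext; simp [N]
  have hdet : (Matrix.of fun j i => (c i j : T)).det = (N.det : ℤ) := by
    rw [hN, ← RingHom.mapMatrix_apply, ← RingHom.map_det]; rfl
  by_cases h0 : ∃ j, ∑ i, c i j = 0
  · obtain ⟨j, hj⟩ := h0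
    rw [Matrix.det_eq_zero_of_row_eq_zero j fun i => ?_, zero_mul, TensorProduct.zero_tmul, map_zero,
      smul_zero]
    rw [Matrix.of_apply, Finset.sum_eq_zero_iff.1 hj i (Finset.mem_univ i), Nat.cast_zero]
  have hexp : ∀ j, (∑ i, c i - ∑ i, Finsupp.single i 1 : Fin n →₀ ℕ) j + 1 = ∑ i, c i j := by
    intro j
    have h1 : (∑ i, Finsupp.single i 1 : Fin n →₀ ℕ) j = 1 := by
      simp [Finsupp.finsetSum_apply, Finsupp.single_apply]
    rw [Finsupp.tsub_apply, h1, Finsupp.finsetSum_apply]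
    have : ∑ i, c i j ≠ 0 := fun h => h0 ⟨j, h⟩
    omega
  by_cases hdvd : ∀ j, p ∣ ∑ i, c i j
  · rw [det_eq_zero_of_sum_eq_zero hn _ fun j => ?_, zero_mul, TensorProduct.zero_tmul, map_zero,
      smul_zero]
    simp only [Matrix.of_apply]
    rw [← Nat.cast_sum]
    exact (CharP.cast_eq_zero_iff T p _).2 (hdvd j)
  · have h := hκ (∑ i, c i - ∑ i, Finsupp.single i 1) m'
    rw [cartierMonomial_of_not_dvd κ fun h => hdvd fun j => hexp j ▸ h j] at h
    rw [hdet, ← zsmul_eq_mul, ← TensorProduct.smul_tmul', map_zsmul, h, smul_zero, smul_zero]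

/-- The Cartier operator takes `(y₁ ⋯ yₙ) ^ (p - 1) dy₁ ∧ ⋯ ∧ dyₙ` to `dy₁ ∧ ⋯ ∧ dyₙ`. Both sides
are derivations in each `yᵢ`, the left one because exact forms are killed, so that it is enough to
take the `yᵢ` among the coordinates. -/
theorem cartier_prod_pow_mul_jac_tmul (hκ : ∀ (c : Fin n →₀ ℕ) (m : M),
      κT (coordMonomial R T c ⊗ₜ m) = cartierMonomial T κ c m) (m : M) (y : Fin n → T) :
    κT (((∏ i, y i) ^ (p - 1) * jac R y) ⊗ₜ m) = jac R y ⊗ₜ κ m := by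
  have hp : p.Prime := Fact.out
  refine forall_of_forall_update
    (P := fun y => κT (((∏ i, y i) ^ (p - 1) * jac R y) ⊗ₜ m) = jac R y ⊗ₜ κ m)
    (G := Set.range fun j => algebraMap (MvPolynomial (Fin n) R) T (MvPolynomial.X j))
    (fun y i h => ?_) (fun y hy => ?_) y
  · have hn : n ≠ 0 := fun h => by subst h; exact i.elim0
    set w := ∏ j ∈ Finset.univ \ {i}, y j
    have hprod : ∀ a, ∏ j, Function.update y i a j = a * w := fun a =>
      Finset.prod_update_of_mem (Finset.mem_univ i) y a
    simp only [hprod] at h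
    rw [← Function.update_eq_self i y, hprod]
    let P : T → Prop := fun a => κT (((a * w) ^ (p - 1) * jac R (Function.update y i a)) ⊗ₜ m) =
      jac R (Function.update y i a) ⊗ₜ κ m
    -- The form `((a + b) w) ^ (p - 1) d(a + b)` is additive in `a` and `b` up to an exact form.
    have hPadd : ∀ a b, P a → P b → P (a + b) := by
      intro a b ha hb
      obtain ⟨g, hg⟩ := exists_pow_smul_D_add (R := R) hp a b
      have h1 : ((a + b) * w) ^ (p - 1) * jac R (Function.update y i (a + b)) =
          (a * w) ^ (p - 1) * jac R (Function.update y i a) +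
          (b * w) ^ (p - 1) * jac R (Function.update y i b) +
          jac R (Function.update y i (g * w ^ (p - 1))) := by
        have h2 := congrArg ((coordBasis R T n).det.toMultilinearMap.toLinearMap
          (fun i => KaehlerDifferential.D R T (y i)) i) hg
        rw [map_smul, LinearMap.map_add _ (_ + _), LinearMap.map_add _ (_ • _), map_smul, map_smul,
          ← jac_update, ← jac_update, ← jac_update, ← jac_update,
          smul_eq_mul, smul_eq_mul, smul_eq_mul] at h2
        rw [jac_update_mul, jac_update_prod_pow, mul_pow, mul_pow, mul_pow]
        linear_combination w ^ (p - 1) * h2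
      change κT _ = _
      rw [h1, TensorProduct.add_tmul, TensorProduct.add_tmul, map_add, map_add,
        cartier_jac_tmul hκ hn, add_zero, ha, hb, jac_update_add, TensorProduct.add_tmul]
    have hPmul : ∀ a b, P a → P b → P (a * b) := by
      intro a b ha hb
      have h1 : ((a * b) * w) ^ (p - 1) * jac R (Function.update y i (a * b)) =
          a ^ p * ((b * w) ^ (p - 1) * jac R (Function.update y i b)) +
          b ^ p * ((a * w) ^ (p - 1) * jac R (Function.update y i a)) := by
        rw [jac_update_mul, ← mul_pow_sub_one hp.ne_zero a, ← mul_pow_sub_one hp.ne_zero b]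
        ring
      change κT _ = _
      rw [h1, TensorProduct.add_tmul, map_add, κT.map_pow_mul_tmul, κT.map_pow_mul_tmul, ha, hb,
        jac_update_mul, TensorProduct.add_tmul, TensorProduct.smul_tmul', TensorProduct.smul_tmul',
        smul_eq_mul, smul_eq_mul]
    have hPzero : ∀ a, KaehlerDifferential.D R T a = 0 → P a := by
      intro a ha
      change κT _ = _
      rw [jac_update, ha, map_zero, mul_zero, TensorProduct.zero_tmul, TensorProduct.zero_tmul,
        map_zero]
    have hPX : ∀ j, P (algebraMap (MvPolynomial (Fin n) R) T (MvPolynomial.X j)) := fun j =>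
      h _ ⟨j, rfl⟩
    have hPR : ∀ r, P (algebraMap R T r) := fun r => hPzero _ (Derivation.map_algebraMap _ _)
    have hPA : ∀ f : MvPolynomial (Fin n) R, P (algebraMap (MvPolynomial (Fin n) R) T f) := by
      intro f
      induction f using MvPolynomial.induction_on with
      | C r =>
        rw [← MvPolynomial.algebraMap_eq, ← IsScalarTower.algebraMap_apply]
        exact hPR r
      | add f g hf hg => rw [map_add]; exact hPadd _ _ hf hg
      | mul_X f j hf => rw [map_mul]; exact hPmul _ _ hf (hPX j)
    change P (y i)
    have hmem := mem_closure_coordMonomial (p := p) (R := R) (n := n) (y i)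
    generalize y i = a at hmem ⊢
    induction hmem using AddSubmonoid.closure_induction with
    | mem a ha =>
      obtain ⟨r, s, c, rfl⟩ := ha
      refine hPmul _ _ (hPmul _ _ (hPR r) (hPzero _ ?_)) (hPA _)
      have := D_pow_prime_mul (KaehlerDifferential.D R T) s 1
      rwa [mul_one, Derivation.map_one_eq_zero, smul_zero] at this
    | zero => exact hPzero 0 (map_zero _)
    | add a b _ _ ha hb => exact hPadd a b ha hb
  -- The `yᵢ` are coordinates: either a permutation of all of them, or two of them are equal.
  choose τ hτ using hy
  have hjac : jac R y = (coordBasis R T n).det (coordBasis R T n ∘ τ) := by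
    rw [jac]
    congr 1
    ext1 i
    rw [← hτ, Function.comp_apply, coordBasis_apply]
  by_cases hinj : Function.Injective τ
  · let e : Equiv.Perm (Fin n) := Equiv.ofBijective τ (Finite.injective_iff_bijective.1 hinj)
    have h1 : (∏ i, y i) ^ (p - 1) =
        coordMonomial R T (∑ i, (p - 1) • (Finsupp.single i 1 : Fin n →₀ ℕ)) := by
      rw [coordMonomial_sum, ← Finset.prod_pow, ← Equiv.prod_comp e fun i =>
        coordMonomial R T ((p - 1) • (Finsupp.single i 1 : Fin n →₀ ℕ))]
      refine Finset.prod_congr rfl fun i _ => ?_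
      rw [← hτ, Finsupp.smul_single, smul_eq_mul, mul_one, coordMonomial, ← map_pow,
        MvPolynomial.X_pow_eq_monomial]
      rfl
    have h2 : ∀ i, (∑ i, (p - 1) • (Finsupp.single i 1 : Fin n →₀ ℕ)) i + 1 = p := fun i => by
      have := hp.pos
      rw [Finsupp.finsetSum_apply, Finset.sum_eq_single i (fun j _ hj => by simp [hj]) (by simp)]
      simp only [Finsupp.smul_apply, Finsupp.single_eq_same, smul_eq_mul]
      omega
    have h3 : rootExponent p (∑ i, (p - 1) • (Finsupp.single i 1 : Fin n →₀ ℕ)) = 0 := by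
      ext i
      change ((∑ i, (p - 1) • (Finsupp.single i 1 : Fin n →₀ ℕ)) i + 1) / p - 1 = 0
      rw [h2, Nat.div_self hp.pos]
    have h4 : jac R y = ((Equiv.Perm.sign e : ℤ) : T) := by
      rw [hjac]
      refine (AlternatingMap.map_perm _ _ e).trans ?_
      rw [Module.Basis.det_self, Units.smul_def, zsmul_eq_mul, mul_one]
    have h5 := hκ (∑ i, (p - 1) • (Finsupp.single i 1 : Fin n →₀ ℕ)) m
    rw [cartierMonomial_of_dvd κ (fun i => (h2 i).symm ▸ dvd_rfl), h3] at h5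
    have h6 : coordMonomial R T (0 : Fin n →₀ ℕ) = 1 := by
      rw [coordMonomial, MvPolynomial.monomial_zero', map_one, map_one]
    rw [h1, h4, mul_comm, ← zsmul_eq_mul, ← TensorProduct.smul_tmul', map_zsmul, h5, h6,
      TensorProduct.smul_tmul', zsmul_eq_mul, mul_one]
  · rw [hjac, (coordBasis R T n).det.map_eq_zero_of_not_injective _ fun h =>
      hinj h.of_comp, mul_zero, TensorProduct.zero_tmul,
      TensorProduct.zero_tmul, map_zero]

end CartierRules

/-! ### Étale coordinates and top forms on a smooth algebra -/

section RelativeDimension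

variable {R S : Type*} [CommRing R] [CommRing S] [Algebra R S]

theorem exists_pow_mul_eq_zero_of_isIdempotentElem {s a : S} (ha : IsIdempotentElem a)
    (h : ∀ q : PrimeSpectrum S, s ∉ q.asIdeal → a ∈ q.asIdeal) : ∃ k : ℕ, s ^ k * a = 0 := by
  have : s * a ∈ nilradical S := by
    rw [nilradical_eq_sInf, Ideal.mem_sInf]
    intro q hq
    by_cases hs : s ∈ q
    · exact q.mul_mem_right _ hs
    · exact q.mul_mem_left _ (h ⟨q, hq⟩ hs)
  obtain ⟨k, hk⟩ := this
  refine ⟨k + 1, ?_⟩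
  rw [← ha.pow_succ_eq k, ← mul_pow, pow_succ, hk, zero_mul]

/-- The locus of relative dimension `n` of a smooth algebra is open and closed. -/
theorem exists_relDimIdempotents [Algebra.Smooth R S] (n : ℕ) :
    ∃ e ∈ relDimIdempotents R S n, ∀ q : PrimeSpectrum S,
      Module.rankAtStalk (Ω[S⁄R]) q = n → e ∉ q.asIdeal := by
  have : Module.FinitePresentation S (Ω[S⁄R]) := Module.finitePresentation_of_projective S _
  have hclopen : IsClopen (Module.rankAtStalk (R := S) (Ω[S⁄R]) ⁻¹' {n}) :=
    Module.isLocallyConstant_rankAtStalk.isClopen_fiber n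
  obtain ⟨e, he, heq⟩ := PrimeSpectrum.exists_idempotent_basicOpen_eq_of_isClopen hclopen
  have hmem : ∀ q : PrimeSpectrum S, Module.rankAtStalk (Ω[S⁄R]) q = n ↔ e ∉ q.asIdeal := fun q => by
    have := Set.ext_iff.1 heq q
    exact this
  exact ⟨e, ⟨he, fun q => (hmem q).2⟩, fun q => (hmem q).1⟩

/-- A smooth algebra has étale coordinates locally. -/
theorem exists_etale_coordinates [Algebra.Smooth R S] (q : PrimeSpectrum S) :
    ∃ s ∉ q.asIdeal, ∃ (n : ℕ) (_ : Algebra (MvPolynomial (Fin n) R) (Localization.Away s)),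
      IsScalarTower R (MvPolynomial (Fin n) R) (Localization.Away s) ∧
      Algebra.Etale (MvPolynomial (Fin n) R) (Localization.Away s) := by
  obtain ⟨s, hs, hstd⟩ := Algebra.IsSmoothAt.exists_notMem_isStandardSmooth R q.asIdeal
  obtain ⟨n, g, hg, het⟩ := RingHom.IsStandardSmooth.exists_etale_mvPolynomial
    (f := algebraMap R (Localization.Away s)) (by simpa [RingHom.isStandardSmooth_algebraMap])
  let := g.toAlgebra
  exact ⟨s, hs, n, g.toAlgebra, .of_algebraMap_eq' hg.symm, het⟩

end RelativeDimension

noncomputable section Coordinates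

variable {p : ℕ} {R S T : Type*} [CommRing R] [CommRing S] [CommRing T] [Algebra S T] {n : ℕ}
  [Algebra (MvPolynomial (Fin n) R) T]

variable (R T n) in
/-- On the locus where `s` is invertible the étale coordinates of `T = S[1/s]` can be replaced by
elements of `S`, multiplying them by `p`-th powers of powers of `s`. -/
theorem exists_coord (s : S) [IsLocalization.Away s T] (hp : 0 < p) :
    ∃ (x : Fin n → S) (k : Fin n → ℕ), ∀ i, algebraMap S T (x i) =
      (algebraMap S T s ^ k i) ^ p *
        algebraMap (MvPolynomial (Fin n) R) T (MvPolynomial.X i) := by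
  choose k a ha using fun i => IsLocalization.Away.surj s
    (algebraMap (MvPolynomial (Fin n) R) T (MvPolynomial.X i))
  refine ⟨fun i => s ^ (k i * p - k i) * a i, k, fun i => ?_⟩
  have : k i ≤ k i * p := Nat.le_mul_of_pos_right _ hp
  rw [map_mul, ← ha, map_pow, ← pow_mul, mul_comm, mul_assoc, ← pow_add, Nat.add_sub_of_le this,
    mul_comm]

variable [Algebra R T] [IsScalarTower R (MvPolynomial (Fin n) R) T]
  [Algebra.Etale (MvPolynomial (Fin n) R) T]

theorem D_coord [CharP T p] {s : S} {x : Fin n → S} {k : Fin n → ℕ}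
    (hx : ∀ i, algebraMap S T (x i) = (algebraMap S T s ^ k i) ^ p *
      algebraMap (MvPolynomial (Fin n) R) T (MvPolynomial.X i)) (i : Fin n) :
    KaehlerDifferential.D R T (algebraMap S T (x i)) =
      (algebraMap S T s ^ k i) ^ p • coordBasis R T n i := by
  rw [hx, D_pow_prime_mul, coordBasis_apply]

theorem jac_coord [CharP T p] {s : S} {x : Fin n → S} {k : Fin n → ℕ}
    (hx : ∀ i, algebraMap S T (x i) = (algebraMap S T s ^ k i) ^ p *
      algebraMap (MvPolynomial (Fin n) R) T (MvPolynomial.X i)) :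
    jac R (fun i => algebraMap S T (x i)) = algebraMap S T (s ^ ((∑ i, k i) * p)) := by
  rw [jac, funext (D_coord hx), AlternatingMap.map_smul_univ]
  change _ • (coordBasis R T n).det (coordBasis R T n) = _
  rw [Module.Basis.det_self, smul_eq_mul, mul_one, Finset.prod_pow, Finset.prod_pow_eq_pow_sum,
    map_pow, pow_mul]

end Coordinates

noncomputable section Charts

variable {R S T : Type*} [CommRing R] [CommRing S] [CommRing T] [Algebra R S]
  [Algebra S T] [Algebra R T] [IsScalarTower R S T] {n : ℕ} [Algebra (MvPolynomial (Fin n) R) T]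
  [IsScalarTower R (MvPolynomial (Fin n) R) T] [Algebra.Etale (MvPolynomial (Fin n) R) T]

variable (T) in
theorem rankAtStalk_eq_of_notMem [Algebra.Smooth R S] (s : S) [IsLocalization.Away s T]
    [Nontrivial T] (q : PrimeSpectrum S) (hq : s ∉ q.asIdeal) :
    Module.rankAtStalk (Ω[S⁄R]) q = n := by
  obtain ⟨q', hq'⟩ : q ∈ Set.range (PrimeSpectrum.comap (algebraMap S T)) := by
    rw [PrimeSpectrum.localization_away_comap_range T s]
    exact hq
  have : Algebra.FormallyEtale S T := .of_isLocalization (Submonoid.powers s)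
  rw [← hq', ← Module.rankAtStalk_isBaseChange
    (KaehlerDifferential.isBaseChange_of_formallyEtale R S T)]
  have : Module.Free T (Ω[T⁄R]) := .of_basis (coordBasis R T n)
  have : Module.Finite T (Ω[T⁄R]) := .of_basis (coordBasis R T n)
  rw [Module.rankAtStalk_eq_finrank_of_free, Pi.natCast_apply,
    Module.finrank_eq_card_basis (coordBasis R T n), Fintype.card_fin]
  simp

variable (R S T n) in
/-- The top form `dx₁ ∧ ⋯ ∧ dxₙ ↦ 1`, as an alternating form on the differentials of `S`. -/
def jacForm : (Ω[S⁄R]) [⋀^Fin n]→ₗ[S] T where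
  toMultilinearMap := ((coordBasis R T n).det.toMultilinearMap.restrictScalars S).compLinearMap
    fun _ => KaehlerDifferential.map R R S T
  map_eq_zero_of_eq' _ _ _ h hij := (coordBasis R T n).det.map_eq_zero_of_eq _
    (congrArg (KaehlerDifferential.map R R S T) h) hij

variable (R S T n) in
/-- The coefficient of a top form with respect to `dx₁ ∧ ⋯ ∧ dxₙ`, where the `xᵢ` are the
coordinates. -/
def formCoeff : relDualizing R S →ₗ[S] T :=
  (ExteriorAlgebra.liftAlternating (Pi.single n (jacForm R S T n))).domRestrict _

theorem formCoeff_topForm (e : relDimIdempotents R S n) (y : Fin n → S) :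
    formCoeff R S T n (topForm R e y) =
      algebraMap S T e * jac R fun i => algebraMap S T (y i) := by
  rw [formCoeff, LinearMap.domRestrict_apply, topForm, map_smul,
    ExteriorAlgebra.liftAlternating_apply_ιMulti, Pi.single_eq_same, Algebra.smul_def]
  congr 1
  change (coordBasis R T n).det (fun i => KaehlerDifferential.map R R S T _) = _
  simp only [KaehlerDifferential.map_D]
  rfl

theorem formCoeff_topForm_of_ne {n' : ℕ} (h : n' ≠ n) (e : relDimIdempotents R S n')
    (y : Fin n' → S) : formCoeff R S T n (topForm R e y) = 0 := by
  rw [formCoeff, LinearMap.domRestrict_apply, topForm, map_smul,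
    ExteriorAlgebra.liftAlternating_apply_ιMulti, Pi.single_eq_of_ne h, AlternatingMap.zero_apply,
    smul_zero]

variable {p : ℕ} {s : S} [IsLocalization.Away s T]

variable {x : Fin n → S} {k : Fin n → ℕ}

variable (T) in
theorem exists_pow_mul_eq_zero_of_ne [Algebra.Smooth R S] [Nontrivial T] {n' : ℕ} (h : n' ≠ n)
    (e : relDimIdempotents R S n') : ∃ k : ℕ, s ^ k * e = 0 := by
  refine exists_pow_mul_eq_zero_of_isIdempotentElem e.2.1 fun q hq => by_contra fun he => h ?_
  have := e.2.2 q he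
  rwa [rankAtStalk_eq_of_notMem (n := n) T s q hq, eq_comm] at this

variable (R T n s) in
theorem exists_relDimIdempotents_pow_mul [Algebra.Smooth R S] [Nontrivial T] :
    ∃ (e : relDimIdempotents R S n) (k : ℕ), s ^ k * e = s ^ k := by
  obtain ⟨e, he, h⟩ := exists_relDimIdempotents (R := R) (S := S) n
  obtain ⟨k, hk⟩ := exists_pow_mul_eq_zero_of_isIdempotentElem (s := s) he.1.one_sub fun q hq => by
    have := h q (rankAtStalk_eq_of_notMem (n := n) T s q hq)
    refine (q.2.mem_or_mem (?_ : e * (1 - e) ∈ q.asIdeal)).resolve_left this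
    rw [mul_sub, mul_one, he.1.eq, sub_self]
    exact zero_mem _
  exact ⟨⟨e, he⟩, k, by rw [mul_sub, mul_one, sub_eq_zero] at hk; exact hk.symm⟩

/-- The `dxᵢ` generate the differentials of `S` on the locus where `s` is invertible. -/
theorem exists_pow_smul_mem_span_D [CharP T p] (hx : ∀ i, algebraMap S T (x i) =
      (algebraMap S T s ^ k i) ^ p * algebraMap (MvPolynomial (Fin n) R) T (MvPolynomial.X i))
    (y : Ω[S⁄R]) :
    ∃ l : ℕ, s ^ l • y ∈ Submodule.span S (Set.range fun i => KaehlerDifferential.D R S (x i)) := by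
  set f := KaehlerDifferential.map R R S T
  have hf : IsLocalizedModule (Submonoid.powers s) f := inferInstance
  suffices ∀ z : Ω[T⁄R], ∃ l : ℕ, ∃ w ∈ Submodule.span S
      (Set.range fun i => KaehlerDifferential.D R S (x i)), algebraMap S T (s ^ l) • z = f w by
    obtain ⟨l, w, hw, h⟩ := this (f y)
    rw [algebraMap_smul, ← map_smul] at h
    obtain ⟨⟨_, l', rfl⟩, h'⟩ := IsLocalizedModule.exists_of_eq (S := Submonoid.powers s) h
    refine ⟨l' + l, ?_⟩
    rw [pow_add, mul_smul]
    exact (show s ^ l' • s ^ l • y = s ^ l' • w from h') ▸ Submodule.smul_mem _ _ hw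
  intro z
  induction (coordBasis R T n).mem_span z using Submodule.span_induction with
  | zero => exact ⟨0, 0, zero_mem _, by rw [smul_zero, map_zero]⟩
  | add a b _ _ ha hb =>
    obtain ⟨l, w, hw, h⟩ := ha
    obtain ⟨l', w', hw', h'⟩ := hb
    refine ⟨l + l', s ^ l' • w + s ^ l • w', add_mem (Submodule.smul_mem _ _ hw)
      (Submodule.smul_mem _ _ hw'), ?_⟩
    rw [map_add, map_smul, map_smul, ← h, ← h', smul_add, ← algebraMap_smul T (s ^ l'), smul_smul,
      ← algebraMap_smul T (s ^ l), smul_smul, ← map_mul, ← map_mul, ← pow_add, ← pow_add, add_comm l']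
  | smul t a _ ha =>
    obtain ⟨l, w, hw, h⟩ := ha
    obtain ⟨l', c, hc⟩ := IsLocalization.Away.surj s t
    refine ⟨l' + l, c • w, Submodule.smul_mem _ _ hw, ?_⟩
    rw [map_smul, ← h, ← algebraMap_smul T c, ← hc, smul_smul, smul_smul, pow_add, map_mul, map_pow,
      map_pow]
    congr 1
    ring
  | mem a ha =>
    obtain ⟨i, rfl⟩ := ha
    refine ⟨k i * p, KaehlerDifferential.D R S (x i), Submodule.subset_span ⟨i, rfl⟩, ?_⟩
    rw [KaehlerDifferential.map_D, D_coord hx, map_pow, pow_mul]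

theorem exists_pow_smul_ιMulti [CharP T p] (hx : ∀ i, algebraMap S T (x i) =
      (algebraMap S T s ^ k i) ^ p * algebraMap (MvPolynomial (Fin n) R) T (MvPolynomial.X i))
    (y : Fin n → Ω[S⁄R]) : ∃ (l : ℕ) (σ : S), s ^ l • ExteriorAlgebra.ιMulti S n y =
      σ • ExteriorAlgebra.ιMulti S n fun i => KaehlerDifferential.D R S (x i) := by
  refine forall_of_forall_update (P := fun y => ∃ (l : ℕ) (σ : S),
    s ^ l • ExteriorAlgebra.ιMulti S n y =
      σ • ExteriorAlgebra.ιMulti S n fun i => KaehlerDifferential.D R S (x i))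
    (G := Set.range fun i => KaehlerDifferential.D R S (x i)) (fun y i h => ?_) (fun y hy => ?_) y
  · let θ := ExteriorAlgebra.ιMulti S n fun i => KaehlerDifferential.D R S (x i)
    let V : Submodule S (Ω[S⁄R]) :=
      { carrier := {a | ∃ (l : ℕ) (σ : S),
          s ^ l • ExteriorAlgebra.ιMulti S n (Function.update y i a) = σ • θ}
        zero_mem' := ⟨0, 0, by rw [AlternatingMap.map_update_zero, smul_zero, zero_smul]⟩
        add_mem' := by
          rintro a b ⟨l, σ, h⟩ ⟨l', σ', h'⟩
          refine ⟨l + l', s ^ l' * σ + s ^ l * σ', ?_⟩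
          rw [AlternatingMap.map_update_add, add_smul, mul_smul, mul_smul, ← h, ← h', smul_smul,
            smul_smul, smul_add, ← pow_add, ← pow_add, add_comm l']
        smul_mem' := by
          rintro c a ⟨l, σ, h⟩
          exact ⟨l, c * σ, by rw [AlternatingMap.map_update_smul, smul_comm, h, mul_smul]⟩ }
    have hV : Submodule.span S (Set.range fun i => KaehlerDifferential.D R S (x i)) ≤ V :=
      Submodule.span_le.2 h
    obtain ⟨l, hl⟩ := exists_pow_smul_mem_span_D hx (y i)
    obtain ⟨l', σ, h'⟩ := hV hl
    refine ⟨l' + l, σ, ?_⟩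
    rw [AlternatingMap.map_update_smul, Function.update_eq_self, smul_smul, ← pow_add] at h'
    exact h'
  · choose τ hτ using hy
    have hy : y = (fun i => KaehlerDifferential.D R S (x i)) ∘ τ := funext fun i => (hτ i).symm
    by_cases hinj : Function.Injective τ
    · refine ⟨0, ((Equiv.Perm.sign (Equiv.ofBijective τ (Finite.injective_iff_bijective.1 hinj)) : ℤ)
        : S), ?_⟩
      rw [hy, pow_zero, one_smul, Int.cast_smul_eq_zsmul]
      exact (AlternatingMap.map_perm _ _ (Equiv.ofBijective τ _))
    · refine ⟨0, 0, ?_⟩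
      rw [hy, AlternatingMap.map_eq_zero_of_not_injective _ _ fun h => hinj h.of_comp, smul_zero,
        zero_smul]

/-- The form `dx₁ ∧ ⋯ ∧ dxₙ` generates `ω` on the locus where `s` is invertible. -/
theorem exists_pow_smul_eq_smul_topForm [Algebra.Smooth R S] [Nontrivial T] [CharP T p]
    (hx : ∀ i, algebraMap S T (x i) =
      (algebraMap S T s ^ k i) ^ p * algebraMap (MvPolynomial (Fin n) R) T (MvPolynomial.X i))
    {e : relDimIdempotents R S n} {k' : ℕ} (he : s ^ k' * (e : S) = s ^ k') (w : relDualizing R S) :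
    ∃ (l : ℕ) (σ : S), s ^ l • w = σ • topForm R e x := by
  let V : Submodule S (ExteriorAlgebra S (Ω[S⁄R])) :=
    { carrier := {w | ∃ (l : ℕ) (σ : S), s ^ l • w = σ • (topForm R e x : ExteriorAlgebra S (Ω[S⁄R]))}
      zero_mem' := ⟨0, 0, by rw [smul_zero, zero_smul]⟩
      add_mem' := by
        rintro a b ⟨l, σ, h⟩ ⟨l', σ', h'⟩
        refine ⟨l + l', s ^ l' * σ + s ^ l * σ', ?_⟩
        rw [add_smul, mul_smul, mul_smul, ← h, ← h', smul_smul,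
          smul_smul, smul_add, ← pow_add, ← pow_add, add_comm l']
      smul_mem' := by
        rintro c a ⟨l, σ, h⟩
        exact ⟨l, c * σ, by rw [smul_comm, h, mul_smul]⟩ }
  suffices relDualizing R S ≤ V by
    obtain ⟨l, σ, h⟩ := this w.2
    exact ⟨l, σ, Subtype.ext h⟩
  refine iSup_le fun n' => Submodule.smul_le.2 fun r hr u hu => ?_
  suffices Ideal.span (relDimIdempotents R S n') ≤ V.comap (LinearMap.toSpanSingleton S _ u) from
    this hr
  refine Ideal.span_le.2 fun a ha => ?_
  change a • u ∈ V
  by_cases h : n' = n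
  · subst h
    refine V.smul_mem a ?_
    rw [← ExteriorAlgebra.ιMulti_span_fixedDegree] at hu
    refine (Submodule.span_le.2 ?_) hu
    rintro _ ⟨y, rfl⟩
    obtain ⟨l, σ, h⟩ := exists_pow_smul_ιMulti hx y
    refine ⟨k' + l, s ^ k' * σ, ?_⟩
    rw [pow_add, mul_smul, h, topForm, smul_smul, smul_smul, mul_right_comm, he]
  · obtain ⟨l, hl⟩ := exists_pow_mul_eq_zero_of_ne (s := s) T h ⟨a, ha⟩
    exact ⟨l, 0, by rw [smul_smul, hl, zero_smul, zero_smul]⟩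

/-- The coefficient map exhibits `T = S[1/s]` as the localization of `ω`. -/
theorem isLocalizedModule_formCoeff [Algebra.Smooth R S] [Nontrivial T] [Fact p.Prime] [CharP T p] :
    IsLocalizedModule (Submonoid.powers s) (formCoeff R S T n) := by
  obtain ⟨x, k, hx⟩ := exists_coord (p := p) R T n s (Fact.out : p.Prime).pos
  obtain ⟨e, k', he⟩ := exists_relDimIdempotents_pow_mul R T n s
  have hs : ∀ l, IsUnit (algebraMap S T (s ^ l)) := fun l =>
    IsLocalization.map_units T (⟨_, l, rfl⟩ : Submonoid.powers s)
  have heT : algebraMap S T e = 1 := by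
    have := congrArg (algebraMap S T) he
    rw [map_mul] at this
    exact (hs k').mul_eq_left.1 this
  have hθ : formCoeff R S T n (topForm R e x) = algebraMap S T (s ^ ((∑ i, k i) * p)) := by
    rw [formCoeff_topForm, heT, one_mul, jac_coord hx]
  refine ⟨?_, fun t => ?_, fun {w w'} h => ?_⟩
  · exact (inferInstance : IsLocalizedModule (Submonoid.powers s)
      (Algebra.linearMap S T)).map_units
  · obtain ⟨l, a, ha⟩ := IsLocalization.Away.surj s t
    refine ⟨(a • topForm R e x, ⟨s ^ (l + (∑ i, k i) * p), _, rfl⟩), ?_⟩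
    change s ^ (l + (∑ i, k i) * p) • t = formCoeff R S T n (a • topForm R e x)
    rw [map_smul, hθ, Algebra.smul_def, Algebra.smul_def, ← ha, pow_add, map_mul,
      map_pow _ _ l]
    ring
  · suffices ∀ w : relDualizing R S, formCoeff R S T n w = 0 → ∃ l : ℕ, s ^ l • w = 0 by
      obtain ⟨l, hl⟩ := this (w - w') (by rw [map_sub, h, sub_self])
      exact ⟨⟨_, l, rfl⟩, by rwa [smul_sub, sub_eq_zero] at hl⟩
    intro w hw
    obtain ⟨l, σ, hl⟩ := exists_pow_smul_eq_smul_topForm hx he w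
    have h0 := congrArg (formCoeff R S T n) hl
    rw [map_smul, map_smul, hw, smul_zero, hθ, Algebra.smul_def, eq_comm,
      (hs _).mul_left_eq_zero] at h0
    obtain ⟨l', hl'⟩ := IsLocalization.Away.exists_of_eq (S := T) s (h0.trans (map_zero _).symm)
    refine ⟨l' + l, ?_⟩
    rw [pow_add, mul_smul, hl, smul_smul, hl', mul_zero, zero_smul]

end Charts

/-! ### Forms that determine the Cartier operator -/

noncomputable section FrobeniusSpan

variable {R S : Type*} [CommRing R] [CommRing S] [Algebra R S] {n : ℕ}

theorem topForm_update_mul (e : relDimIdempotents R S n) (y : Fin n → S) (i : Fin n) (a b : S) :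
    topForm R e (Function.update y i (a * b)) =
      a • topForm R e (Function.update y i b) + b • topForm R e (Function.update y i a) := by
  refine Subtype.ext ?_
  change (e : S) • ExteriorAlgebra.ιMulti S n _ = a • ((e : S) • ExteriorAlgebra.ιMulti S n _) +
    b • ((e : S) • ExteriorAlgebra.ιMulti S n _)
  simp only [Function.apply_update (fun _ => KaehlerDifferential.D R S), Derivation.leibniz,
    AlternatingMap.map_update_add, AlternatingMap.map_update_smul, smul_add]
  rw [smul_comm a, smul_comm b]

theorem topForm_update_of_D_eq_smul (e : relDimIdempotents R S n) (y : Fin n → S) (i : Fin n)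
    {a b : S} {c : S} (h : KaehlerDifferential.D R S a = c • KaehlerDifferential.D R S b) :
    topForm R e (Function.update y i a) = c • topForm R e (Function.update y i b) := by
  refine Subtype.ext ?_
  change (e : S) • ExteriorAlgebra.ιMulti S n _ = c • ((e : S) • ExteriorAlgebra.ιMulti S n _)
  simp only [Function.apply_update (fun _ => KaehlerDifferential.D R S), h,
    AlternatingMap.map_update_smul]
  rw [smul_comm c]

/-- A top form vanishes if one of the functions is a monomial in the others. -/
theorem topForm_update_prod_pow (e : relDimIdempotents R S n) (y : Fin n → S) (i : Fin n)
    (c : Fin n → ℕ) :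
    topForm R e (Function.update y i (∏ j ∈ Finset.univ.erase i, y j ^ c j)) = 0 := by
  let V : Submonoid S :=
    { carrier := {v | topForm R e (Function.update y i v) = 0}
      one_mem' := by
        change _ = _
        rw [topForm_update_of_D_eq_smul e y i (b := 1) (c := 0), zero_smul]
        rw [Derivation.map_one_eq_zero, zero_smul]
      mul_mem' := fun {a b} (ha : _ = 0) (hb : _ = 0) => by
        change _ = 0
        rw [topForm_update_mul, ha, hb, smul_zero, smul_zero, add_zero] }
  refine V.prod_mem fun j hj => V.pow_mem ?_ _
  have hji : i ≠ j := (Finset.ne_of_mem_erase hj).symm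
  refine Subtype.ext ?_
  change (e : S) • ExteriorAlgebra.ιMulti S n _ = 0
  simp only [Function.apply_update (fun _ => KaehlerDifferential.D R S)]
  rw [AlternatingMap.map_update_self (ExteriorAlgebra.ιMulti S n) _ hji, smul_zero]

/-- The form `x ^ c dx₁ ∧ ⋯ ∧ dxₙ` is exact if `c i + 1` is invertible for some `i`. -/
theorem exists_prod_pow_smul_topForm {p : ℕ} (hp : p.Prime) (hS : (p : S) = 0)
    (e : relDimIdempotents R S n) (x : Fin n → S) (c : Fin n → ℕ) {i : Fin n} (hi : ¬ p ∣ c i + 1) :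
    ∃ (r : ℕ) (y : Fin n → S), (∏ j, x j ^ c j) • topForm R e x = r • topForm R e y := by
  obtain ⟨r, hr⟩ : ∃ r : ℕ, ((c i + 1 : ℕ) : S) * r = 1 := by
    obtain ⟨r, -, hr⟩ := Nat.exists_mul_mod_eq_one_of_coprime
      ((Nat.Prime.coprime_iff_not_dvd hp).2 hi).symm hp.one_lt
    refine ⟨r, ?_⟩
    rw [← Nat.cast_mul, ← Nat.div_add_mod ((c i + 1) * r) p, hr, Nat.cast_add, Nat.cast_mul, hS,
      zero_mul, zero_add, Nat.cast_one]
  refine ⟨r, Function.update x i (x i ^ (c i + 1) * ∏ j ∈ Finset.univ.erase i, x j ^ c j), ?_⟩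
  rw [topForm_update_mul, topForm_update_prod_pow, smul_zero, zero_add,
    topForm_update_of_D_eq_smul e x i (b := x i) (c := ((c i + 1 : ℕ) : S) * x i ^ c i),
    Function.update_eq_self, ← Nat.cast_smul_eq_nsmul S r, smul_smul, smul_smul,
    ← Finset.mul_prod_erase Finset.univ (fun j => x j ^ c j) (Finset.mem_univ i)]
  · congr 1
    linear_combination -(∏ j ∈ Finset.univ.erase i, x j ^ c j) * x i ^ c i * hr
  · rw [Derivation.leibniz_pow, Nat.add_sub_cancel, mul_smul, Nat.cast_smul_eq_nsmul]

variable (R S) in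
/-- The forms that the two rules for the Cartier operator of `ω ⊗ M` reach: sums of multiples by
`r • σ ^ p` of exact forms and of forms `(y₁ ⋯ yₙ) ^ (p - 1) dy₁ ∧ ⋯ ∧ dyₙ`. -/
def reachableForms (p : ℕ) : AddSubmonoid (relDualizing R S) :=
  AddSubmonoid.closure
    ({w | ∃ (r : R) (σ : S) (n : ℕ) (e : relDimIdempotents R S n) (y : Fin n → S),
        w = r • σ ^ p • (∏ i, y i) ^ (p - 1) • topForm R e y} ∪
      {w | ∃ (r : R) (σ : S) (n : ℕ) (e : relDimIdempotents R S n) (y : Fin n → S), n ≠ 0 ∧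
        w = r • σ ^ p • topForm R e y})

theorem smul_pow_smul_mem_reachableForms {p : ℕ} (r : R) (σ : S) {w : relDualizing R S}
    (hw : w ∈ reachableForms R S p) : r • σ ^ p • w ∈ reachableForms R S p := by
  induction hw using AddSubmonoid.closure_induction with
  | zero => rw [smul_zero, smul_zero]; exact zero_mem _
  | add a b _ _ ha hb => rw [smul_add, smul_add]; exact add_mem ha hb
  | mem w hw =>
    obtain ⟨r', σ', n, e, y, rfl⟩ | ⟨r', σ', n, e, y, hn, rfl⟩ := hw
    · refine AddSubmonoid.subset_closure (Or.inl ⟨r * r', σ * σ', n, e, y, ?_⟩)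
      rw [mul_smul, mul_pow, mul_smul, smul_comm (σ ^ p) r']
    · refine AddSubmonoid.subset_closure (Or.inr ⟨r * r', σ * σ', n, e, y, hn, ?_⟩)
      rw [mul_smul, mul_pow, mul_smul, smul_comm (σ ^ p) r']

/-- The form `x ^ a dx₁ ∧ ⋯ ∧ dxₙ` is exact unless all `a i` are equal to `p - 1`. -/
theorem prod_pow_smul_topForm_mem_reachableForms {p : ℕ} (hp : p.Prime) (hS : (p : S) = 0)
    (e : relDimIdempotents R S n) (x : Fin n → S) (a : Fin n → Fin p) :
    (∏ j, x j ^ (a j : ℕ)) • topForm R e x ∈ reachableForms R S p := by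
  by_cases h : ∃ i, ¬ p ∣ (a i : ℕ) + 1
  · obtain ⟨i, hi⟩ := h
    obtain ⟨r, y, hr⟩ := exists_prod_pow_smul_topForm hp hS e x (fun j => a j) hi
    rw [hr]
    have hn : n ≠ 0 := by rintro rfl; exact i.elim0
    have : topForm R e y ∈ reachableForms R S p := AddSubmonoid.subset_closure
      (Or.inr ⟨1, 1, n, e, y, hn, by rw [one_pow, one_smul, one_smul]⟩)
    exact nsmul_mem this r
  · refine AddSubmonoid.subset_closure (Or.inl ⟨1, 1, n, e, x, ?_⟩)
    rw [one_pow, one_smul, one_smul, ← Finset.prod_pow]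
    congr 1
    refine Finset.prod_congr rfl fun j _ => ?_
    have h1 := Nat.le_of_dvd (Nat.succ_pos _) (not_not.1 fun h' => h ⟨j, h'⟩)
    have h2 := (a j).2
    congr 1
    omega

theorem coordMonomial_eq_prod {T : Type*} [CommRing T] [Algebra (MvPolynomial (Fin n) R) T]
    (c : Fin n →₀ ℕ) : coordMonomial R T c =
      ∏ i, algebraMap (MvPolynomial (Fin n) R) T (MvPolynomial.X i) ^ c i := by
  conv_lhs => rw [← Finsupp.univ_sum_single c, coordMonomial_sum]
  refine Finset.prod_congr rfl fun i _ => ?_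
  rw [coordMonomial, ← map_pow, MvPolynomial.X_pow_eq_monomial]

/-- On the locus with étale coordinates `S` is generated by the monomials in the coordinates over
`R` and the `p`-th powers. -/
theorem exists_pow_mul_mem_closure {p : ℕ} [Fact p.Prime] {T : Type*} [CommRing T] [Algebra S T]
    [Algebra R T] [IsScalarTower R S T] [Algebra (MvPolynomial (Fin n) R) T]
    [IsScalarTower R (MvPolynomial (Fin n) R) T] [Algebra.Etale (MvPolynomial (Fin n) R) T]
    [CharP R p] [CharP T p] {s : S} [IsLocalization.Away s T] {x : Fin n → S} {k : Fin n → ℕ}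
    (hx : ∀ i, algebraMap S T (x i) = (algebraMap S T s ^ k i) ^ p *
      algebraMap (MvPolynomial (Fin n) R) T (MvPolynomial.X i)) (z : S) :
    ∃ l : ℕ, s ^ (p * l) * z ∈ AddSubmonoid.closure {y : S | ∃ (r : R) (t : S) (a : Fin n → Fin p),
      y = algebraMap R S r * t ^ p * ∏ i, x i ^ (a i : ℕ)} := by
  have hp : p.Prime := Fact.out
  set C := AddSubmonoid.closure {y : S | ∃ (r : R) (t : S) (a : Fin n → Fin p),
      y = algebraMap R S r * t ^ p * ∏ i, x i ^ (a i : ℕ)}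
  have hC : ∀ (l : ℕ), ∀ y ∈ C, s ^ (p * l) * y ∈ C := by
    intro l y hy
    induction hy using AddSubmonoid.closure_induction with
    | zero => rw [mul_zero]; exact zero_mem _
    | add a b _ _ ha hb => rw [mul_add]; exact add_mem ha hb
    | mem y hy =>
      obtain ⟨r, t, a, rfl⟩ := hy
      refine AddSubmonoid.subset_closure ⟨r, s ^ l * t, a, ?_⟩
      rw [mul_pow, ← pow_mul, mul_comm p l]
      ring
  suffices ∀ z : T, ∃ l : ℕ, ∃ y ∈ C, z * algebraMap S T s ^ (p * l) = algebraMap S T y by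
    obtain ⟨l, y, hy, h⟩ := this (algebraMap S T z)
    rw [← map_pow, ← map_mul] at h
    obtain ⟨m, hm⟩ := IsLocalization.Away.exists_of_eq (S := T) s h
    refine ⟨m + l, ?_⟩
    have h1 : (p - 1) * m + m = p * m := by
      rw [← Nat.succ_mul, Nat.succ_eq_add_one, Nat.sub_add_cancel hp.one_le]
    have : s ^ (p * (m + l)) * z = s ^ (p * m) * y := by
      rw [mul_add, ← h1, pow_add, pow_add, mul_assoc _ _ y, ← hm]
      ring
    rw [this]
    exact hC m y hy
  intro z
  induction mem_closure_coordMonomial (p := p) (R := R) (n := n) z using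
      AddSubmonoid.closure_induction with
  | zero => exact ⟨0, 0, zero_mem _, by rw [zero_mul, map_zero]⟩
  | add a b _ _ ha hb =>
    obtain ⟨l, y, hy, h⟩ := ha
    obtain ⟨l', y', hy', h'⟩ := hb
    refine ⟨l + l', s ^ (p * l') * y + s ^ (p * l) * y', add_mem (hC _ _ hy) (hC _ _ hy'), ?_⟩
    rw [map_add, map_mul, map_mul, ← h, ← h', map_pow, map_pow, mul_add p, pow_add]
    ring
  | mem z hz =>
    obtain ⟨r, t, c, rfl⟩ := hz
    obtain ⟨l, t', ht'⟩ := IsLocalization.Away.surj s t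
    refine ⟨l + ∑ i, k i * c i, algebraMap R S r * (t' * ∏ i, x i ^ (c i / p)) ^ p *
      ∏ i, x i ^ (c i % p), AddSubmonoid.subset_closure
        ⟨r, t' * ∏ i, x i ^ (c i / p), fun i => ⟨c i % p, Nat.mod_lt _ hp.pos⟩, rfl⟩, ?_⟩
    have h1 : (∏ i, x i ^ (c i / p)) ^ p * ∏ i, x i ^ (c i % p) = ∏ i, x i ^ c i := by
      rw [← Finset.prod_pow, ← Finset.prod_mul_distrib]
      refine Finset.prod_congr rfl fun i _ => ?_
      rw [← pow_mul, ← pow_add, mul_comm, Nat.div_add_mod]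
    have h2 : algebraMap S T (∏ i, x i ^ c i) =
        algebraMap S T s ^ (p * ∑ i, k i * c i) * coordMonomial R T c := by
      rw [coordMonomial_eq_prod, map_prod, Finset.mul_sum, ← Finset.prod_pow_eq_pow_sum,
        ← Finset.prod_mul_distrib]
      refine Finset.prod_congr rfl fun i _ => ?_
      rw [map_pow, hx, mul_pow, ← pow_mul, ← pow_mul]
      congr 2
      ring
    rw [mul_pow, mul_assoc (algebraMap R S r), mul_assoc (t' ^ p), h1, map_mul, map_mul, map_pow,
      ← ht', h2, ← IsScalarTower.algebraMap_apply, mul_add p, pow_add, mul_pow, ← pow_mul,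
      mul_comm l p]
    ring

theorem nontrivial_localization_of_notMem (q : PrimeSpectrum S) {s : S} (hs : s ∉ q.asIdeal) :
    Nontrivial (Localization.Away s) := by
  rw [← not_subsingleton_iff_nontrivial, IsLocalization.subsingleton_iff (M := Submonoid.powers s)]
  rintro ⟨l, hl⟩
  exact hs (q.2.mem_of_pow_mem l ((show s ^ l = 0 from hl) ▸ zero_mem _))

theorem charP_of_natCast_eq_zero {A : Type*} [CommRing A] [Nontrivial A] {p : ℕ} (hp : p.Prime)
    (h : (p : A) = 0) : CharP A p :=
  (CharP.charP_iff_prime_eq_zero hp).2 h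

/-- Every form is reachable. This holds locally by the existence of étale coordinates, and the `f`
for which `f ^ p • w` is reachable are an ideal. -/
theorem reachableForms_eq_top [Algebra.Smooth R S] {p : ℕ} [Fact p.Prime] (hS : (p : S) = 0)
    (hR : (p : R) = 0) : reachableForms R S p = ⊤ := by
  have hp : p.Prime := Fact.out
  refine eq_top_iff.2 fun w _ => ?_
  let I : Ideal S :=
    { carrier := {f | f ^ p • w ∈ reachableForms R S p}
      zero_mem' := by
        rw [Set.mem_ofPred_eq, zero_pow hp.ne_zero, zero_smul]; exact zero_mem _
      add_mem' := fun {a b} (ha : _ ∈ _) (hb : _ ∈ _) => by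
        rw [Set.mem_ofPred_eq, add_pow_prime_of_natCast_eq_zero hp hS, add_smul]; exact add_mem ha hb
      smul_mem' := fun c a (ha : _ ∈ _) => by
        rw [Set.mem_ofPred_eq]
        have := smul_pow_smul_mem_reachableForms (1 : R) c ha
        rwa [one_smul, smul_smul, ← mul_pow] at this }
  suffices I = ⊤ by
    have : (1 : S) ∈ I := this ▸ Submodule.mem_top
    have : (1 : S) ^ p • w ∈ reachableForms R S p := this
    rwa [one_pow, one_smul] at this
  by_contra hI
  obtain ⟨q, hq, hIq⟩ := Ideal.exists_le_maximal I hI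
  obtain ⟨s, hs, n, _, _, _⟩ := exists_etale_coordinates (R := R) ⟨q, hq.isPrime⟩
  have := nontrivial_localization_of_notMem ⟨q, hq.isPrime⟩ hs
  have := charP_of_natCast_eq_zero (A := Localization.Away s) hp (by
    rw [← map_natCast (algebraMap S (Localization.Away s)), hS, map_zero])
  have : Nontrivial R := (algebraMap R (Localization.Away s)).domain_nontrivial
  have := charP_of_natCast_eq_zero hp hR
  obtain ⟨x, k, hx⟩ := exists_coord R (Localization.Away s) n s hp.pos
  obtain ⟨e, k', he⟩ := exists_relDimIdempotents_pow_mul R (Localization.Away s) n s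
  obtain ⟨l, σ, hl⟩ := exists_pow_smul_eq_smul_topForm hx he w
  obtain ⟨l', hl'⟩ := exists_pow_mul_mem_closure hx (s ^ ((p - 1) * l) * σ)
  suffices s ^ (l' + l) ∈ I from hs (hq.isPrime.mem_of_pow_mem _ (hIq this))
  change (s ^ (l' + l)) ^ p • w ∈ reachableForms R S p
  have h1 : (s ^ (l' + l)) ^ p • w = (s ^ (p * l') * (s ^ ((p - 1) * l) * σ)) • topForm R e x := by
    have h2 : (l' + l) * p = p * l' + ((p - 1) * l + l) := by
      rw [← Nat.succ_mul, Nat.succ_eq_add_one, Nat.sub_add_cancel hp.one_le]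
      ring
    rw [← pow_mul, h2, pow_add, pow_add, mul_smul, mul_smul, hl, mul_smul, mul_smul]
  rw [h1]
  generalize s ^ (p * l') * (s ^ ((p - 1) * l) * σ) = z at hl'
  induction hl' using AddSubmonoid.closure_induction with
  | zero => rw [zero_smul]; exact zero_mem _
  | add a b _ _ ha hb => rw [add_smul]; exact add_mem ha hb
  | mem z hz =>
    obtain ⟨r, t, a, rfl⟩ := hz
    rw [mul_smul, mul_smul, algebraMap_smul]
    exact smul_pow_smul_mem_reachableForms r t
      (prod_pow_smul_topForm_mem_reachableForms hp hS e x a)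

end FrobeniusSpan

/-! ### The Cartier structure of `f^! M` -/

noncomputable section ShriekStructure

variable {p : ℕ} {R S M : Type*} [CommRing R] [CommRing S] [Algebra R S] [AddCommGroup M]
  [Module R M] {κ : CartierStructure p R M} {κ' : CartierStructure p S (Shriek R S M)}

theorem IsShriekStructure.exact_eq_zero_of_ne (h : IsShriekStructure κ κ') {n : ℕ} (hn : n ≠ 0)
    (e : relDimIdempotents R S n) (y : Fin n → S) (m : M) : κ' (topForm R e y ⊗ₜ m) = 0 := by
  obtain ⟨n, rfl⟩ := Nat.exists_eq_succ_of_ne_zero hn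
  exact h.exact_eq_zero n e y m

theorem smul_pow_smul_tmul (r : R) (σ : S) (w : relDualizing R S) (m : M) :
    (r • σ ^ p • w) ⊗ₜ[R] m = σ ^ p • (w ⊗ₜ[R] (r • m)) := by
  rw [TensorProduct.smul_tmul, TensorProduct.smul_tmul']

/-- An additive property of elements of `ω ⊗ M` may be checked on the elements on which the two rules
determine the Cartier operator. -/
theorem shriek_induction [Algebra.Smooth R S] [Fact p.Prime] (hS : (p : S) = 0) (hR : (p : R) = 0)
    {N : Submodule R M} {P : Shriek R S M → Prop} (zero : P 0)
    (add : ∀ z z', P z → P z' → P (z + z'))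
    (cartier : ∀ (σ : S) (n : ℕ) (e : relDimIdempotents R S n) (y : Fin n → S), ∀ m ∈ N,
      P (σ ^ p • (((∏ i, y i) ^ (p - 1) • topForm R e y) ⊗ₜ[R] m)))
    (exact_form : ∀ (σ : S) (n : ℕ) (e : relDimIdempotents R S n) (y : Fin n → S), n ≠ 0 → ∀ m ∈ N,
      P (σ ^ p • (topForm R e y ⊗ₜ[R] m))) (w : relDualizing R S) (m : M) (hm : m ∈ N) :
    P (w ⊗ₜ m) := by
  have hw : w ∈ reachableForms R S p := reachableForms_eq_top hS hR ▸ AddSubmonoid.mem_top w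
  induction hw using AddSubmonoid.closure_induction with
  | zero => rwa [TensorProduct.zero_tmul]
  | add a b _ _ ha hb => rw [TensorProduct.add_tmul]; exact add _ _ ha hb
  | mem w hw =>
    obtain ⟨r, σ, n, e, y, rfl⟩ | ⟨r, σ, n, e, y, hn, rfl⟩ := hw
    · rw [smul_pow_smul_tmul]
      exact cartier σ n e y _ (N.smul_mem r hm)
    · rw [smul_pow_smul_tmul]
      exact exact_form σ n e y hn _ (N.smul_mem r hm)

theorem IsShriekStructure.unique [Algebra.Smooth R S] [Fact p.Prime] (hS : (p : S) = 0)
    (hR : (p : R) = 0) {κ'' : CartierStructure p S (Shriek R S M)} (h : IsShriekStructure κ κ')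
    (h' : IsShriekStructure κ κ'') : κ' = κ'' := by
  refine DFunLike.ext _ _ fun z => ?_
  induction z using TensorProduct.induction_on with
  | zero => rw [map_zero, map_zero]
  | add x y hx hy => rw [map_add, map_add, hx, hy]
  | tmul w m =>
    refine shriek_induction (p := p) (N := ⊤) (P := fun z => κ' z = κ'' z) hS hR
      (by rw [map_zero, map_zero]) (fun z z' hz hz' => by rw [map_add, map_add, hz, hz'])
      (fun σ n e y m _ => ?_) (fun σ n e y hn m _ => ?_) w m trivial
    · rw [κ'.map_pow_smul, κ''.map_pow_smul, h.cartier, h'.cartier]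
    · rw [κ'.map_pow_smul, κ''.map_pow_smul, h.exact_eq_zero_of_ne hn, h'.exact_eq_zero_of_ne hn]

variable (S) in
/-- The graph of the Cartier operator of `ω ⊗ M`: the subgroup that is generated by the two rules. -/
def shriekGraph (κ : CartierStructure p R M) : AddSubgroup (Shriek R S M × Shriek R S M) :=
  AddSubgroup.closure
    ({z | ∃ (σ : S) (n : ℕ) (e : relDimIdempotents R S n) (y : Fin n → S) (m : M),
        z = (σ ^ p • (((∏ i, y i) ^ (p - 1) • topForm R e y) ⊗ₜ[R] m),
          σ • (topForm R e y ⊗ₜ[R] κ m))} ∪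
      {z | ∃ (σ : S) (n : ℕ) (e : relDimIdempotents R S n) (y : Fin n → S) (m : M), n ≠ 0 ∧
        z = (σ ^ p • (topForm R e y ⊗ₜ[R] m), 0)})

theorem smul_mem_shriekGraph (τ : S) {z z' : Shriek R S M} (h : (z, z') ∈ shriekGraph S κ) :
    (τ ^ p • z, τ • z') ∈ shriekGraph S κ := by
  suffices ∀ v ∈ shriekGraph S κ, (τ ^ p • v.1, τ • v.2) ∈ shriekGraph S κ from this _ h
  intro v hv
  induction hv using AddSubgroup.closure_induction with
  | zero => simp only [Prod.fst_zero, Prod.snd_zero, smul_zero]; exact zero_mem _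
  | add a b _ _ ha hb =>
    simp only [Prod.fst_add, Prod.snd_add, smul_add]
    exact add_mem ha hb
  | neg a _ ha =>
    simp only [Prod.fst_neg, Prod.snd_neg, smul_neg]
    exact neg_mem ha
  | mem v hv =>
    refine AddSubgroup.subset_closure ?_
    obtain ⟨σ, n, e, y, m, rfl⟩ | ⟨σ, n, e, y, m, hn, rfl⟩ := hv
    · exact Or.inl ⟨τ * σ, n, e, y, m, by simp only [mul_pow, mul_smul]⟩
    · exact Or.inr ⟨τ * σ, n, e, y, m, hn, by simp only [mul_pow, mul_smul, smul_zero]⟩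

theorem exists_mem_shriekGraph [Algebra.Smooth R S] [Fact p.Prime] (hS : (p : S) = 0)
    (hR : (p : R) = 0) (κ : CartierStructure p R M) (z : Shriek R S M) :
    ∃ z', (z, z') ∈ shriekGraph S κ := by
  have hadd : ∀ z z' : Shriek R S M, (∃ v, (z, v) ∈ shriekGraph S κ) →
      (∃ v, (z', v) ∈ shriekGraph S κ) → ∃ v, (z + z', v) ∈ shriekGraph S κ := by
    rintro z z' ⟨v, hv⟩ ⟨v', hv'⟩
    exact ⟨v + v', add_mem hv hv'⟩
  induction z using TensorProduct.induction_on with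
  | zero => exact ⟨0, zero_mem _⟩
  | add x y hx hy => exact hadd _ _ hx hy
  | tmul w m =>
    refine shriek_induction (p := p) (N := ⊤) (P := fun z => ∃ z', (z, z') ∈ shriekGraph S κ) hS hR
      ⟨0, zero_mem _⟩ hadd (fun σ n e y m _ => ?_) (fun σ n e y hn m _ => ?_) w m trivial
    · exact ⟨_, AddSubgroup.subset_closure (Or.inl ⟨σ, n, e, y, m, rfl⟩)⟩
    · exact ⟨_, AddSubgroup.subset_closure (Or.inr ⟨σ, n, e, y, m, hn, rfl⟩)⟩

/-- On the locus with étale coordinates the graph is contained in the graph of the Cartier operator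
that the coordinates define. -/
theorem map_fst_of_mem_shriekGraph [Fact p.Prime] {T : Type*} [CommRing T] [Algebra S T]
    [Algebra R T] [IsScalarTower R S T] {n : ℕ} [Algebra (MvPolynomial (Fin n) R) T]
    [IsScalarTower R (MvPolynomial (Fin n) R) T] [Algebra.Etale (MvPolynomial (Fin n) R) T]
    [CharP R p] [CharP T p] {κT : CartierStructure p T (T ⊗[R] M)}
    (hκT : ∀ (c : Fin n →₀ ℕ) (m : M), κT (coordMonomial R T c ⊗ₜ m) = cartierMonomial T κ c m)
    {z : Shriek R S M × Shriek R S M} (hz : z ∈ shriekGraph S κ) :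
    κT (TensorProduct.AlgebraTensorModule.rTensor R M (formCoeff R S T n) z.1) =
      TensorProduct.AlgebraTensorModule.rTensor R M (formCoeff R S T n) z.2 := by
  have hp : p.Prime := Fact.out
  induction hz using AddSubgroup.closure_induction with
  | zero => simp only [Prod.fst_zero, Prod.snd_zero, map_zero]
  | add a b _ _ ha hb => simp only [Prod.fst_add, Prod.snd_add, map_add, ha, hb]
  | neg a _ ha => simp only [Prod.fst_neg, Prod.snd_neg, map_neg, ha]
  | mem z hz =>
    obtain ⟨σ, n', e, y, m, rfl⟩ | ⟨σ, n', e, y, m, hn, rfl⟩ := hz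
    · simp only [map_smul, TensorProduct.AlgebraTensorModule.rTensor_tmul]
      rw [← algebraMap_smul T (σ ^ p), map_pow, κT.map_pow_smul, algebraMap_smul]
      by_cases h : n' = n
      · subst h
        have he : algebraMap S T e = algebraMap S T e ^ p := by
          rw [← map_pow, ← Nat.sub_add_cancel hp.one_le, e.2.1.pow_succ_eq]
        rw [formCoeff_topForm, ← algebraMap_smul T ((∏ i, y i) ^ (p - 1)), smul_eq_mul, he,
          mul_left_comm, κT.map_pow_mul_tmul, map_pow, map_prod,
          cartier_prod_pow_mul_jac_tmul hκT, ← he, TensorProduct.smul_tmul', smul_eq_mul]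
      · rw [formCoeff_topForm_of_ne h, smul_zero, TensorProduct.zero_tmul, TensorProduct.zero_tmul,
          map_zero]
    · simp only [map_smul, map_zero, TensorProduct.AlgebraTensorModule.rTensor_tmul]
      rw [← algebraMap_smul T (σ ^ p), map_pow, κT.map_pow_smul]
      by_cases h : n' = n
      · subst h
        have he : algebraMap S T e = algebraMap S T e ^ p := by
          rw [← map_pow, ← Nat.sub_add_cancel hp.one_le, e.2.1.pow_succ_eq]
        rw [formCoeff_topForm, he, κT.map_pow_mul_tmul, cartier_jac_tmul hκT hn, smul_zero, smul_zero]
      · rw [formCoeff_topForm_of_ne h, TensorProduct.zero_tmul, map_zero, smul_zero]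

/-- The graph is single-valued, because it is so locally and `ω ⊗ M` localizes to `T ⊗ M`. -/
theorem eq_zero_of_mem_shriekGraph [Algebra.Smooth R S] [Fact p.Prime] (hS : (p : S) = 0)
    (hR : (p : R) = 0) {z : Shriek R S M} (hz : (0, z) ∈ shriekGraph S κ) : z = 0 := by
  have hp : p.Prime := Fact.out
  suffices Ideal.torsionOf S _ z = ⊤ from (Ideal.torsionOf_eq_top_iff (R := S) z).1 this
  by_contra hI
  obtain ⟨q, hq, hIq⟩ := Ideal.exists_le_maximal _ hI
  obtain ⟨s, hs, n, _, _, _⟩ := exists_etale_coordinates (R := R) ⟨q, hq.isPrime⟩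
  have := nontrivial_localization_of_notMem ⟨q, hq.isPrime⟩ hs
  have := charP_of_natCast_eq_zero (A := Localization.Away s) hp (by
    rw [← map_natCast (algebraMap S (Localization.Away s)), hS, map_zero])
  have : Nontrivial R := (algebraMap R (Localization.Away s)).domain_nontrivial
  have := charP_of_natCast_eq_zero hp hR
  obtain ⟨κT, hκT⟩ := exists_cartierStructure_coord (T := Localization.Away s) n κ
  have h0 := map_fst_of_mem_shriekGraph hκT hz
  simp only [map_zero] at h0
  have := isLocalizedModule_formCoeff (p := p) (R := R) (T := Localization.Away s) (n := n) (s := s)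
  obtain ⟨⟨_, l, rfl⟩, hl⟩ := IsLocalizedModule.exists_of_eq (S := Submonoid.powers s)
    (f := TensorProduct.AlgebraTensorModule.rTensor R M (formCoeff R S (Localization.Away s) n))
    (h0.symm.trans (map_zero _).symm)
  rw [smul_zero] at hl
  exact hs (hq.isPrime.mem_of_pow_mem l (hIq ((Ideal.mem_torsionOf_iff z _).2 hl)))

variable (S) in
/-- The module `ω ⊗ M` carries exactly one Cartier structure that obeys the two rules. -/
theorem existsUnique_isShriekStructure [Algebra.Smooth R S] [Fact p.Prime] (hS : (p : S) = 0)
    (hR : (p : R) = 0) (κ : CartierStructure p R M) :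
    ∃! κ' : CartierStructure p S (Shriek R S M), IsShriekStructure κ κ' := by
  choose F hF using exists_mem_shriekGraph hS hR κ
  have huniq : ∀ {z z'}, (z, z') ∈ shriekGraph S κ → F z = z' := fun {z z'} h =>
    sub_eq_zero.1 (eq_zero_of_mem_shriekGraph hS hR (z := F z - z')
      (by simpa using sub_mem (hF z) h))
  let κ' : CartierStructure p S (Shriek R S M) :=
    { toFun := F
      map_zero' := huniq (zero_mem _)
      map_add' := fun z z' => huniq (add_mem (hF z) (hF z'))
      map_pow_smul' := fun τ z => huniq (smul_mem_shriekGraph τ (hF z)) }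
  have h : IsShriekStructure κ κ' := by
    refine ⟨fun n e y m => huniq ?_, fun n e y m => huniq ?_⟩
    · exact AddSubgroup.subset_closure (Or.inr ⟨1, n + 1, e, y, m, n.succ_ne_zero, by
        rw [one_pow, one_smul]⟩)
    · exact AddSubgroup.subset_closure (Or.inl ⟨1, n, e, y, m, by
        rw [one_pow, one_smul, one_smul]⟩)
  exact ⟨κ', h, fun κ'' h'' => h''.unique hS hR h⟩

end ShriekStructure

/-! ### Pullbacks of submodules -/

section Frame

variable {p : ℕ} {R S : Type*} [CommRing R] [CommRing S] [Algebra R S]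

/-- Locally on `Spec S` the module `ω` is generated by a form `dx₁ ∧ ⋯ ∧ dxₙ`, the ring `S` by the
monomials in the `xᵢ` over `R` and the `p`-th powers, and `f dx₁ ∧ ⋯ ∧ dxₙ ⊗ m` vanishes only if
`f ⊗ m` does. -/
theorem exists_frame [Algebra.Smooth R S] [Fact p.Prime] (hS : (p : S) = 0) (hR : (p : R) = 0)
    (M : Type*) [AddCommGroup M] [Module R M] (q : PrimeSpectrum S) :
    ∃ s ∉ q.asIdeal, ∃ (n : ℕ) (e : relDimIdempotents R S n) (x : Fin n → S),
      (∀ w : relDualizing R S, ∃ (l : ℕ) (σ : S), s ^ l • w = σ • topForm R e x) ∧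
      (∀ z : S, ∃ l : ℕ, s ^ (p * l) * z ∈ AddSubmonoid.closure
        {y : S | ∃ (r : R) (t : S) (a : Fin n → Fin p),
          y = algebraMap R S r * t ^ p * ∏ i, x i ^ (a i : ℕ)}) ∧
      ∀ (f : S) (m : M), f • (topForm R e x ⊗ₜ[R] m) = 0 →
        ∃ l : ℕ, (s ^ l * f) ⊗ₜ[R] m = 0 := by
  have hp : p.Prime := Fact.out
  obtain ⟨s, hs, n, _, _, _⟩ := exists_etale_coordinates (R := R) q
  refine ⟨s, hs, n, ?_⟩
  let T := Localization.Away s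
  have := nontrivial_localization_of_notMem q hs
  have := charP_of_natCast_eq_zero (A := T) hp (by
    rw [← map_natCast (algebraMap S T), hS, map_zero])
  have : Nontrivial R := (algebraMap R T).domain_nontrivial
  have := charP_of_natCast_eq_zero hp hR
  obtain ⟨x, k, hx⟩ := exists_coord R T n s hp.pos
  obtain ⟨e, k', he⟩ := exists_relDimIdempotents_pow_mul R T n s
  refine ⟨e, x, exists_pow_smul_eq_smul_topForm hx he, exists_pow_mul_mem_closure hx,
    fun f m hf => ?_⟩
  have heT : algebraMap S T (s ^ k' * e) = algebraMap S T (s ^ k') := congrArg _ he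
  have h1 := congrArg (fun z => s ^ k' •
    TensorProduct.AlgebraTensorModule.rTensor R M (formCoeff R S T n) z) hf
  simp only [map_smul, map_zero, smul_zero, TensorProduct.AlgebraTensorModule.rTensor_tmul] at h1
  rw [formCoeff_topForm, jac_coord hx, TensorProduct.smul_tmul', TensorProduct.smul_tmul',
    smul_comm, Algebra.smul_def (s ^ k'), ← mul_assoc, ← map_mul, he, Algebra.smul_def f,
    ← map_mul, ← map_mul, ← pow_add, mul_comm] at h1
  set N := k' + (∑ i, k i) * p
  obtain ⟨⟨_, l, rfl⟩, hl⟩ := IsLocalizedModule.exists_of_eq (S := Submonoid.powers s)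
    (f := TensorProduct.AlgebraTensorModule.rTensor R M (Algebra.linearMap S T))
    (x₁ := (s ^ N * f) ⊗ₜ[R] m) (x₂ := 0) (by rw [map_zero]; exact h1)
  refine ⟨l + N, ?_⟩
  rw [smul_zero] at hl
  have h2 : s ^ l • ((s ^ N * f) ⊗ₜ[R] m) = 0 := hl
  rwa [TensorProduct.smul_tmul', smul_eq_mul, ← mul_assoc, ← pow_add] at h2

theorem relDualizing_finite [Algebra.Smooth R S] [Fact p.Prime] (hS : (p : S) = 0)
    (hR : (p : R) = 0) : Module.Finite S (relDualizing R S) := by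
  choose s hs n e x h1 _ _ using exists_frame (S := S) hS hR R
  have htop : Ideal.span (Set.range s) = ⊤ := by
    by_contra hI
    obtain ⟨q, hq, hIq⟩ := Ideal.exists_le_maximal _ hI
    exact hs ⟨q, hq.isPrime⟩ (hIq (Ideal.subset_span ⟨_, rfl⟩))
  obtain ⟨t, ht, htop⟩ := (Ideal.span_eq_top_iff_finite _).1 htop
  choose q hq using fun a : t => ht a.2
  refine ⟨Submodule.fg_def.2 ⟨Set.range fun a => topForm R (e (q a)) (x (q a)), Set.finite_range _,
    eq_top_iff.2 fun w _ => ?_⟩⟩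
  refine Submodule.mem_of_span_eq_top_of_smul_pow_mem _ _ htop w fun a => ?_
  obtain ⟨l, σ, h⟩ := h1 (q a) w
  refine ⟨l, ?_⟩
  rw [← hq a, h]
  exact Submodule.smul_mem _ _ (Submodule.subset_span ⟨a, rfl⟩)

end Frame

section ShriekSubmodule

variable {p : ℕ} {R S M : Type*} [CommRing R] [CommRing S] [Algebra R S] [AddCommGroup M]
  [Module R M]

theorem tmul_mem_shriekSubmodule {N : Submodule R M} (w : relDualizing R S) {m : M} (hm : m ∈ N) :
    w ⊗ₜ[R] m ∈ shriekSubmodule S N :=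
  ⟨w ⊗ₜ[R] (⟨m, hm⟩ : N), rfl⟩

theorem shriekSubmodule_induction {N : Submodule R M} {P : Shriek R S M → Prop} (zero : P 0)
    (add : ∀ z z', P z → P z' → P (z + z')) (tmul : ∀ (w : relDualizing R S), ∀ m ∈ N, P (w ⊗ₜ[R] m))
    {z : Shriek R S M} (hz : z ∈ shriekSubmodule S N) : P z := by
  obtain ⟨z, rfl⟩ := hz
  induction z using TensorProduct.induction_on with
  | zero => rwa [map_zero]
  | add x y hx hy => rw [map_add]; exact add _ _ hx hy
  | tmul w m => exact tmul w m m.2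

theorem shriekSubmodule_le_iff {N : Submodule R M} {Q : Submodule S (Shriek R S M)} :
    shriekSubmodule S N ≤ Q ↔ ∀ w : relDualizing R S, ∀ m ∈ N, w ⊗ₜ[R] m ∈ Q :=
  ⟨fun h w _ hm => h (tmul_mem_shriekSubmodule w hm), fun h _ hz =>
    shriekSubmodule_induction Q.zero_mem (fun _ _ => Q.add_mem) h hz⟩

theorem shriekSubmodule_mono : Monotone (shriekSubmodule (R := R) (M := M) S) := fun _ _ h =>
  shriekSubmodule_le_iff.2 fun w _ hm => tmul_mem_shriekSubmodule w (h hm)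

theorem shriekSubmodule_top : shriekSubmodule S (⊤ : Submodule R M) = ⊤ := by
  refine eq_top_iff.2 fun z _ => ?_
  induction z using TensorProduct.induction_on with
  | zero => exact zero_mem _
  | add x y hx hy => exact add_mem (hx trivial) (hy trivial)
  | tmul w m => exact tmul_mem_shriekSubmodule w trivial

theorem shriekSubmodule_iSup {ι : Sort*} (N : ι → Submodule R M) :
    shriekSubmodule S (⨆ i, N i) = ⨆ i, shriekSubmodule S (N i) := by
  refine le_antisymm (shriekSubmodule_le_iff.2 fun w m hm => ?_)
    (iSup_le fun i => shriekSubmodule_mono (le_iSup N i))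
  induction hm using Submodule.iSup_induction' with
  | mem i m hm => exact Submodule.mem_iSup_of_mem i (tmul_mem_shriekSubmodule w hm)
  | zero => rw [TensorProduct.tmul_zero]; exact zero_mem _
  | add a b _ _ ha hb => rw [TensorProduct.tmul_add]; exact add_mem ha hb

theorem shriekSubmodule_smul (𝔞 : Ideal R) (N : Submodule R M) :
    shriekSubmodule S (𝔞 • N) = 𝔞.map (algebraMap R S) • shriekSubmodule S N := by
  refine le_antisymm (shriekSubmodule_le_iff.2 fun w m hm => ?_) ?_
  · induction hm using Submodule.smul_induction_on' with
    | smul r hr m hm =>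
      rw [TensorProduct.tmul_smul, ← algebraMap_smul S r]
      exact Submodule.smul_mem_smul (Ideal.mem_map_of_mem _ hr) (tmul_mem_shriekSubmodule w hm)
    | add a _ b _ ha hb => rw [TensorProduct.tmul_add]; exact add_mem ha hb
  · rw [Ideal.map, Submodule.smul_le]
    intro a ha z hz
    suffices Ideal.span (algebraMap R S '' 𝔞) ≤
        (shriekSubmodule S (𝔞 • N)).comap (LinearMap.toSpanSingleton S _ z) from this ha
    refine Ideal.span_le.2 ?_
    rintro _ ⟨r, hr, rfl⟩
    change algebraMap R S r • z ∈ shriekSubmodule S (𝔞 • N)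
    refine shriekSubmodule_induction (P := fun z => algebraMap R S r • z ∈ shriekSubmodule S (𝔞 • N))
      (by rw [smul_zero]; exact zero_mem _) (fun z z' h h' => by rw [smul_add]; exact add_mem h h')
      (fun w m hm => ?_) hz
    rw [algebraMap_smul, ← TensorProduct.tmul_smul]
    exact tmul_mem_shriekSubmodule w (Submodule.smul_mem_smul hr hm)

variable [Algebra.Smooth R S] [Fact p.Prime] (hS : (p : S) = 0) (hR : (p : R) = 0)
  {κ : CartierStructure p R M} {κ' : CartierStructure p S (Shriek R S M)}
  (h : IsShriekStructure κ κ')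
include hS hR h

theorem IsShriekStructure.apply_mem {N : Submodule R M} {z : Shriek R S M}
    (hz : z ∈ shriekSubmodule S N) : κ' z ∈ shriekSubmodule S (κ.image N) := by
  refine shriekSubmodule_induction (P := fun z => κ' z ∈ shriekSubmodule S (κ.image N))
    (by rw [map_zero]; exact zero_mem _) (fun z z' h h' => by rw [map_add]; exact add_mem h h')
    (shriek_induction (p := p) (P := fun z => κ' z ∈ shriekSubmodule S (κ.image N)) hS hR
      (by rw [map_zero]; exact zero_mem _) (fun z z' h h' => by rw [map_add]; exact add_mem h h')
      (fun σ n e y m hm => ?_) (fun σ n e y hn m hm => ?_)) hz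
  · rw [κ'.map_pow_smul, h.cartier]
    exact Submodule.smul_mem _ _ (tmul_mem_shriekSubmodule _ ⟨m, hm, rfl⟩)
  · rw [κ'.map_pow_smul, h.exact_eq_zero_of_ne hn, smul_zero]
    exact zero_mem _

theorem IsShriekStructure.image_shriekSubmodule (N : Submodule R M) :
    κ'.image (shriekSubmodule S N) = shriekSubmodule S (κ.image N) := by
  refine le_antisymm ?_ (shriekSubmodule_le_iff.2 ?_)
  · rintro _ ⟨z, hz, rfl⟩
    exact h.apply_mem hS hR hz
  · have hmem : ∀ (n : ℕ) (e : relDimIdempotents R S n) (y : Fin n → S), ∀ m ∈ κ.image N,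
        topForm R e y ⊗ₜ[R] m ∈ κ'.image (shriekSubmodule S N) := by
      rintro n e y _ ⟨m, hm, rfl⟩
      exact ⟨_, tmul_mem_shriekSubmodule _ hm, h.cartier n e y m⟩
    refine shriek_induction (p := p) hS hR (zero_mem _) (fun z z' => add_mem)
      (fun σ n e y m hm => Submodule.smul_mem _ _ ?_)
      (fun σ n e y hn m hm => Submodule.smul_mem _ _ (hmem n e y m hm))
    rw [← TensorProduct.smul_tmul']
    exact Submodule.smul_mem _ _ (hmem n e y m hm)

theorem IsShriekStructure.image_iterate_shriekSubmodule (k : ℕ) (N : Submodule R M) :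
    κ'.image^[k] (shriekSubmodule S N) = shriekSubmodule S (κ.image^[k] N) :=
  (Function.Semiconj.iterate_right (fun N => (h.image_shriekSubmodule hS hR N).symm) k N).symm

theorem IsShriekStructure.plusAct_shriekSubmodule (𝔞 : Ideal R) (t : ℚ) (N : Submodule R M) :
    plusAct κ' (𝔞.map (algebraMap R S)) t (shriekSubmodule S N) =
      shriekSubmodule S (plusAct κ 𝔞 t N) := by
  simp only [plusAct, shriekSubmodule_iSup, ← h.image_iterate_shriekSubmodule hS hR,
    shriekSubmodule_smul, Ideal.map_pow]

theorem IsShriekStructure.plusAct_iterate_shriekSubmodule (𝔞 : Ideal R) (t : ℚ)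
    (N : Submodule R M) (k : ℕ) :
    (plusAct κ' (𝔞.map (algebraMap R S)) t)^[k] (shriekSubmodule S N) =
      shriekSubmodule S ((plusAct κ 𝔞 t)^[k] N) :=
  (Function.Semiconj.iterate_right (fun N => (h.plusAct_shriekSubmodule hS hR 𝔞 t N).symm) k N).symm

theorem IsShriekStructure.iterate_eq_shriekSubmodule_fPurePart (𝔞 : Ideal R) (t : ℚ) {h₀ : ℕ}
    (h₀_spec : ∀ k ≥ h₀, (plusAct κ 𝔞 t)^[k] ⊤ = fPurePart κ 𝔞 t) {k : ℕ} (hk : k ≥ h₀) :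
    (plusAct κ' (𝔞.map (algebraMap R S)) t)^[k] ⊤ = shriekSubmodule S (fPurePart κ 𝔞 t) := by
  rw [← shriekSubmodule_top, h.plusAct_iterate_shriekSubmodule hS hR, h₀_spec k hk]

theorem IsShriekStructure.fPurePart_eq (𝔞 : Ideal R) (t : ℚ) {h₀ : ℕ}
    (h₀_spec : ∀ k ≥ h₀, (plusAct κ 𝔞 t)^[k] ⊤ = fPurePart κ 𝔞 t) :
    fPurePart κ' (𝔞.map (algebraMap R S)) t = shriekSubmodule S (fPurePart κ 𝔞 t) := by
  have hit := fun {k} => h.iterate_eq_shriekSubmodule_fPurePart hS hR 𝔞 t h₀_spec (k := k)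
  refine le_antisymm ((fPurePart_le_iterate h₀).trans (hit le_rfl).le) (le_iInf fun k => ?_)
  rw [← hit (le_max_left h₀ k)]
  exact plusAct_iterate_antitone (le_max_right h₀ k)

end ShriekSubmodule

/-! ### Test modules of pullbacks -/

section ShriekChart

variable {p : ℕ} {R S M : Type*} [CommRing R] [CommRing S] [Algebra R S] [AddCommGroup M]
  [Module R M] [Algebra.Smooth R S] [Fact p.Prime]
  {κ : CartierStructure p R M} {κ' : CartierStructure p S (Shriek R S M)}

theorem IsShriekStructure.iterate_apply_eq_zero (h : IsShriekStructure κ κ') (hS : (p : S) = 0)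
    (hR : (p : R) = 0) {k : ℕ} {v : M} (hv : v ∈ nilSubmodule κ k) (w : relDualizing R S) :
    κ'^[k] (w ⊗ₜ v) = 0 := by
  have h0 : κ.image^[k] (Submodule.span R {v}) = ⊥ := by
    refine eq_bot_iff.2 fun z hz => ?_
    obtain ⟨y, hy, rfl⟩ := CartierStructure.mem_image_iterate.1 hz
    obtain ⟨r, rfl⟩ := Submodule.mem_span_singleton.1 hy
    exact mem_nilSubmodule.1 hv r
  have h1 : κ'^[k] (w ⊗ₜ v) ∈ shriekSubmodule S (⊥ : Submodule R M) := by
    rw [← h0, ← h.image_iterate_shriekSubmodule hS hR]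
    exact CartierStructure.mem_image_iterate.2
      ⟨_, tmul_mem_shriekSubmodule w (Submodule.mem_span_singleton_self v), rfl⟩
  refine (Submodule.mem_bot S).1 (shriekSubmodule_le_iff.2 (fun w m hm => ?_) h1)
  rw [(Submodule.mem_bot R).1 hm, TensorProduct.tmul_zero]
  exact zero_mem _

/-- A frame of `ω` defines a chart for the Cartier module `ω ⊗ M`. -/
theorem IsShriekStructure.isChart (h : IsShriekStructure κ κ') (hS : (p : S) = 0)
    (hR : (p : R) = 0) {s : S} {n : ℕ} (e : relDimIdempotents R S n) (x : Fin n → S)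
    (hs : ∀ z : S, ∃ l : ℕ, s ^ (p * l) * z ∈ AddSubmonoid.closure
      {y : S | ∃ (r : R) (t : S) (a : Fin n → Fin p),
        y = algebraMap R S r * t ^ p * ∏ i, x i ^ (a i : ℕ)}) :
    IsChart κ κ' s (TensorProduct.mk R (relDualizing R S) M (topForm R e x))
      (fun a : Fin n → Fin p => ∏ i, x i ^ (a i : ℕ))
      (fun a : Fin n → Fin p => ∏ i, x i ^ (p - 1 - (a i : ℕ))) where
  orth a a' m := by
    rw [TensorProduct.mk_apply, TensorProduct.mk_apply, TensorProduct.smul_tmul',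
      ← Finset.prod_mul_distrib]
    simp only [← pow_add]
    split_ifs with haa
    · subst haa
      have : ∀ i, (a i : ℕ) + (p - 1 - (a i : ℕ)) = p - 1 := fun i => by
        have := (a i).2
        omega
      simp only [this, Finset.prod_pow]
      exact h.cartier n e x m
    · obtain ⟨i, hi⟩ := Function.ne_iff.1 haa
      have hdvd : ¬ p ∣ (a' i : ℕ) + (p - 1 - (a i : ℕ)) + 1 := by
        rintro ⟨k, hk⟩
        refine hi (Fin.ext ?_)
        have h1 := (a i).2
        have h2 := (a' i).2
        have hk1 : k = 1 := by
          rcases k with - | - | k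
          · omega
          · rfl
          · have : p * (k + 1 + 1) = p * k + 2 * p := by ring
            omega
        subst hk1
        omega
      obtain ⟨r, y, hy⟩ := exists_prod_pow_smul_topForm (Fact.out : p.Prime) hS e x
        (fun i => (a' i : ℕ) + (p - 1 - (a i : ℕ))) hdvd
      rw [hy, ← TensorProduct.smul_tmul', map_nsmul, h.exact_eq_zero_of_ne
        (by rintro rfl; exact i.elim0), smul_zero]
  span z := let ⟨l, hl⟩ := hs z; ⟨p * l, hl⟩
  nil k v hv σ := by
    rw [TensorProduct.mk_apply, TensorProduct.smul_tmul']
    exact h.iterate_apply_eq_zero hS hR hv _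

end ShriekChart

section Support

variable {p : ℕ} {R S M : Type*} [CommRing R] [CommRing S] [Algebra R S] [AddCommGroup M]
  [Module R M] [Algebra.Smooth R S] [Fact p.Prime]

theorem mem_support_submodule_iff {A Z : Type*} [CommRing A] [AddCommGroup Z] [Module A Z]
    {Q : Submodule A Z} {η : PrimeSpectrum A} :
    η ∈ Module.support A Q ↔ ∃ z ∈ Q, ∀ f : A, f • z = 0 → f ∈ η.asIdeal := by
  rw [Module.mem_support_iff_exists_annihilator]
  constructor
  · rintro ⟨⟨z, hz⟩, h⟩
    exact ⟨z, hz, fun f hf => h ((Submodule.mem_annihilator_span_singleton _ _).2 (Subtype.ext hf))⟩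
  · rintro ⟨z, hz, h⟩
    exact ⟨⟨z, hz⟩, fun f hf => h f
      (congrArg Subtype.val ((Submodule.mem_annihilator_span_singleton _ _).1 hf))⟩

/-- The support of the submodule `N` of `M`. For submodules of a tensor product, the abbreviation lets
the module structure be found from that of `M`. -/
abbrev submoduleSupport {R M : Type*} [CommRing R] [AddCommGroup M] [Module R M]
    (N : Submodule R M) : Set (PrimeSpectrum R) :=
  Module.support R N

/-- The support of `f^! P` is the preimage of the support of `P`. -/
theorem mem_support_shriekSubmodule_iff [IsNoetherianRing R] [Module.Finite R M] (hS : (p : S) = 0)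
    (hR : (p : R) = 0) (P : Submodule R M) (η : PrimeSpectrum S) :
    η ∈ submoduleSupport (R := S) (M := Shriek R S M) (shriekSubmodule S P) ↔
      PrimeSpectrum.comap (algebraMap R S) η ∈ Module.support R P := by
  constructor
  · intro hη
    obtain ⟨z, hz, hzη⟩ := (mem_support_submodule_iff (A := S) (Z := Shriek R S M)).1 hη
    rw [Module.mem_support_iff_of_finite]
    intro r hr
    refine hzη _ ?_
    refine shriekSubmodule_induction (P := fun z => algebraMap R S r • z = 0)
      (by rw [smul_zero]) (fun z z' h h' => by rw [smul_add, h, h', add_zero])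
      (fun w m hm => ?_) hz
    have hrm : r • m = 0 := congrArg Subtype.val (Module.mem_annihilator.1 hr ⟨m, hm⟩)
    rw [algebraMap_smul, ← TensorProduct.tmul_smul, hrm, TensorProduct.tmul_zero]
  · intro hη
    obtain ⟨m, hm, hmη⟩ := mem_support_submodule_iff.1 hη
    obtain ⟨s, hs, n, e, x, -, -, h⟩ := exists_frame hS hR M η
    refine (mem_support_submodule_iff (A := S) (Z := Shriek R S M)).2
      ⟨topForm R e x ⊗ₜ m, tmul_mem_shriekSubmodule _ hm, fun f hf => ?_⟩
    obtain ⟨l, hl⟩ := h f m hf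
    suffices s ^ l * f ∈ η.asIdeal from
      (η.2.mem_or_mem this).resolve_left fun h' => hs (η.2.mem_of_pow_mem l h')
    -- `S` is flat over `R`, so that the submodule `R m ≅ R / J` of `M` remains a submodule.
    let J : Ideal R := Ideal.torsionOf R M m
    have hJη : J ≤ η.asIdeal.comap (algebraMap R S) := fun r hr =>
      hmη r hr
    let j : (R ⧸ J) →ₗ[R] M := J.liftQ (LinearMap.toSpanSingleton R M m) le_rfl
    have hj : Function.Injective j := by
      rw [← LinearMap.ker_eq_bot]
      exact Submodule.ker_liftQ_eq_bot _ _ _ le_rfl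
    have h1 : (s ^ l * f) ⊗ₜ[R] (1 : R ⧸ J) = 0 := by
      refine Module.Flat.lTensor_preserves_injective_linearMap (M := S) j hj ?_
      rw [map_zero, LinearMap.lTensor_tmul, ← hl]
      congr 1
      exact one_smul R m
    let φ : S ⊗[R] (R ⧸ J) →ₐ[R] S ⧸ η.asIdeal := Algebra.TensorProduct.lift
      (Ideal.Quotient.mkₐ R η.asIdeal)
      (Ideal.Quotient.liftₐ J (Algebra.ofId R (S ⧸ η.asIdeal)) fun r hr =>
        Ideal.Quotient.eq_zero_iff_mem.2 (hJη hr)) fun _ _ => Commute.all _ _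
    have h2 := congrArg φ h1
    rw [map_zero, Algebra.TensorProduct.lift_tmul, map_one, mul_one] at h2
    exact Ideal.Quotient.eq_zero_iff_mem.1 h2

/-- The generic points of the support of `f^! P` lie over generic points of the support of `P`, by
going down for the flat algebra `S`. -/
theorem minimal_comap_support [IsNoetherianRing R] [Module.Finite R M] (hS : (p : S) = 0)
    (hR : (p : R) = 0) {P : Submodule R M} {η : PrimeSpectrum S}
    (hη : Minimal (· ∈ submoduleSupport (R := S) (M := Shriek R S M) (shriekSubmodule S P)) η) :
    Minimal (· ∈ Module.support R P) (PrimeSpectrum.comap (algebraMap R S) η) := by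
  refine ⟨(mem_support_shriekSubmodule_iff hS hR P η).1 hη.1, fun η₁ hη₁ hle => ?_⟩
  have : η.asIdeal.LiesOver (η.asIdeal.comap (algebraMap R S)) := ⟨rfl⟩
  obtain ⟨Q, hQ, hQp, hQo⟩ := Ideal.exists_ideal_le_liesOver_of_le
    (p := η₁.asIdeal) (q := η.asIdeal.comap (algebraMap R S)) η.asIdeal hle
  have hcomap : PrimeSpectrum.comap (algebraMap R S) ⟨Q, hQp⟩ = η₁ :=
    PrimeSpectrum.ext hQo.over.symm
  have h1 : (⟨Q, hQp⟩ : PrimeSpectrum S) ∈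
      submoduleSupport (R := S) (M := Shriek R S M) (shriekSubmodule S P) :=
    (mem_support_shriekSubmodule_iff hS hR P _).2 (hcomap ▸ hη₁)
  have h2 : η ≤ ⟨Q, hQp⟩ := hη.2 h1 hQ
  rw [← hcomap]
  exact Ideal.comap_mono h2

end Support

section Main

variable {p : ℕ} {R S M : Type*} [CommRing R] [CommRing S] [Algebra R S] [AddCommGroup M]
  [Module R M] [Algebra.Smooth R S] [Fact p.Prime] [IsNoetherianRing R] [Module.Finite R M]
  {κ : CartierStructure p R M} {κ' : CartierStructure p S (Shriek R S M)} {𝔞 : Ideal R} {t : ℚ}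

theorem shriek_isNoetherian (hS : (p : S) = 0) (hR : (p : R) = 0) :
    IsNoetherian S (Shriek R S M) := by
  have := Algebra.FiniteType.isNoetherianRing R S
  have := relDualizing_finite hS hR
  have : Module.Finite S (Shriek R S M) := Module.Finite.equiv
    (TensorProduct.AlgebraTensorModule.cancelBaseChange R S S (relDualizing R S) M)
  exact isNoetherian_of_isNoetherianRing_of_finite S (Shriek R S M)

/-- The denominators of the splittings of `P` are test elements for `f^! P`. -/
theorem IsShriekStructure.exists_pow_smul_mem (h : IsShriekStructure κ κ') (hS : (p : S) = 0)
    (hR : (p : R) = 0) {P : Submodule R M} (hP : plusAct κ 𝔞 t P = P) {c : R}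
    (hc : c ∈ splittingElements κ 𝔞 t P) {N' : Submodule S (Shriek R S M)}
    (hN' : IsCartierSubmodule κ' (𝔞.map (algebraMap R S)) t N')
    (hgen : GenericallyAgrees (R := S) (M := Shriek R S M) N' (shriekSubmodule S P)) :
    ∃ L : ℕ, ∀ z ∈ shriekSubmodule S P, algebraMap R S c ^ L • z ∈ N' := by
  have hp : p.Prime := Fact.out
  have : IsNoetherianRing S := Algebra.FiniteType.isNoetherianRing R S
  have hnoeth : IsNoetherian S (Shriek R S M) := shriek_isNoetherian hS hR
  obtain ⟨hc𝔞, k, r, T, b, hsplit⟩ := hc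
  set C := algebraMap R S c
  -- the elements `f` such that `C` is a test element on the locus where `f` is invertible
  let I : Ideal S := Submodule.comap (LinearMap.mulLeft S C)
    (N'.colon (shriekSubmodule S P : Set (Shriek R S M))).radical

  suffices hI : I = ⊤ by
    have h1 : (1 : S) ∈ I := hI ▸ trivial
    rw [Submodule.mem_comap, LinearMap.mulLeft_apply, mul_one] at h1
    obtain ⟨L, hL⟩ := h1
    exact ⟨L, Submodule.mem_colon.1 hL⟩
  by_contra hI
  obtain ⟨q, hq, hIq⟩ := Ideal.exists_le_maximal _ hI
  obtain ⟨s, hs, n, e, x, hgenx, hspan, -⟩ := exists_frame hS hR M ⟨q, hq.isPrime⟩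
  have : Nontrivial S := ⟨s, 0, fun h0 => hs (h0 ▸ q.zero_mem)⟩
  have := charP_of_natCast_eq_zero hp hS
  refine hs (hIq ?_)
  obtain ⟨L, hL⟩ := exists_pow_smul_mem_of_generic (Z := Shriek R S M) hsplit
    (h.isChart hS hR e x hspan) (hc𝔞.imp_right (Ideal.mem_map_of_mem _))
    (P' := shriekSubmodule S P) (N' := N') (hnoeth.noetherian _)
    (fun r hr z hz => shriekSubmodule_induction (P := fun z => r • z = 0) (smul_zero r)
      (fun z z' h h' => by rw [smul_add, h, h', add_zero])
      (fun w m hm => by rw [← TensorProduct.tmul_smul, hr m hm, TensorProduct.tmul_zero]) hz)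
    (fun m hm => tmul_mem_shriekSubmodule _ hm)
    (fun z hz => shriekSubmodule_induction (P := fun z => ∃ l : ℕ, s ^ l • z ∈ Submodule.span S
        (TensorProduct.mk R (relDualizing R S) M (topForm R e x) '' P))
      ⟨0, by rw [smul_zero]; exact zero_mem _⟩
      (fun z z' => by
        rintro ⟨l, hl⟩ ⟨l', hl'⟩
        refine ⟨l + l', ?_⟩
        rw [smul_add]
        refine add_mem ?_ ?_
        · rw [pow_add, mul_comm, mul_smul]
          exact Submodule.smul_mem _ _ hl
        · rw [pow_add, mul_smul]
          exact Submodule.smul_mem _ _ hl')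
      (fun w m hm => by
        obtain ⟨l, σ, hl⟩ := hgenx w
        refine ⟨l, ?_⟩
        rw [TensorProduct.smul_tmul', hl, ← TensorProduct.smul_tmul']
        exact Submodule.smul_mem _ _ (Submodule.subset_span ⟨m, hm, rfl⟩)) hz)
    (by rw [h.plusAct_shriekSubmodule hS hR, hP]) hN'
    (fun η hη => GenericallyAgrees.exists_smul_mem (R := S) (M := Shriek R S M) hgen hη)
  exact ⟨L, Submodule.mem_colon.2 hL⟩

/-- The pullback of the test module is the test module of the pullback. -/
theorem IsShriekStructure.isLeast_testCandidates (h : IsShriekStructure κ κ') (hS : (p : S) = 0)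
    (hR : (p : R) = 0) {k : ℕ} (hleast : IsLeast (testCandidates κ 𝔞 t) ((plusAct κ 𝔞 t)^[k]
      (Ideal.span (splittingElements κ 𝔞 t (fPurePart κ 𝔞 t)) • fPurePart κ 𝔞 t))) :
    IsLeast (testCandidates κ' (𝔞.map (algebraMap R S)) t) (shriekSubmodule S
      ((plusAct κ 𝔞 t)^[k]
        (Ideal.span (splittingElements κ 𝔞 t (fPurePart κ 𝔞 t)) • fPurePart κ 𝔞 t))) := by
  have hp : p.Prime := Fact.out
  obtain ⟨h₀, hh₀⟩ := exists_iterate_eq_fPurePart hp κ 𝔞 t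
  have hpure := h.fPurePart_eq hS hR 𝔞 t hh₀
  have hP : plusAct κ 𝔞 t (fPurePart κ 𝔞 t) = fPurePart κ 𝔞 t := plusAct_fPurePart hp κ 𝔞 t
  set P := fPurePart κ 𝔞 t
  set T := splittingElements κ 𝔞 t P
  have hle : (plusAct κ 𝔞 t)^[k] (Ideal.span T • P) ≤ P :=
    (plusAct_iterate_mono k Submodule.smul_le_right).trans (Function.iterate_fixed hP k).le
  refine ⟨⟨?_, ?_⟩, fun N' hN' => ?_⟩
  · rw [IsCartierSubmodule, h.plusAct_shriekSubmodule hS hR]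
    exact shriekSubmodule_mono hleast.1.1
  · rw [hpure]
    refine genericallyAgrees_of_le (shriekSubmodule_mono hle) fun η hη => ?_
    obtain ⟨r, hr, hrP⟩ := hleast.1.2.exists_smul_mem (minimal_comap_support hS hR hη)
    refine ⟨algebraMap R S r, hr, fun z hz => ?_⟩
    have := Submodule.smul_mem_smul (Ideal.mem_map_of_mem (algebraMap R S)
      (Ideal.mem_span_singleton_self r)) hz
    rw [← shriekSubmodule_smul] at this
    refine shriekSubmodule_mono (Submodule.smul_le.2 fun y hy m hm => ?_) this
    obtain ⟨y, rfl⟩ := Ideal.mem_span_singleton'.1 hy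
    rw [mul_smul]
    exact Submodule.smul_mem _ _ (hrP m hm)
  · rw [← h.plusAct_iterate_shriekSubmodule hS hR, shriekSubmodule_smul, Ideal.map_span]
    refine iterate_span_smul_le hp (by rw [h.plusAct_shriekSubmodule hS hR, hP]) hN'.1 ?_ k
    rintro _ ⟨c, hc, rfl⟩
    exact h.exists_pow_smul_mem hS hR hP hc hN'.1 (hpure ▸ hN'.2)

end Main

theorem testModuleExists_of_subsingleton {p : ℕ} {A Z : Type*} [CommRing A] [AddCommGroup Z]
    [Module A Z] [Subsingleton Z] (κ : CartierStructure p A Z) (𝔞 : Ideal A) (t : ℚ) :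
    TestModuleExists κ 𝔞 t :=
  ⟨⟨0, fun _ _ => Subsingleton.elim _ _⟩,
    ⟨(Subsingleton.elim _ _ : plusAct κ 𝔞 t _ = _).le, fun _ _ => Subsingleton.elim _ _⟩,
    fun _ _ => (Subsingleton.elim _ _ : testModule κ 𝔞 t = _).le⟩

end CartierModule

open CartierModule in
theorem corollary3p8 {p : ℕ} [Fact p.Prime] {k R S M : Type*} [Field k] [CharP k p]
    (hk : (frobenius k p).Finite)
    [CommRing R] [Algebra k R] [Algebra.EssFiniteType k R]
    [CommRing S] [Algebra R S] [Algebra.Smooth R S]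
    [AddCommGroup M] [Module R M] [Module.Finite R M]
    (κ : CartierStructure p R M) (𝔞 : Ideal R) (t : ℚ) (ht : 0 ≤ t) :
    (∃! κ' : CartierStructure p S (Shriek R S M), IsShriekStructure κ κ') ∧
    TestModuleExists κ 𝔞 t ∧
    TestModuleExists (shriekStructure S κ) (𝔞.map (algebraMap R S)) t ∧
    shriekSubmodule S (testModule κ 𝔞 t) =
      testModule (shriekStructure S κ) (𝔞.map (algebraMap R S)) t := by
  have hp : p.Prime := Fact.out
  have hR : (p : R) = 0 := by rw [← map_natCast (algebraMap k R), CharP.cast_eq_zero, map_zero]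
  have hS : (p : S) = 0 := by rw [← map_natCast (algebraMap R S), hR, map_zero]
  have : IsNoetherianRing R := Algebra.EssFiniteType.isNoetherianRing k R
  have huniq := existsUnique_isShriekStructure S hS hR κ
  have h : IsShriekStructure κ (shriekStructure S κ) := Classical.epsilon_spec huniq.exists
  refine ⟨huniq, ?_⟩
  obtain hsub | _ := subsingleton_or_nontrivial R
  · have : Subsingleton M := Module.subsingleton R M
    have : Subsingleton (Shriek R S M) := Module.subsingleton R _
    exact ⟨testModuleExists_of_subsingleton κ 𝔞 t, testModuleExists_of_subsingleton _ _ t,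
      Subsingleton.elim _ _⟩
  · have := charP_of_natCast_eq_zero hp hR
    obtain ⟨h₀, hh₀⟩ := exists_iterate_eq_fPurePart hp κ 𝔞 t
    obtain ⟨l, hleast⟩ := exists_isLeast_testCandidates (isFFinite_of_essFiniteType hk) κ 𝔞 ht
    have hleast' := h.isLeast_testCandidates hS hR hleast
    have hτ : testModule κ 𝔞 t = _ := hleast.isGLB.sInf_eq
    have hτ' : testModule (shriekStructure S κ) (𝔞.map (algebraMap R S)) t = _ :=
      hleast'.isGLB.sInf_eq
    refine ⟨⟨⟨h₀, hh₀⟩, hτ ▸ hleast⟩, ⟨⟨h₀, fun l hl => ?_⟩, hτ' ▸ hleast'⟩, by rw [hτ, hτ']⟩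
    rw [h.iterate_eq_shriekSubmodule_fPurePart hS hR 𝔞 t hh₀ hl, h.fPurePart_eq hS hR 𝔞 t hh₀]
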